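/- **Theorem (tangential trace estimates).** Let $n \ge 1$, $0 \le k \le n$, $r \ge 0$ be integers, $\gamma > 0$ and let $s \ge 0$ be a real number. There is a constant $C$, depending only on $n, k, r, s, \gamma$, such that the following holds. *Setting.* Let $\Omega \subset \mathbb{R}^n$ be a bounded polyhedral (Lipschitz) domain — more generally a bounded open set — and let $\mathcal{T}_h$ be a conforming mesh by finitely many nondegenerate $n$-simplices whose union is $\overline\Omega$ and whose interiors lie in $\Omega$. Put $h_K = \operatorname{diam} K$, $h = \max_K h_K$, and assume that $\mathcal{T}_h$ is shape-regular with constant $\gamma$: each $K \in \mathcal{T}_h$ contains a ball of some radius $\rho_K>0$ with $h_K \le \gamma \rho_K$. Let $H\Lambda^k(\Omega)$ be the space of $L^2$ $k$-forms with weak exterior derivative in $L^2$, let $\mathcal{P}_r\Lambda^k$ be the $k$-forms with polynomial coefficients of degree $\le r$, and let $\mathcal{P}_r^-\Lambda^k = \mathcal{P}_{r-1}\Lambda^k + \kappa \mathcal{P}_{r-1}\Lambda^{k+1}$, where $\kappa$ is contraction with the vector field $x \mapsto x$. Let $$W_h^{k-1}(K) = \mathcal{P}_{r+1}\Lambda^{k-1}(K)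 \text{ for all } K, \quad\text{or}\quad W_h^{k-1}(K) = \mathcal{P}_{r+1}^-\Lambda^{k-1}(K) \text{ for all } K,$$ $$W_h^{k}(K) = \mathcal{P}_{r}\Lambda^{k}(K) \text{ for all } K \ (\text{if } r \ge 1), \quad\text{or}\quad W_h^{k}(K) = \mathcal{P}_{r+1}^-\Lambda^{k}(K) \text{ for all } K,$$ and $V_h^{\ell} = \{ v \in H\Lambda^{\ell}(\Omega) : v|_K \in W_h^{\ell}(K)\ \forall K \in \mathcal{T}_h\}$ for $\ell = k-1, k$. For $f \in L^2\Lambda^k(\Omega)$ let $(\sigma,u,p)$ solve the mixed Hodge–Laplace problem: $\sigma \in V^{k-1}$, $u \in V^k$, $p \in \mathfrak{H}^k$ with $$(\sigma,\tau)_\Omega - (u,\mathrm{d}\tau)_\Omega = 0,\qquad (\mathrm{d}\sigma,v)_\Omega + (\mathrm{d}u,\mathrm{d}v)_\Omega + (p,v)_\Omega = (f,v)_\Omega,\qquad (u,q)_\Omega = 0$$ for all $\tau \in V^{k-1}$, $v \in V^k$, $q \in \mathfrak{H}^k$, where $V^{\ell} = H\Lambda^{\ell}(\Omega)$ and $\mathfrak{H}^k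 = \{ q \in V^k : \mathrm{d}q = 0,\ (q,\mathrm{d}\tau)_\Omega = 0\ \forall \tau \in V^{k-1}\}$; and let $(\sigma_h,u_h,p_h)$ solve the same problem with $V^{k-1},V^k$ replaced by $V_h^{k-1},V_h^k$. (For $k=0$ the variables $\sigma,\sigma_h$ are absent.) Assume that $\sigma$ and $u$ are in $H^1(K)$ for each $K \in \mathcal{T}_h$. For a form $v$ that is in $H^1$ on $K$, the tangential trace $v^{\mathrm{tan}}$ on $\partial K$ is its trace, restricted on each facet to vectors tangent to that facet. Let $|\!|\!|\cdot|\!|\!|_{\partial K} = h_K^{1/2} \|\cdot\|_{L^2(\partial K)}$ and $|\!|\!|\cdot|\!|\!|_{\partial\mathcal{T}_h} = \bigl(\sum_K |\!|\!|\cdot|\!|\!|_{\partial K}^2\bigr)^{1/2}$. Let $|\cdot|_{t}$ be the Sobolev seminorm of real order $t$ (Sobolev–Slobodeckij if $t$ is not an integer), taken to be $+\infty$ on forms that are not in $H^t$. *Conclusion.* The traces of $\sigma,\sigma_h,u,u_h$ exist in $L^2(\partial K)$ in each of the cases below, and for each $K \in \mathcal{T}_h$, $$|\!|\!|\sigma^{\mathrm{tan}}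 - \sigma_h^{\mathrm{tan}}|\!|\!|_{\partial K} \le C\bigl( \|\sigma-\sigma_h\|_K + h_K^{s+1} |\sigma|_{s+1,K}\bigr),\quad\text{if } \begin{cases} s \le r+1, & W_h^{k-1}(K) = \mathcal{P}_{r+1}\Lambda^{k-1}(K),\\ s \le r, & W_h^{k-1}(K) = \mathcal{P}_{r+1}^-\Lambda^{k-1}(K),\end{cases}$$ $$|\!|\!|u^{\mathrm{tan}} - u_h^{\mathrm{tan}}|\!|\!|_{\partial K} \le C\Bigl( \|u-u_h\|_K + \begin{cases} h_K |u|_{1,K}, & \text{if } W_h^{k}(K) = \mathcal{P}_{1}^-\Lambda^{k}(K),\\ h_K^{s+2} |u|_{s+2,K}, & \text{if } s \le r-1.\end{cases}\Bigr)$$ Moreover, under the same conditions on $s$ and on the spaces, $$|\!|\!|\sigma^{\mathrm{tan}} - \sigma_h^{\mathrm{tan}}|\!|\!|_{\partial\mathcal{T}_h} \le C\bigl( \|\sigma-\sigma_h\|_\Omega + h^{s+1} |\sigma|_{s+1,\Omega}\bigr),$$ $$|\!|\!|u^{\mathrm{tan}} - u_h^{\mathrm{tan}}|\!|\!|_{\partial\mathcal{T}_h}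 \le C\Bigl( \|u-u_h\|_\Omega + \begin{cases} h |u|_{1,\Omega}, & \text{if } W_h^{k}(K) = \mathcal{P}_{1}^-\Lambda^{k}(K) \text{ for all } K,\\ h^{s+2} |u|_{s+2,\Omega}, & \text{if } s \le r-1.\end{cases}\Bigr)$$ -/

import Mathlib

open MeasureTheory Filter Topology Set
open scoped ENNReal ContDiff

noncomputable section

namespace TanTrace

/-- The ambient space `ℝⁿ` with its Euclidean structure. -/
abbrev Pt (n : ℕ) := EuclideanSpace ℝ (Fin n)

/-- `Alt^k V`, the alternating `k`-linear forms on `V`. -/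
abbrev Alt (V : Type*) [NormedAddCommGroup V] [NormedSpace ℝ V] (k : ℕ) := V [⋀^Fin k]→L[ℝ] ℝ

/-- Differential `k`-forms on `ℝⁿ` (no regularity); forms on a subset are given by such a function,
of which only the values on the subset matter. -/
abbrev Form (n k : ℕ) := Pt n → Alt (Pt n) k

/-- The standard basis vector `e_i`. -/
abbrev stdVec {n : ℕ} (i : Fin n) : Pt n := EuclideanSpace.basisFun (Fin n) ℝ i

/-- The inner product on `Alt^k V` induced by the inner product of `V`:
`∑_{i₁ < ⋯ < i_k} α(b_{i₁}, …, b_{i_k}) β(b_{i₁}, …, b_{i_k})` for an orthonormal basis `b`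
(the value does not depend on `b`). -/
def altInner {V : Type*} [NormedAddCommGroup V] [InnerProductSpace ℝ V] [FiniteDimensional ℝ V]
    {k : ℕ} (α β : Alt V k) : ℝ :=
  ∑ I : Fin k ↪o Fin (Module.finrank ℝ V),
    α (fun a => stdOrthonormalBasis ℝ V (I a)) * β (fun a => stdOrthonormalBasis ℝ V (I a))

/-- The `L²` norm, as an extended nonnegative real, of a field of alternating forms. -/
def l2Norm {X V : Type*} [MeasurableSpace X]
    [NormedAddCommGroup V] [InnerProductSpace ℝ V] [FiniteDimensional ℝ V] {k : ℕ}
    (μ : Measure X) (v : X → Alt V k) : ℝ≥0∞ :=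
  (∫⁻ x, ENNReal.ofReal (altInner (v x) (v x)) ∂μ) ^ (1 / 2 : ℝ)

/-- The `L²` inner product `(v, w)_Ω` of two forms. -/
def l2Inner {n k : ℕ} (Ω : Set (Pt n)) (v w : Form n k) : ℝ :=
  ∫ x in Ω, altInner (v x) (w x)

/-- `v ∈ L²Λ^k(Ω)`. -/
def MemL2 {n k : ℕ} (Ω : Set (Pt n)) (v : Form n k) : Prop :=
  MemLp v 2 (volume.restrict Ω)

/-! ### Weak exterior derivative -/

/-- The codifferential of a smooth form, `δη = -∑ᵢ ι_{eᵢ} ∂ᵢη`; this is the formal adjoint of the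
exterior derivative. -/
def codiff {n k : ℕ} (η : Form n (k + 1)) : Form n k := fun x =>
  -∑ i : Fin n, (fderiv ℝ η x (stdVec i)).curryLeft (stdVec i)

/-- `v ∈ L²Λ^k(Ω)` has the weak exterior derivative `w ∈ L²Λ^{k+1}(Ω)`:
`(w, η)_Ω = (v, δη)_Ω` for all smooth `η` with compact support in `Ω`. -/
structure HasWeakExtDeriv {n k : ℕ} (Ω : Set (Pt n)) (v : Form n k) (w : Form n (k + 1)) :
    Prop where
  memL2 : MemL2 Ω v
  memL2_deriv : MemL2 Ω w
  eq : ∀ η : Form n (k + 1), ContDiff ℝ ∞ η → HasCompactSupport η → tsupport η ⊆ Ω →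
    l2Inner Ω w η = l2Inner Ω v (codiff η)

/-- The space `HΛ^k(Ω)`. -/
def HLambda {n : ℕ} (Ω : Set (Pt n)) (k : ℕ) : Set (Form n k) :=
  {v | ∃ w, HasWeakExtDeriv Ω v w}

/-! ### Sobolev seminorms of forms -/

/-- `D` consists of weak partial derivatives in `L²(U)` of all orders `≤ m` of the form `v`:
`D i α = ∂_{α₁} ⋯ ∂_{αᵢ} v` weakly in `U`, for `i ≤ m`. -/
structure IsWeakJet {n k : ℕ} (U : Set (Pt n)) (m : ℕ) (v : Form n k)
    (D : (i : ℕ) → (Fin i → Fin n) → Form n k) : Prop where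
  memL2 : MemL2 U v
  memL2_deriv : ∀ i ≤ m, ∀ α, MemL2 U (D i α)
  eq : ∀ i ≤ m, ∀ α : Fin i → Fin n, ∀ φ : Pt n → ℝ,
    ContDiff ℝ ∞ φ → HasCompactSupport φ → tsupport φ ⊆ U →
      ∫ x in U, (iteratedFDeriv ℝ i φ x (fun a => stdVec (α a))) • v x =
        (-1 : ℝ) ^ i • ∫ x in U, φ x • D i α x

/-- The square of the `L²(U)` norm (if `θ = 0`), respectively of the Sobolev–Slobodeckij seminorm
of order `θ` (if `0 < θ < 1`), of a form. -/
def slobodeckijSq {n k : ℕ} (U : Set (Pt n)) (θ : ℝ) (v : Form n k) : ℝ≥0∞ :=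
  if θ = 0 then l2Norm (volume.restrict U) v ^ 2
  else ∫⁻ x in U, ∫⁻ y in U,
    ENNReal.ofReal (altInner (v x - v y) (v x - v y) / ‖x - y‖ ^ ((n : ℝ) + 2 * θ))

/-- The Sobolev seminorm `|v|_{t,U}` of real order `t ≥ 0` on an open set `U`: with `t = m + θ`,
`m` integer and `0 ≤ θ < 1`, the order-`θ` seminorm of the derivatives of order `m`.
Weak derivatives are unique almost everywhere, so that the infimum is over a single value, or over
the empty set; hence the value is `∞` when `v` is not in `H^t`. -/
def sobolevSeminorm {n k : ℕ} (U : Set (Pt n)) (t : ℝ) (v : Form n k) : ℝ≥0∞ :=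
  ⨅ (D : (i : ℕ) → (Fin i → Fin n) → Form n k) (_ : IsWeakJet U ⌊t⌋₊ v D),
    (∑ α : Fin ⌊t⌋₊ → Fin n, slobodeckijSq U (t - ⌊t⌋₊) (D ⌊t⌋₊ α)) ^ (1 / 2 : ℝ)

/-- `v ∈ H^tΛ^k(U)`. -/
def MemSobolev {n k : ℕ} (U : Set (Pt n)) (t : ℝ) (v : Form n k) : Prop :=
  sobolevSeminorm U t v < ⊤

/-! ### Simplicial meshes -/

/-- The interior of the simplex with vertex set `K`. -/
def cell {n : ℕ} (K : Finset (Pt n)) : Set (Pt n) := interior (convexHull ℝ (K : Set (Pt n)))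

/-- The facet of the simplex `K` opposite to the vertex `z`. -/
def facet {n : ℕ} (K : Finset (Pt n)) (z : Pt n) : Set (Pt n) :=
  convexHull ℝ ((K : Set (Pt n)) \ {z})

/-- The tangent space of the facet of `K` opposite to `z`. -/
abbrev facetDir {n : ℕ} (K : Finset (Pt n)) (z : Pt n) : Submodule ℝ (Pt n) :=
  vectorSpan ℝ ((K : Set (Pt n)) \ {z})

/-- The diameter `h_K`. -/
def cellDiam {n : ℕ} (K : Finset (Pt n)) : ℝ := Metric.diam (convexHull ℝ (K : Set (Pt n)))

/-- The mesh size `h = max_K h_K`. -/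
def meshSize {n : ℕ} (T : Finset (Finset (Pt n))) : ℝ :=
  sSup (cellDiam '' (T : Set (Finset (Pt n))))

/-- `T` is a conforming mesh of `Ω` by nondegenerate `n`-simplices, each given by its vertices. -/
structure IsMesh {n : ℕ} (Ω : Set (Pt n)) (T : Finset (Finset (Pt n))) : Prop where
  card : ∀ K ∈ T, K.card = n + 1
  affineIndependent : ∀ K ∈ T, AffineIndependent ℝ ((↑) : K → Pt n)
  conforming : ∀ K ∈ T, ∀ L ∈ T,
    convexHull ℝ (K : Set (Pt n)) ∩ convexHull ℝ (L : Set (Pt n)) =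
      convexHull ℝ ((K : Set (Pt n)) ∩ (L : Set (Pt n)))
  cell_subset : ∀ K ∈ T, cell K ⊆ Ω
  cover : ⋃ K ∈ T, convexHull ℝ (K : Set (Pt n)) = closure Ω

/-- Shape regularity with constant `γ`: each simplex `K` of the mesh contains a ball of some radius
`ρ > 0` with `h_K ≤ γ ρ`. -/
def IsShapeRegular {n : ℕ} (γ : ℝ) (T : Finset (Finset (Pt n))) : Prop :=
  ∀ K ∈ T, ∃ (c : Pt n) (ρ : ℝ), 0 < ρ ∧
    Metric.ball c ρ ⊆ convexHull ℝ (K : Set (Pt n)) ∧ cellDiam K ≤ γ * ρ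

/-! ### Tangential traces on the boundary of a simplex -/

/-- `k`-forms on `∂K`: for each vertex `z` of `K`, a field on the opposite facet of alternating
forms on the tangent space of that facet. -/
abbrev BdryForm {n : ℕ} (K : Finset (Pt n)) (k : ℕ) := (z : Pt n) → Pt n → Alt (facetDir K z) k

/-- Surface measure on the facet of `K` opposite to `z`. -/
def facetMeasure {n : ℕ} (K : Finset (Pt n)) (z : Pt n) : Measure (Pt n) :=
  (μHE[n - 1] : Measure (Pt n)).restrict (facet K z)

/-- The norm `‖g‖_{∂K}` of `L²Λ^k(∂K)`. -/
def bdryNorm {n k : ℕ} (K : Finset (Pt n)) (g : BdryForm K k) : ℝ≥0∞ :=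
  (∑ z ∈ K, l2Norm (facetMeasure K z) (g z) ^ 2) ^ (1 / 2 : ℝ)

/-- The scaled norm `|||g|||_{∂K} = h_K^{1/2} ‖g‖_{∂K}`. -/
def scaledBdryNorm {n k : ℕ} (K : Finset (Pt n)) (g : BdryForm K k) : ℝ≥0∞ :=
  ENNReal.ofReal (cellDiam K ^ (1 / 2 : ℝ)) * bdryNorm K g

/-- The pullback to `∂K` of a form defined everywhere: on each facet, restriction to the vectors
tangent to the facet. -/
def pullbackBdry {n k : ℕ} (K : Finset (Pt n)) (v : Form n k) : BdryForm K k := fun z x =>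
  (v x).compContinuousLinearMap (facetDir K z).subtypeL

/-- `g ∈ L²Λ^k(∂K)` is the tangential trace `v^tan` on `∂K` of the form `v ∈ H¹Λ^k(K)`: it is the
limit in `L²(∂K)` of the pullbacks of smooth forms that converge to `v` in `H¹(K)`. -/
def IsTanTrace {n k : ℕ} (K : Finset (Pt n)) (v : Form n k) (g : BdryForm K k) : Prop :=
  (∀ z ∈ K, MemLp (g z) 2 (facetMeasure K z)) ∧
  ∃ φ : ℕ → Form n k, (∀ i, ContDiff ℝ ∞ (φ i)) ∧
    Tendsto (fun i => l2Norm (volume.restrict (cell K)) (φ i - v)) atTop (𝓝 0) ∧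
    Tendsto (fun i => sobolevSeminorm (cell K) 1 (φ i - v)) atTop (𝓝 0) ∧
    Tendsto (fun i => bdryNorm K (pullbackBdry K (φ i) - g)) atTop (𝓝 0)

/-! ### Finite element spaces -/

/-- `𝒫_r Λ^k`: forms whose coefficients are polynomials of degree `≤ r`. -/
def polyForms (n r k : ℕ) : Set (Form n k) :=
  {v | ∀ I : Fin k ↪o Fin n, ∃ p : MvPolynomial (Fin n) ℝ, p.totalDegree ≤ r ∧
    ∀ x : Pt n, v x (fun a => stdVec (I a)) = MvPolynomial.eval (fun i => x i) p}

/-- The Koszul differential: contraction with the vector field `x ↦ x`. -/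
def koszul {n k : ℕ} (v : Form n (k + 1)) : Form n k := fun x => (v x).curryLeft x

/-- `𝒫_r⁻ Λ^k = 𝒫_{r-1} Λ^k + κ 𝒫_{r-1} Λ^{k+1}` (and `0` if `r = 0`). -/
def polyFormsMinus (n : ℕ) : (r k : ℕ) → Set (Form n k)
  | 0, _ => {0}
  | r + 1, k => {v | ∃ a ∈ polyForms n r k, ∃ b ∈ polyForms n r (k + 1), v = a + koszul b}

/-- The conforming finite element space of the forms in `HΛ^k(Ω)` whose restriction to each
simplex of the mesh belongs to the space `W` of polynomial forms. -/
def feSpace {n k : ℕ} (Ω : Set (Pt n)) (T : Finset (Finset (Pt n))) (W : Set (Form n k)) :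
    Set (Form n k) :=
  {v | v ∈ HLambda Ω k ∧ ∀ K ∈ T, ∃ q ∈ W, v =ᵐ[volume.restrict (cell K)] q}

/-! ### The mixed Hodge–Laplace problem -/

/-- The harmonic `(j+1)`-forms of a subcomplex of `HΛ(Ω)` that has `V'` in degree `j` and `V` in
degree `j + 1`: the closed forms in `V` that are orthogonal to `d V'`. -/
def harmonic {n j : ℕ} (Ω : Set (Pt n)) (V' : Set (Form n j)) (V : Set (Form n (j + 1))) :
    Set (Form n (j + 1)) :=
  {q | q ∈ V ∧ HasWeakExtDeriv Ω q 0 ∧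
    ∀ τ ∈ V', ∀ dτ, HasWeakExtDeriv Ω τ dτ → l2Inner Ω q dτ = 0}

/-- `(σ, u, p)` solves the mixed Hodge–Laplace problem for `k`-forms, `k = j + 1`, posed on the
subspaces `V'` of `HΛ^{k-1}(Ω)` and `V` of `HΛ^k(Ω)`. The full spaces give the exact problem, the
finite element spaces give the discrete problem. -/
structure IsMixedSolution {n j : ℕ} (Ω : Set (Pt n)) (V' : Set (Form n j))
    (V : Set (Form n (j + 1))) (f : Form n (j + 1))
    (σ : Form n j) (u p : Form n (j + 1)) : Prop where
  sigma_mem : σ ∈ V'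
  u_mem : u ∈ V
  p_mem : p ∈ harmonic Ω V' V
  eq_sigma : ∀ τ ∈ V', ∀ dτ, HasWeakExtDeriv Ω τ dτ → l2Inner Ω σ τ - l2Inner Ω u dτ = 0
  eq_u : ∀ v ∈ V, ∀ dσ du dv,
    HasWeakExtDeriv Ω σ dσ → HasWeakExtDeriv Ω u du → HasWeakExtDeriv Ω v dv →
      l2Inner Ω dσ v + l2Inner Ω du dv + l2Inner Ω p v = l2Inner Ω f v
  eq_p : ∀ q ∈ harmonic Ω V' V, l2Inner Ω u q = 0

/-- The harmonic `0`-forms of a subcomplex of `HΛ(Ω)` that has `V` in degree `0`. -/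
def harmonicZero {n : ℕ} (Ω : Set (Pt n)) (V : Set (Form n 0)) : Set (Form n 0) :=
  {q | q ∈ V ∧ HasWeakExtDeriv Ω q 0}

/-- The Hodge–Laplace problem for `k = 0`, where there is no variable `σ`. -/
structure IsMixedSolutionZero {n : ℕ} (Ω : Set (Pt n)) (V : Set (Form n 0)) (f u p : Form n 0) :
    Prop where
  u_mem : u ∈ V
  p_mem : p ∈ harmonicZero Ω V
  eq_u : ∀ v ∈ V, ∀ du dv, HasWeakExtDeriv Ω u du → HasWeakExtDeriv Ω v dv →
    l2Inner Ω du dv + l2Inner Ω p v = l2Inner Ω f v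
  eq_p : ∀ q ∈ harmonicZero Ω V, l2Inner Ω u q = 0

/-! ### The estimates -/

/-- The local and global estimates of order `t` for the tangential traces of `v` and `vh`:
the traces exist in `L²(∂K)` for each `K`,
`|||v^tan - vh^tan|||_{∂K} ≤ C (‖v - vh‖_K + h_K^t |v|_{t,K})` for each `K`, and
`(∑_K |||v^tan - vh^tan|||_{∂K}²)^{1/2} ≤ C (‖v - vh‖_Ω + h^t |v|_{t,Ω})`. -/
structure TraceEstimate {n k : ℕ} (Ω : Set (Pt n)) (T : Finset (Finset (Pt n))) (C t : ℝ)
    (v vh : Form n k) : Prop where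
  exists_trace : ∀ K ∈ T, ∃ g : BdryForm K k, IsTanTrace K v g
  exists_trace_discrete : ∀ K ∈ T, ∃ gh : BdryForm K k, IsTanTrace K vh gh
  local_estimate : ∀ K ∈ T, ∀ g gh : BdryForm K k, IsTanTrace K v g → IsTanTrace K vh gh →
    scaledBdryNorm K (g - gh) ≤ ENNReal.ofReal C *
      (l2Norm (volume.restrict (cell K)) (v - vh) +
        ENNReal.ofReal (cellDiam K ^ t) * sobolevSeminorm (cell K) t v)
  global_estimate : ∀ g gh : (K : Finset (Pt n)) → BdryForm K k,
    (∀ K ∈ T, IsTanTrace K v (g K)) → (∀ K ∈ T, IsTanTrace K vh (gh K)) →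
    (∑ K ∈ T, scaledBdryNorm K (g K - gh K) ^ 2) ^ (1 / 2 : ℝ) ≤ ENNReal.ofReal C *
      (l2Norm (volume.restrict Ω) (v - vh) +
        ENNReal.ofReal (meshSize T ^ t) * sobolevSeminorm Ω t v)

end TanTrace

end

/-!
On a cell `K`, split `v - v_h = (v - q) + (q - v_h)` with `q` a polynomial approximating `v`.

Both parts are bounded on a facet by integrating along the segments that join the points of the
facet to the opposite vertex. These sweep out the cone `K`, and its height is at least the radius of
the inscribed ball, hence comparable with `h_K`. On each segment the value at the end point in the
facet is controlled by an integral over the outer half of the segment: by the fundamental theorem of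
calculus, which gives the scaled trace inequality `h_K ^ (1 / 2) ‖w‖_{∂K} ≤ C (‖w‖_K + h_K ‖∇w‖_K)`
used for `v - q`; or, for a polynomial of bounded degree, by the equivalence of norms in finite
dimension, which gives the inverse estimate `h_K ^ (1 / 2) ‖w‖_{∂K} ≤ C ‖w‖_K` used for `q - v_h`.
Then `‖q - v_h‖_K ≤ ‖v - v_h‖_K + ‖v - q‖_K`.

The polynomial `q` is the one for which all derivatives of `v - q` up to the order of the highest
weak derivatives of `v` have mean zero on `K`. The Poincaré inequality on the convex cell then
removes one derivative at a time, each at the cost of a factor `h_K`. The top derivatives minus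
their means are controlled by the Slobodeckij seminorm or, in integer order, by their norm. Weak
derivatives are reached from the smooth case by contracting `K` towards its interior points before
mollifying.
-/

namespace TanTrace

open scoped NNReal

section AlternatingForms

theorem alt_ext_of_orderEmbedding {V : Type*} [NormedAddCommGroup V] [NormedSpace ℝ V] {k : ℕ}
    {ι : Type*} [LinearOrder ι] (b : Module.Basis ι ℝ V) {α β : Alt V k}
    (h : ∀ I : Fin k ↪o ι, α (fun a => b (I a)) = β (fun a => b (I a))) : α = β := by
  refine ContinuousAlternatingMap.toAlternatingMap_injective
    (Module.Basis.ext_alternating b fun v hv => ?_)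
  have hsorted : StrictMono (v ∘ Tuple.sort v) :=
    (Tuple.monotone_sort v).strictMono_of_injective (hv.comp (Tuple.sort v).injective)
  have hα := α.toAlternatingMap.map_perm (fun i => b (v i)) (Tuple.sort v)
  have hβ := β.toAlternatingMap.map_perm (fun i => b (v i)) (Tuple.sort v)
  exact smul_left_cancel _ (hα.symm.trans ((h (OrderEmbedding.ofStrictMono _ hsorted)).trans hβ))

variable {V : Type*} [NormedAddCommGroup V] [InnerProductSpace ℝ V] [FiniteDimensional ℝ V] {k : ℕ}

variable (V k) in
/-- The coefficients of an alternating form in the standard orthonormal basis. They embed `Alt V k`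
into a Euclidean space in such a way that `altInner` is induced by the Euclidean inner product. -/
noncomputable def altCoeffs :
    Alt V k →ₗ[ℝ] EuclideanSpace ℝ (Fin k ↪o Fin (Module.finrank ℝ V)) where
  toFun α := WithLp.toLp 2 fun I => α fun a => stdOrthonormalBasis ℝ V (I a)
  map_add' _ _ := rfl
  map_smul' _ _ := rfl

lemma altCoeffs_apply (α : Alt V k) (I : Fin k ↪o Fin (Module.finrank ℝ V)) :
    altCoeffs V k α I = α fun a => stdOrthonormalBasis ℝ V (I a) := rfl

lemma altCoeffs_injective : Function.Injective (altCoeffs V k) := fun α β h =>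
  alt_ext_of_orderEmbedding (stdOrthonormalBasis ℝ V).toBasis fun I => by
    rw [OrthonormalBasis.coe_toBasis, ← altCoeffs_apply, ← altCoeffs_apply, h]

instance instFiniteDimensionalAlt : FiniteDimensional ℝ (Alt V k) :=
  FiniteDimensional.of_injective (altCoeffs V k) altCoeffs_injective

lemma altInner_self (α : Alt V k) : altInner α α = ‖altCoeffs V k α‖ ^ 2 := by
  rw [EuclideanSpace.norm_sq_eq]
  exact Finset.sum_congr rfl fun I _ => by rw [Real.norm_eq_abs, sq_abs, sq]; rfl

lemma nnnorm_altCoeffs_le (α : Alt V k) {n : ℕ} (hn : Module.finrank ℝ V ≤ n) :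
    ‖altCoeffs V k α‖₊ ≤ NNReal.sqrt (n ^ k) * ‖α‖₊ := by
  have hcoeff (I : Fin k ↪o Fin (Module.finrank ℝ V)) : ‖altCoeffs V k α I‖ ≤ ‖α‖ :=
    (α.le_opNorm _).trans (by simp)
  have hcard : Fintype.card (Fin k ↪o Fin (Module.finrank ℝ V)) ≤ n ^ k := by
    have := Fintype.card_le_of_injective (fun I : Fin k ↪o Fin (Module.finrank ℝ V) => ⇑I)
      DFunLike.coe_injective
    simp only [Fintype.card_fun, Fintype.card_fin] at this
    exact this.trans (Nat.pow_le_pow_left hn k)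
  rw [← NNReal.coe_le_coe, NNReal.coe_mul, Real.coe_sqrt, NNReal.coe_pow, NNReal.coe_natCast]
  refine (abs_le_of_sq_le_sq' ?_ (by positivity)).2
  calc ‖altCoeffs V k α‖ ^ 2
      = ∑ I, ‖altCoeffs V k α I‖ ^ 2 := EuclideanSpace.norm_sq_eq _
    _ ≤ ∑ _I : Fin k ↪o Fin (Module.finrank ℝ V), ‖α‖ ^ 2 := by gcongr; exact hcoeff _
    _ = (Fintype.card (Fin k ↪o Fin (Module.finrank ℝ V)) : ℝ) * ‖α‖ ^ 2 := by
        rw [Finset.sum_const, Finset.card_univ, nsmul_eq_mul]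
    _ ≤ (n : ℝ) ^ k * ‖α‖ ^ 2 := by gcongr; exact_mod_cast hcard
    _ = (√((n : ℝ) ^ k) * ‖α‖) ^ 2 := by rw [mul_pow, Real.sq_sqrt (by positivity)]

variable (V k) in
lemma exists_nnnorm_le_mul_nnnorm_altCoeffs :
    ∃ c : ℝ≥0, ∀ α : Alt V k, ‖α‖₊ ≤ c * ‖altCoeffs V k α‖₊ := by
  obtain ⟨c, -, h⟩ := (altCoeffs V k).exists_antilipschitzWith
    (LinearMap.ker_eq_bot.2 altCoeffs_injective)
  exact ⟨c, fun α => by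
    simpa only [map_zero, nndist_zero_right] using antilipschitzWith_iff_le_mul_nndist.1 h α 0⟩

variable {X : Type*} [MeasurableSpace X] {μ : Measure X}

lemma ofReal_altInner_self (α : Alt V k) :
    ENNReal.ofReal (altInner α α) = ‖altCoeffs V k α‖ₑ ^ 2 := by
  rw [altInner_self, ENNReal.ofReal_pow (norm_nonneg _), ofReal_norm]

lemma l2Norm_eq_eLpNorm_altCoeffs (v : X → Alt V k) :
    l2Norm μ v = eLpNorm (fun x => altCoeffs V k (v x)) 2 μ := by
  rw [eLpNorm_eq_lintegral_rpow_enorm_toReal two_ne_zero ENNReal.ofNat_ne_top]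
  simp only [l2Norm, ofReal_altInner_self, ENNReal.toReal_ofNat, ENNReal.rpow_ofNat]

lemma l2Norm_le_mul_eLpNorm (v : X → Alt V k) {n : ℕ} (hn : Module.finrank ℝ V ≤ n) :
    l2Norm μ v ≤ (NNReal.sqrt (n ^ k) : ℝ≥0) * eLpNorm v 2 μ := by
  rw [l2Norm_eq_eLpNorm_altCoeffs]
  exact eLpNorm_le_nnreal_smul_eLpNorm_of_ae_le_mul
    (ae_of_all _ fun x => nnnorm_altCoeffs_le (v x) hn) 2

lemma eLpNorm_le_mul_l2Norm {c : ℝ≥0} (hc : ∀ α : Alt V k, ‖α‖₊ ≤ c * ‖altCoeffs V k α‖₊)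
    (v : X → Alt V k) : eLpNorm v 2 μ ≤ c * l2Norm μ v := by
  rw [l2Norm_eq_eLpNorm_altCoeffs]
  exact eLpNorm_le_nnreal_smul_eLpNorm_of_ae_le_mul (ae_of_all _ fun x => hc (v x)) 2

lemma l2Norm_congr_ae {v w : X → Alt V k} (h : v =ᵐ[μ] w) : l2Norm μ v = l2Norm μ w := by
  simp only [l2Norm_eq_eLpNorm_altCoeffs]
  exact eLpNorm_congr_ae (h.fun_comp (altCoeffs V k))

end AlternatingForms

section Cones

lemma lintegral_eq_ofReal_mul_lintegral_comp_mul_left {d : ℝ} (hd : 0 < d) (f : ℝ → ℝ≥0∞) :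
    ∫⁻ x, f x = ENNReal.ofReal d * ∫⁻ s, f (d * s) := by
  have h := congrArg (fun μ => ∫⁻ x, f x ∂μ) (Real.smul_map_volume_mul_left hd.ne')
  simp only [lintegral_smul_measure, abs_of_pos hd, smul_eq_mul] at h
  exact h.symm.trans
    (congrArg _ (lintegral_map_equiv f (MeasurableEquiv.mulLeft₀ d hd.ne')))

variable {V : Type*} [NormedAddCommGroup V] [InnerProductSpace ℝ V]

/-- The set `F` lies in the hyperplane with unit normal `v` at distance `d` from the point `z`, and
in a compact convex set `C` that contains `z`. Thus `C` contains the cone of height `d` with base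
`F` and apex `z`. -/
structure IsConeBase (z v : V) (d : ℝ) (C F : Set V) : Prop where
  norm_normal : ‖v‖ = 1
  height_pos : 0 < d
  convex : Convex ℝ C
  isCompact : IsCompact C
  apex_mem : z ∈ C
  subset : F ⊆ C
  inner_eq : ∀ x ∈ F, inner ℝ v (x - z) = d

namespace IsConeBase

variable {z v : V} {d s : ℝ} {C F t : Set V}

lemma homothety_image_subset_slice (h : IsConeBase z v d C F) (hs : s ∈ Icc (0 : ℝ) 1) :
    AffineMap.homothety z s '' (F ∩ AffineMap.homothety z s ⁻¹' t) ⊆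
      t ∩ C ∩ AffineSubspace.mk' ((d * s) • v +ᵥ z) (ℝ ∙ v)ᗮ := by
  rintro _ ⟨x, ⟨hxF, hxt⟩, rfl⟩
  refine ⟨⟨hxt, ?_⟩, ?_⟩
  · rw [AffineMap.homothety_eq_lineMap]
    exact h.convex.lineMap_mem h.apex_mem (h.subset hxF) hs
  · have hdiff : s • (x - z) + z - ((d * s) • v + z) = s • (x - z) - (d * s) • v := by abel
    rw [SetLike.mem_coe, AffineSubspace.mem_mk', Submodule.mem_orthogonal_singleton_iff_inner_right,
      AffineMap.homothety_apply, vsub_eq_sub, vsub_eq_sub, vadd_eq_add, vadd_eq_add, hdiff,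
      inner_sub_right, inner_smul_right, inner_smul_right, h.inner_eq x hxF,
      real_inner_self_eq_norm_sq, h.norm_normal]
    ring

variable [MeasurableSpace V] [BorelSpace V]

lemma measure_le_measure_slice (h : IsConeBase z v d C F) (m : ℕ) (hs : s ∈ Ioo (1 / 2 : ℝ) 1) :
    (μHE[m] : Measure V) (F ∩ AffineMap.homothety z s ⁻¹' t) ≤
      2 ^ m * (μHE[m] : Measure V) (t ∩ C ∩ AffineSubspace.mk' ((d * s) • v +ᵥ z) (ℝ ∙ v)ᗮ) := by
  have hs0 : 0 < s := by linarith [hs.1]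
  have hscale : 1 ≤ (2 : ℝ≥0∞) ^ m * ((‖s‖₊ ^ m : NNReal) : ℝ≥0∞) := by
    have hone : 1 ≤ 2 * ‖s‖ₑ := by
      rw [Real.enorm_of_nonneg hs0.le, ← ENNReal.ofReal_ofNat 2,
        ← ENNReal.ofReal_mul (by norm_num), ENNReal.one_le_ofReal]
      linarith [hs.1]
    rw [ENNReal.coe_pow, ← mul_pow]
    exact one_le_pow₀ hone
  calc (μHE[m] : Measure V) (F ∩ AffineMap.homothety z s ⁻¹' t)
      ≤ 2 ^ m * ((‖s‖₊ ^ m : NNReal) : ℝ≥0∞) *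
          (μHE[m] : Measure V) (F ∩ AffineMap.homothety z s ⁻¹' t) := le_mul_of_one_le_left' hscale
    _ = 2 ^ m * (μHE[m] : Measure V)
          (AffineMap.homothety z s '' (F ∩ AffineMap.homothety z s ⁻¹' t)) := by
        rw [euclideanHausdorffMeasure_homothety_image _ _ hs0.ne', ENNReal.smul_def, smul_eq_mul,
          mul_assoc]
    _ ≤ _ := by
        gcongr
        exact h.homothety_image_subset_slice ⟨hs0.le, hs.2.le⟩

variable [FiniteDimensional ℝ V]

lemma ofReal_mul_lintegral_measure_le (h : IsConeBase z v d C F) (ht : MeasurableSet t) :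
    ENNReal.ofReal d * ∫⁻ s in Ioo (1 / 2 : ℝ) 1,
        (μHE[Module.finrank ℝ V - 1] : Measure V) (F ∩ AffineMap.homothety z s ⁻¹' t) ≤
      2 ^ (Module.finrank ℝ V - 1) * volume (t ∩ C) := by
  have hv0 : v ≠ 0 := norm_ne_zero_iff.1 (h.norm_normal ▸ one_ne_zero)
  have hslices := EuclideanGeometry.euclideanHausdorffMeasure_eq_lintegral z hv0
    (ht.inter h.isCompact.measurableSet)
  rw [InnerProductSpace.euclideanHausdorffMeasure_eq_volume, ← ofReal_norm, h.norm_normal,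
    ENNReal.ofReal_one, one_mul, lintegral_eq_ofReal_mul_lintegral_comp_mul_left h.height_pos]
    at hslices
  rw [hslices, mul_left_comm]
  gcongr
  rw [← lintegral_const_mul' _ _ (by simp)]
  exact (setLIntegral_mono' measurableSet_Ioo fun s hs => h.measure_le_measure_slice _ hs).trans
    (setLIntegral_le_lintegral _ _)

lemma measure_lt_top (h : IsConeBase z v d C F) :
    (μHE[Module.finrank ℝ V - 1] : Measure V) F < ⊤ := by
  have hle := h.ofReal_mul_lintegral_measure_le MeasurableSet.univ
  have hlt : (2 : ℝ≥0∞) ^ (Module.finrank ℝ V - 1) * volume (univ ∩ C) < ⊤ := by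
    rw [univ_inter]
    exact ENNReal.mul_lt_top (by simp) h.isCompact.measure_lt_top
  by_contra! htop
  refine absurd (hle.trans_lt hlt) ?_
  simp only [preimage_univ, inter_univ, top_le_iff.1 htop, setLIntegral_const, Real.volume_Ioo]
  rw [ENNReal.top_mul (by norm_num), ENNReal.mul_top (by simpa using h.height_pos)]
  exact lt_irrefl _

theorem ofReal_mul_lintegral_lintegral_le (h : IsConeBase z v d C F) {g : V → ℝ≥0∞}
    (hg : Measurable g) :
    ENNReal.ofReal d * ∫⁻ x in F, (∫⁻ s in Ioo (1 / 2 : ℝ) 1, g (z + s • (x - z)))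
        ∂(μHE[Module.finrank ℝ V - 1] : Measure V) ≤
      2 ^ (Module.finrank ℝ V - 1) * ∫⁻ y in C, g y := by
  set μF := (μHE[Module.finrank ℝ V - 1] : Measure V).restrict F
  have : IsFiniteMeasure μF := ⟨by rw [Measure.restrict_apply_univ]; exact h.measure_lt_top⟩
  have hΦ : Measurable fun p : ℝ × V => z + p.1 • (p.2 - z) := by fun_prop
  set ν := (((volume : Measure ℝ).restrict (Ioo (1 / 2 : ℝ) 1)).prod μF).map
    fun p : ℝ × V => z + p.1 • (p.2 - z) with hν
  have hle : ENNReal.ofReal d • ν ≤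
      (2 ^ (Module.finrank ℝ V - 1) : ℝ≥0∞) • volume.restrict C := by
    refine Measure.le_iff.2 fun t ht => ?_
    rw [Measure.smul_apply, Measure.smul_apply, smul_eq_mul, smul_eq_mul,
      Measure.map_apply hΦ ht, Measure.prod_apply (hΦ ht), Measure.restrict_apply ht]
    refine le_trans (le_of_eq ?_) (h.ofReal_mul_lintegral_measure_le ht)
    refine congrArg _ (lintegral_congr fun s => ?_)
    rw [Measure.restrict_apply (measurable_prodMk_left (hΦ ht)), inter_comm]
    congr 2
    ext x
    simp [AffineMap.homothety_apply, add_comm]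
  have hint := lintegral_mono' hle (le_refl g)
  rwa [lintegral_smul_measure, lintegral_smul_measure, smul_eq_mul, smul_eq_mul, hν,
    lintegral_map hg hΦ, lintegral_prod_symm' (fun p : ℝ × V => g (z + p.1 • (p.2 - z)))
      (hg.comp hΦ)] at hint

end IsConeBase

end Cones

section Simplices

section InnerProductSpace

variable {V : Type*} [NormedAddCommGroup V] [InnerProductSpace ℝ V]

lemma convex_inner_mem {I : Set ℝ} (u : V) (hI : Convex ℝ I) :
    Convex ℝ {x : V | inner ℝ u x ∈ I} :=
  hI.linear_preimage (innerₛₗ ℝ u)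

lemma two_mul_le_of_ball_subset_slab {u c : V} {ρ a b : ℝ} (hu : ‖u‖ = 1) (hρ : 0 < ρ)
    (hball : Metric.ball c ρ ⊆ {x : V | inner ℝ u x ∈ Icc a b}) : 2 * ρ ≤ b - a := by
  have hclosed : IsClosed {x : V | inner ℝ u x ∈ Icc a b} :=
    isClosed_Icc.preimage (continuous_const.inner continuous_id)
  have hsub := closure_minimal hball hclosed
  rw [closure_ball c hρ.ne'] at hsub
  have hmem (s : ℝ) (hs : |s| = ρ) : inner ℝ u c + s ∈ Icc a b := by
    have : c + s • u ∈ Metric.closedBall c ρ := by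
      simp [dist_eq_norm, norm_smul, hu, hs]
    simpa [inner_add_right, inner_smul_right, real_inner_self_eq_norm_sq, hu] using hsub this
  linarith [(hmem ρ (abs_of_pos hρ)).2, (hmem (-ρ) (by rw [abs_neg, abs_of_pos hρ])).1]

lemma exists_unit_normal_inner_nonneg [FiniteDimensional ℝ V] {W : Submodule ℝ V} (hW : W ≠ ⊤)
    (y : V) : ∃ u ∈ Wᗮ, ‖u‖ = 1 ∧ 0 ≤ inner ℝ u y := by
  obtain ⟨w, hw, hw0⟩ := Submodule.exists_mem_ne_zero_of_ne_bot
    (mt (Submodule.orthogonal_eq_bot_iff (K := W)).1 hW)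
  have hmem : ‖w‖⁻¹ • w ∈ Wᗮ := Submodule.smul_mem _ _ hw
  have hnorm : ‖‖w‖⁻¹ • w‖ = 1 := norm_smul_inv_norm (𝕜 := ℝ) hw0
  rcases le_total 0 (inner ℝ (‖w‖⁻¹ • w) y) with h | h
  · exact ⟨_, hmem, hnorm, h⟩
  · exact ⟨_, Submodule.neg_mem _ hmem, by rwa [norm_neg],
      by rwa [inner_neg_left, Left.nonneg_neg_iff]⟩

end InnerProductSpace

variable {n : ℕ} {K : Finset (Pt n)}

lemma vectorSpan_ne_top_of_card_le {s : Finset (Pt n)} (hn : 0 < n) (hs : s.card ≤ n) :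
    vectorSpan ℝ (s : Set (Pt n)) ≠ ⊤ := by
  classical
  intro htop
  have hrank : Module.finrank ℝ (vectorSpan ℝ (s : Set (Pt n))) = n := by
    rw [htop, finrank_top, finrank_euclideanSpace_fin]
  rcases s.eq_empty_or_nonempty with rfl | hne
  · rw [Finset.coe_empty, vectorSpan_empty, finrank_bot] at hrank
    omega
  · have hpos := hne.card_pos
    have := finrank_vectorSpan_image_finset_le ℝ (id : Pt n → Pt n) s (n := s.card - 1) (by omega)
    rw [Finset.image_id, hrank] at this
    omega

lemma isCompact_hull : IsCompact (convexHull ℝ (K : Set (Pt n))) :=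
  K.finite_toSet.isCompact_convexHull (𝕜 := ℝ)

lemma facet_subset_hull (z : Pt n) : facet K z ⊆ convexHull ℝ (K : Set (Pt n)) :=
  convexHull_mono sdiff_subset

lemma isCompact_facet (z : Pt n) : IsCompact (facet K z) :=
  (K.finite_toSet.subset sdiff_subset).isCompact_convexHull (𝕜 := ℝ)

lemma isOpen_cell : IsOpen (cell K) := isOpen_interior

lemma convex_cell : Convex ℝ (cell K) := (convex_convexHull ℝ _).interior

lemma isBounded_cell : Bornology.IsBounded (cell K) :=
  isCompact_hull.isBounded.subset interior_subset

lemma dist_le_cellDiam {x y : Pt n} (hx : x ∈ convexHull ℝ (K : Set (Pt n)))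
    (hy : y ∈ convexHull ℝ (K : Set (Pt n))) : dist x y ≤ cellDiam K :=
  Metric.dist_le_diam_of_mem isCompact_hull.isBounded hx hy

lemma restrict_hull_eq_restrict_cell :
    (volume : Measure (Pt n)).restrict (convexHull ℝ (K : Set (Pt n))) =
      volume.restrict (cell K) :=
  (Measure.restrict_congr_set (interior_ae_eq_of_null_frontier
    ((convex_convexHull ℝ _).addHaar_frontier volume))).symm

lemma exists_isConeBase_facet (hn : 0 < n) (hK : K.card = n + 1) {c : Pt n} {ρ : ℝ} (hρ : 0 < ρ)
    (hball : Metric.ball c ρ ⊆ convexHull ℝ (K : Set (Pt n))) {z : Pt n} (hz : z ∈ K) :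
    ∃ v d, ρ ≤ d ∧ IsConeBase z v d (convexHull ℝ (K : Set (Pt n))) (facet K z) := by
  classical
  have hcard : (K.erase z).card = n := by rw [Finset.card_erase_of_mem hz, hK, Nat.add_sub_cancel]
  obtain ⟨y₀, hy₀⟩ : ((K : Set (Pt n)) \ {z}).Nonempty := by
    rw [← Finset.coe_erase]
    exact Finset.coe_nonempty.2 (Finset.card_pos.1 (by omega))
  have hdir : facetDir K z ≠ ⊤ := by
    simpa only [Finset.coe_erase] using vectorSpan_ne_top_of_card_le hn hcard.le
  obtain ⟨u, hu_orth, hu, hd⟩ := exists_unit_normal_inner_nonneg hdir (y₀ - z)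
  set d := inner ℝ u (y₀ - z)
  have hvertex (y : Pt n) (hy : y ∈ (K : Set (Pt n)) \ {z}) : inner ℝ u y = inner ℝ u z + d := by
    have := (Submodule.mem_orthogonal' _ _).1 hu_orth (y - y₀) (vsub_mem_vectorSpan ℝ hy hy₀)
    rw [inner_sub_right] at this
    simp only [d, inner_sub_right]
    linarith
  have hslab : convexHull ℝ (K : Set (Pt n)) ⊆
      {x | inner ℝ u x ∈ Icc (inner ℝ u z) (inner ℝ u z + d)} := by
    refine convexHull_min (fun y hy => ?_) (convex_inner_mem u (convex_Icc _ _))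
    rcases eq_or_ne y z with rfl | hyz
    · exact ⟨le_rfl, le_add_of_nonneg_right hd⟩
    · exact ⟨(hvertex y ⟨hy, hyz⟩).symm ▸ le_add_of_nonneg_right hd, (hvertex y ⟨hy, hyz⟩).le⟩
  have hfacet : facet K z ⊆ {x | inner ℝ u x ∈ ({inner ℝ u z + d} : Set ℝ)} :=
    convexHull_min hvertex (convex_inner_mem u (convex_singleton _))
  have hwidth := two_mul_le_of_ball_subset_slab hu hρ (hball.trans hslab)
  have hρd : ρ ≤ d := by linarith
  refine ⟨u, d, hρd, ⟨hu, hρ.trans_le hρd, convex_convexHull ℝ _, isCompact_hull,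
    subset_convexHull ℝ _ hz, facet_subset_hull z, fun x hx => ?_⟩⟩
  have hx' : inner ℝ u x = inner ℝ u z + d := hfacet hx
  rw [inner_sub_right, hx', add_sub_cancel_left]

lemma disjoint_cell (hn : 0 < n) {L : Finset (Pt n)} (hK : K.card = n + 1)
    (hL : L.card = n + 1) (hKL : K ≠ L)
    (hconf : convexHull ℝ (K : Set (Pt n)) ∩ convexHull ℝ (L : Set (Pt n)) =
      convexHull ℝ ((K : Set (Pt n)) ∩ (L : Set (Pt n)))) : Disjoint (cell K) (cell L) := by
  classical
  by_contra hmeet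
  have hpos : 0 < volume (cell K ∩ cell L) :=
    (isOpen_cell.inter isOpen_cell).measure_pos volume (not_disjoint_iff_nonempty_inter.1 hmeet)
  have hcard : (K ∩ L).card ≤ n := by
    have hssub : K ∩ L ⊂ K :=
      Finset.ssubset_iff_subset_ne.2 ⟨Finset.inter_subset_left, fun h => hKL
        (Finset.eq_of_subset_of_card_le (Finset.inter_eq_left.1 h) (by omega))⟩
    have := Finset.card_lt_card hssub
    omega
  have hsub : cell K ∩ cell L ⊆ affineSpan ℝ ((K ∩ L : Finset (Pt n)) : Set (Pt n)) := by
    refine (inter_subset_inter interior_subset interior_subset).trans ?_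
    rw [hconf, Finset.coe_inter]
    exact convexHull_subset_affineSpan _
  have hproper : affineSpan ℝ ((K ∩ L : Finset (Pt n)) : Set (Pt n)) ≠ ⊤ := fun h =>
    vectorSpan_ne_top_of_card_le hn hcard (by
      rw [← direction_affineSpan, h, AffineSubspace.direction_top])
  exact hpos.ne' (measure_mono_null hsub (Measure.addHaar_affineSubspace volume _ hproper))

/-- `K` is the vertex set of an `n`-simplex that is shape-regular with constant `γ`. -/
structure IsRegularSimplex (γ : ℝ) (K : Finset (Pt n)) : Prop where
  card : K.card = n + 1
  exists_ball : ∃ (c : Pt n) (ρ : ℝ), 0 < ρ ∧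
    Metric.ball c ρ ⊆ convexHull ℝ (K : Set (Pt n)) ∧ cellDiam K ≤ γ * ρ

lemma IsMesh.isRegularSimplex {Ω : Set (Pt n)} {T : Finset (Finset (Pt n))} {γ : ℝ}
    (hT : IsMesh Ω T) (hreg : IsShapeRegular γ T) (hK : K ∈ T) : IsRegularSimplex γ K :=
  ⟨hT.card K hK, hreg K hK⟩

lemma IsMesh.pairwise_disjoint_cell {Ω : Set (Pt n)} {T : Finset (Finset (Pt n))} (hn : 0 < n)
    (hT : IsMesh Ω T) : (T : Set (Finset (Pt n))).Pairwise (Function.onFun Disjoint cell) :=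
  fun _ hK _ hL hKL =>
    disjoint_cell hn (hT.card _ hK) (hT.card _ hL) hKL (hT.conforming _ hK _ hL)

namespace IsRegularSimplex

variable {γ : ℝ}

lemma cellDiam_pos (hn : 0 < n) (hK : IsRegularSimplex γ K) : 0 < cellDiam K := by
  obtain ⟨c, ρ, hρ, hball, -⟩ := hK.exists_ball
  have he : ‖(stdVec ⟨0, hn⟩ : Pt n)‖ = 1 := (EuclideanSpace.basisFun (Fin n) ℝ).norm_eq_one _
  have hnear : dist (c + (ρ / 2) • (stdVec ⟨0, hn⟩ : Pt n)) c = ρ / 2 := by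
    rw [dist_eq_norm, add_sub_cancel_left, norm_smul, he, mul_one,
      Real.norm_of_nonneg (half_pos hρ).le]
  have hmem : c + (ρ / 2) • (stdVec ⟨0, hn⟩ : Pt n) ∈ Metric.ball c ρ := by
    rw [Metric.mem_ball, hnear]
    exact half_lt_self hρ
  have := dist_le_cellDiam (hball hmem) (hball (Metric.mem_ball_self hρ))
  linarith

lemma constant_pos (hn : 0 < n) (hK : IsRegularSimplex γ K) : 0 < γ := by
  obtain ⟨_, _, hρ, _, hle⟩ := hK.exists_ball
  exact pos_of_mul_pos_left ((hK.cellDiam_pos hn).trans_le hle) hρ.le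

lemma exists_ball_subset_cell (hK : IsRegularSimplex γ K) : ∃ (c : Pt n) (ρ : ℝ), 0 < ρ ∧
    Metric.ball c ρ ⊆ cell K ∧ cellDiam K ≤ γ * ρ := by
  obtain ⟨c, ρ, hρ, hball, hle⟩ := hK.exists_ball
  exact ⟨c, ρ, hρ, interior_maximal hball Metric.isOpen_ball, hle⟩

lemma nonempty_cell (hK : IsRegularSimplex γ K) : (cell K).Nonempty := by
  obtain ⟨c, ρ, hρ, hball, -⟩ := hK.exists_ball_subset_cell
  exact ⟨c, hball (Metric.mem_ball_self hρ)⟩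

lemma isFiniteMeasure_facetMeasure (hn : 0 < n) (hK : IsRegularSimplex γ K) {z : Pt n}
    (hz : z ∈ K) : IsFiniteMeasure (facetMeasure K z) := by
  obtain ⟨c, ρ, hρ, hball, -⟩ := hK.exists_ball
  obtain ⟨v, d, -, hcone⟩ := exists_isConeBase_facet hn hK.card hρ hball hz
  have := hcone.measure_lt_top
  rw [finrank_euclideanSpace_fin] at this
  exact ⟨by rwa [facetMeasure, Measure.restrict_apply_univ]⟩

lemma cellDiam_mul_lintegral_rays_le (hn : 0 < n) (hK : IsRegularSimplex γ K) {z : Pt n}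
    (hz : z ∈ K) {g : Pt n → ℝ≥0∞} (hg : Measurable g) :
    ENNReal.ofReal (cellDiam K) *
        ∫⁻ x, (∫⁻ s in Ioo (1 / 2 : ℝ) 1, g (z + s • (x - z))) ∂facetMeasure K z ≤
      ENNReal.ofReal (γ * 2 ^ (n - 1)) * ∫⁻ y in cell K, g y := by
  obtain ⟨c, ρ, hρ, hball, hle⟩ := hK.exists_ball
  obtain ⟨v, d, hρd, hcone⟩ := exists_isConeBase_facet hn hK.card hρ hball hz
  have hγ := (hK.constant_pos hn).le
  have hrays := hcone.ofReal_mul_lintegral_lintegral_le hg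
  rw [finrank_euclideanSpace_fin, restrict_hull_eq_restrict_cell] at hrays
  calc ENNReal.ofReal (cellDiam K) *
        ∫⁻ x, (∫⁻ s in Ioo (1 / 2 : ℝ) 1, g (z + s • (x - z))) ∂facetMeasure K z
      ≤ ENNReal.ofReal (γ * d) *
          ∫⁻ x, (∫⁻ s in Ioo (1 / 2 : ℝ) 1, g (z + s • (x - z))) ∂facetMeasure K z := by
        gcongr
        exact hle.trans (by gcongr)
    _ ≤ ENNReal.ofReal γ * (2 ^ (n - 1) * ∫⁻ y in cell K, g y) := by
        rw [ENNReal.ofReal_mul hγ, mul_assoc]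
        exact mul_le_mul_right hrays _
    _ = ENNReal.ofReal (γ * 2 ^ (n - 1)) * ∫⁻ y in cell K, g y := by
        rw [ENNReal.ofReal_mul hγ, ENNReal.ofReal_pow zero_le_two, ENNReal.ofReal_ofNat, mul_assoc]

end IsRegularSimplex

end Simplices

section MeasureInequalities

lemma rpow_half_sq (a : ℝ≥0∞) : (a ^ (1 / 2 : ℝ)) ^ 2 = a := by
  rw [← ENNReal.rpow_ofNat, ← ENNReal.rpow_mul]
  norm_num

lemma sq_rpow_half (a : ℝ≥0∞) : (a ^ 2) ^ (1 / 2 : ℝ) = a := by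
  rw [← ENNReal.rpow_ofNat, ← ENNReal.rpow_mul]
  norm_num

section L2

variable {X : Type*} [MeasurableSpace X] {μ : Measure X}

lemma eLpNorm_two_sq {E : Type*} [ENorm E] (f : X → E) (μ : Measure X) :
    eLpNorm f 2 μ ^ 2 = ∫⁻ x, ‖f x‖ₑ ^ 2 ∂μ := by
  simpa using eLpNorm_nnreal_pow_eq_lintegral (f := f) (μ := μ) (p := 2) two_ne_zero

lemma sq_lintegral_le_measure_univ_mul {f : X → ℝ≥0∞} (hf : AEMeasurable f μ) :
    (∫⁻ x, f x ∂μ) ^ 2 ≤ μ univ * ∫⁻ x, f x ^ 2 ∂μ := by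
  have h := ENNReal.lintegral_mul_le_Lp_mul_Lq μ Real.HolderConjugate.two_two hf
    (aemeasurable_const (b := (1 : ℝ≥0∞)))
  simp only [ENNReal.rpow_ofNat, one_pow, lintegral_const, one_mul, Pi.mul_apply, mul_one] at h
  calc (∫⁻ x, f x ∂μ) ^ 2
      ≤ ((∫⁻ x, f x ^ 2 ∂μ) ^ (1 / 2 : ℝ) * μ univ ^ (1 / 2 : ℝ)) ^ 2 := by gcongr
    _ = μ univ * ∫⁻ x, f x ^ 2 ∂μ := by
      rw [mul_pow, ← ENNReal.rpow_natCast, ← ENNReal.rpow_mul, ← ENNReal.rpow_natCast,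
        ← ENNReal.rpow_mul, mul_comm]
      simp

lemma sq_lintegral_le (hμ : μ univ ≤ 1) {f : X → ℝ≥0∞} (hf : AEMeasurable f μ) :
    (∫⁻ x, f x ∂μ) ^ 2 ≤ ∫⁻ x, f x ^ 2 ∂μ :=
  (sq_lintegral_le_measure_univ_mul hf).trans (mul_le_of_le_one_left zero_le hμ)

end L2

section ConvexCombination

variable {V : Type*} [NormedAddCommGroup V] [NormedSpace ℝ V] [FiniteDimensional ℝ V]
  [MeasurableSpace V] [BorelSpace V] {μ : Measure V} [μ.IsAddHaarMeasure]

lemma lintegral_comp_add_smul {s : ℝ} (hs : 0 < s) (c : V) {f : V → ℝ≥0∞} (hf : Measurable f) :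
    ∫⁻ y, f (c + s • y) ∂μ = ENNReal.ofReal (s ^ Module.finrank ℝ V)⁻¹ * ∫⁻ y, f y ∂μ := by
  have hmap := Measure.map_addHaar_smul μ hs.ne'
  rw [abs_of_pos (by positivity)] at hmap
  calc ∫⁻ y, f (c + s • y) ∂μ
      = ∫⁻ y, f (c + y) ∂(μ.map (s • ·)) := by
        rw [lintegral_map (by fun_prop) (by fun_prop)]
    _ = ENNReal.ofReal (s ^ Module.finrank ℝ V)⁻¹ * ∫⁻ y, f y ∂μ := by
        rw [hmap, lintegral_smul_measure, lintegral_add_left_eq_self, smul_eq_mul]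

variable {U : Set V} {s : ℝ} {g : V → ℝ≥0∞}

lemma setLIntegral_convex_comb_le (hU : Convex ℝ U) (hUm : MeasurableSet U)
    (hs : s ∈ Ioo (0 : ℝ) 1) {x : V} (hx : x ∈ U) (hg : Measurable g) :
    ∫⁻ y in U, g ((1 - s) • x + s • y) ∂μ ≤
      ENNReal.ofReal (s ^ Module.finrank ℝ V)⁻¹ * ∫⁻ y in U, g y ∂μ := by
  rw [← lintegral_indicator hUm g, ← lintegral_comp_add_smul hs.1 ((1 - s) • x) (hg.indicator hUm),
    ← lintegral_indicator hUm]
  refine lintegral_mono fun y => ?_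
  by_cases hy : y ∈ U
  · rw [indicator_of_mem hy, indicator_of_mem]
    exact hU hx hy (by linarith [hs.2]) hs.1.le (by ring)
  · rw [indicator_of_notMem hy]
    exact zero_le

lemma setLIntegral_setLIntegral_convex_comb_le_of_half_le (hU : Convex ℝ U)
    (hUm : MeasurableSet U) (hs : s ∈ Ico (1 / 2 : ℝ) 1) (hg : Measurable g) :
    ∫⁻ x in U, ∫⁻ y in U, g ((1 - s) • x + s • y) ∂μ ∂μ ≤
      2 ^ Module.finrank ℝ V * μ U * ∫⁻ y in U, g y ∂μ := by
  have hs0 : 0 < s := by linarith [hs.1]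
  have hpow : ENNReal.ofReal (s ^ Module.finrank ℝ V)⁻¹ ≤ 2 ^ Module.finrank ℝ V := by
    rw [← inv_pow, ENNReal.ofReal_pow (inv_nonneg.2 hs0.le)]
    gcongr
    rw [← ENNReal.ofReal_ofNat]
    refine ENNReal.ofReal_le_ofReal ?_
    rw [inv_le_comm₀ hs0 two_pos]
    linarith [hs.1]
  calc ∫⁻ x in U, ∫⁻ y in U, g ((1 - s) • x + s • y) ∂μ ∂μ
      ≤ ∫⁻ _x in U, 2 ^ Module.finrank ℝ V * ∫⁻ y in U, g y ∂μ ∂μ :=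
        setLIntegral_mono' hUm fun x hx =>
          (setLIntegral_convex_comb_le hU hUm ⟨hs0, hs.2⟩ hx hg).trans (by gcongr)
    _ = 2 ^ Module.finrank ℝ V * μ U * ∫⁻ y in U, g y ∂μ := by
        rw [setLIntegral_const, mul_right_comm]

lemma setLIntegral_setLIntegral_convex_comb_le (hU : Convex ℝ U) (hUm : MeasurableSet U)
    (hs : s ∈ Ioo (0 : ℝ) 1) (hg : Measurable g) :
    ∫⁻ x in U, ∫⁻ y in U, g ((1 - s) • x + s • y) ∂μ ∂μ ≤
      2 ^ Module.finrank ℝ V * μ U * ∫⁻ y in U, g y ∂μ := by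
  rcases le_total (1 / 2) s with h | h
  · exact setLIntegral_setLIntegral_convex_comb_le_of_half_le hU hUm ⟨h, hs.2⟩ hg
  · rw [lintegral_lintegral_swap (by fun_prop)]
    have := setLIntegral_setLIntegral_convex_comb_le_of_half_le (μ := μ) (s := 1 - s) hU hUm
      ⟨by linarith, by linarith [hs.1]⟩ hg
    simpa [add_comm] using this

end ConvexCombination

end MeasureInequalities

section PolynomialFunctions

variable {n R : ℕ} {E : Type*} [NormedAddCommGroup E] [NormedSpace ℝ E]

variable (n R E) in
/-- The polynomial functions of degree at most `R` on `ℝⁿ` with values in `E`, as the span of the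
products of a scalar polynomial and a constant vector. -/
def polySpan : Submodule ℝ (Pt n → E) :=
  Submodule.span ℝ {f | ∃ p : MvPolynomial (Fin n) ℝ, p.totalDegree ≤ R ∧ ∃ e : E,
    f = fun x : Pt n => MvPolynomial.eval (fun i => x i) p • e}

lemma eval_smul_mem_polySpan {p : MvPolynomial (Fin n) ℝ} (hp : p.totalDegree ≤ R) (e : E) :
    (fun x : Pt n => MvPolynomial.eval (fun i => x i) p • e) ∈ polySpan n R E :=
  Submodule.subset_span ⟨p, hp, e, rfl⟩

lemma polySpan_mono {S : ℕ} (h : R ≤ S) : polySpan n R E ≤ polySpan n S E :=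
  Submodule.span_mono fun _ ⟨p, hp, e, hf⟩ => ⟨p, hp.trans h, e, hf⟩

lemma contDiff_mvPolynomial_eval (p : MvPolynomial (Fin n) ℝ) :
    ContDiff ℝ ∞ fun x : Pt n => MvPolynomial.eval (fun i => x i) p := by
  induction p using MvPolynomial.induction_on with
  | C a => simpa using contDiff_const
  | add p q hp hq => simpa using hp.add hq
  | mul_X p i hp =>
    simp only [map_mul, MvPolynomial.eval_X]
    exact hp.mul (EuclideanSpace.proj (𝕜 := ℝ) i).contDiff

lemma contDiff_of_mem_polySpan {q : Pt n → E} (hq : q ∈ polySpan n R E) : ContDiff ℝ ∞ q := by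
  induction hq using Submodule.span_induction with
  | mem f hf =>
    obtain ⟨p, -, e, rfl⟩ := hf
    exact (contDiff_mvPolynomial_eval p).smul contDiff_const
  | zero => exact contDiff_const
  | add f g _ _ hf hg => exact hf.add hg
  | smul a f _ hf => exact contDiff_const.smul hf

lemma mem_polySpan_of_injective {ι : Type*} [Finite ι] {J : E →ₗ[ℝ] ι → ℝ}
    (hJ : Function.Injective J) {q : Pt n → E}
    (hq : ∀ i, ∃ p : MvPolynomial (Fin n) ℝ, p.totalDegree ≤ R ∧
      ∀ x : Pt n, J (q x) i = MvPolynomial.eval (fun i => x i) p) :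
    q ∈ polySpan n R E := by
  classical
  have := Fintype.ofFinite ι
  choose p hp hq using hq
  obtain ⟨L, hL⟩ := J.exists_leftInverse_of_injective (LinearMap.ker_eq_bot.2 hJ)
  have hexpand : q = ∑ i, fun x : Pt n =>
      MvPolynomial.eval (fun i => x i) (p i) • L (Pi.single i 1) := by
    ext1 x
    calc q x = L (J (q x)) := by rw [← LinearMap.comp_apply, hL, LinearMap.id_apply]
      _ = ∑ i, J (q x) i • L (Pi.single i 1) := by
        conv_lhs => rw [← Finset.univ_sum_single (J (q x)), map_sum]
        exact Finset.sum_congr rfl fun i _ => by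
          rw [← map_smul, ← Pi.single_smul, smul_eq_mul, mul_one]
      _ = _ := by simp only [hq, Finset.sum_apply]
  rw [hexpand]
  exact Submodule.sum_mem _ fun i _ => eval_smul_mem_polySpan (hp i) _

variable (R E) in
/-- The polynomial function of one real variable with given coefficients in `E`, as a linear
function of the coefficients. -/
def polyOfCoeffs : (Fin (R + 1) → E) →ₗ[ℝ] ℝ → E where
  toFun a s := ∑ i : Fin (R + 1), s ^ (i : ℕ) • a i
  map_add' a b := by ext s; simp [Finset.sum_add_distrib]
  map_smul' c a := by ext s; simp [Finset.smul_sum, smul_comm c]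

lemma polyOfCoeffs_apply (a : Fin (R + 1) → E) (s : ℝ) :
    polyOfCoeffs R E a s = ∑ i : Fin (R + 1), s ^ (i : ℕ) • a i := rfl

lemma continuous_polyOfCoeffs (a : Fin (R + 1) → E) : Continuous (polyOfCoeffs R E a) := by
  simp only [funext (polyOfCoeffs_apply a)]
  fun_prop

lemma mvPolynomial_eval_add_smul (p : MvPolynomial (Fin n) ℝ) (z d : Pt n) (s : ℝ) :
    MvPolynomial.eval (fun i => (z + s • d) i) p =
      (MvPolynomial.aeval
        (fun i => Polynomial.C (z i) + Polynomial.X * Polynomial.C (d i)) p).eval s := by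
  change _ = (Polynomial.evalRingHom s) (MvPolynomial.aeval _ p)
  have hC : (Polynomial.evalRingHom s).comp (algebraMap ℝ (Polynomial ℝ)) = RingHom.id ℝ := by
    ext; simp
  rw [MvPolynomial.aeval_def, MvPolynomial.hom_eval₂, hC, MvPolynomial.eval₂_id]
  simp [mul_comm s]

lemma exists_polyOfCoeffs_eq_comp_line {q : Pt n → E} (hq : q ∈ polySpan n R E) (z d : Pt n) :
    ∃ a, ∀ s : ℝ, q (z + s • d) = polyOfCoeffs R E a s := by
  suffices h : polySpan n R E ≤
      (LinearMap.range (polyOfCoeffs R E)).comap (LinearMap.funLeft ℝ E fun s : ℝ => z + s • d) by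
    obtain ⟨a, ha⟩ := h hq
    exact ⟨a, fun s => (congrFun ha s).symm⟩
  refine Submodule.span_le.2 ?_
  rintro _ ⟨p, hp, e, rfl⟩
  let P : Polynomial ℝ := MvPolynomial.aeval
    (fun i => Polynomial.C (z i) + Polynomial.X * Polynomial.C (d i)) p
  have hP : P.natDegree ≤ R := by
    simpa only [mul_one] using MvPolynomial.aeval_natDegree_le p hp
      (fun i => Polynomial.C (z i) + Polynomial.X * Polynomial.C (d i)) (n := 1)
      (fun i => by compute_degree)
  refine ⟨fun i => P.coeff i • e, funext fun s => ?_⟩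
  rw [LinearMap.funLeft_apply, mvPolynomial_eval_add_smul,
    Polynomial.eval_eq_sum_range' (Nat.lt_succ_of_le hP), Finset.sum_smul, Finset.sum_range,
    polyOfCoeffs_apply]
  exact Finset.sum_congr rfl fun i _ => by rw [mul_comm, mul_smul]

lemma eq_zero_of_polyOfCoeffs_eq_zero {a : Fin (R + 1) → E} {S : Set ℝ} (hS : S.Infinite)
    (h : EqOn (polyOfCoeffs R E a) 0 S) : a = 0 := by
  ext i
  refine (SeparatingDual.eq_zero_iff_forall_dual_eq_zero (R := ℝ) (a i)).2 fun f => ?_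
  let P : Polynomial ℝ := ∑ j : Fin (R + 1), Polynomial.monomial (j : ℕ) (f (a j))
  have hroot : ∀ s ∈ S, P.IsRoot s := fun s hs => by
    have hfs := congrArg f (h hs)
    simp only [polyOfCoeffs_apply, map_sum, map_smul, Pi.zero_apply, map_zero,
      smul_eq_mul] at hfs
    simp only [P, Polynomial.IsRoot, Polynomial.eval_finsetSum, Polynomial.eval_monomial, ← hfs]
    exact Finset.sum_congr rfl fun _ _ => mul_comm _ _
  have hcoeff := congrArg (fun Q => Q.coeff (i : ℕ))
    (Polynomial.eq_zero_of_infinite_isRoot P (hS.mono hroot))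
  simpa [P, Polynomial.finsetSum_coeff, Polynomial.coeff_monomial, Fin.val_inj] using hcoeff

lemma exists_enorm_le_mul_eLpNorm {F G X : Type*} [NormedAddCommGroup F] [NormedSpace ℝ F]
    [FiniteDimensional ℝ F] [NormedAddCommGroup G] [NormedSpace ℝ G] [MeasurableSpace X]
    {μ : Measure X} {p : ℝ≥0∞} [Fact (1 ≤ p)] (B : F →ₗ[ℝ] G) {A : F →ₗ[ℝ] X → E}
    (hmem : ∀ a, MemLp (A a) p μ) (hinj : ∀ a, A a =ᵐ[μ] 0 → a = 0) :
    ∃ C : ℝ≥0, ∀ a, ‖B a‖ₑ ≤ C * eLpNorm (A a) p μ := by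
  let A' : F →ₗ[ℝ] Lp E p μ :=
    { toFun := fun a => (hmem a).toLp
      map_add' := fun a b => by
        rw [← MemLp.toLp_add]
        exact MemLp.toLp_congr _ _ (ae_of_all _ fun s => by simp)
      map_smul' := fun c a => by
        rw [RingHom.id_apply, ← MemLp.toLp_const_smul]
        exact MemLp.toLp_congr _ _ (ae_of_all _ fun s => by simp) }
  have hker : A'.ker = ⊥ := LinearMap.ker_eq_bot'.2 fun a ha =>
    hinj a ((MemLp.toLp_eq_toLp_iff (hmem a) MemLp.zero).1 (by simpa [A'] using ha))
  obtain ⟨L, -, hL⟩ := A'.exists_antilipschitzWith hker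
  refine ⟨‖B.toContinuousLinearMap‖₊ * L, fun a => ?_⟩
  calc ‖B a‖ₑ ≤ ‖B.toContinuousLinearMap‖₊ * ‖a‖ₑ := B.toContinuousLinearMap.le_opENorm a
    _ ≤ ‖B.toContinuousLinearMap‖₊ * (L * ‖A' a‖ₑ) := by
      gcongr
      simpa using hL a 0
    _ = _ := by rw [← mul_assoc, ENNReal.coe_mul, ← Lp.enorm_toLp (hmem a)]; rfl

variable (R E) in
lemma exists_enorm_polyOfCoeffs_one_sq_le [FiniteDimensional ℝ E] :
    ∃ C : ℝ≥0, ∀ a, ‖polyOfCoeffs R E a 1‖ₑ ^ 2 ≤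
      C * ∫⁻ s in Ioo (1 / 2 : ℝ) 1, ‖polyOfCoeffs R E a s‖ₑ ^ 2 := by
  have hmem (a) : MemLp (polyOfCoeffs R E a) 2 (volume.restrict (Ioo (1 / 2 : ℝ) 1)) := by
    obtain ⟨M, hM⟩ := (isCompact_Icc (a := (1 / 2 : ℝ)) (b := 1)).exists_bound_of_continuousOn
      (continuous_polyOfCoeffs a).continuousOn
    refine MemLp.of_bound (continuous_polyOfCoeffs a).aestronglyMeasurable M ?_
    filter_upwards [ae_restrict_mem measurableSet_Ioo] with s hs
    exact hM s (Ioo_subset_Icc_self hs)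
  have hinj (a) (ha : polyOfCoeffs R E a =ᵐ[volume.restrict (Ioo (1 / 2 : ℝ) 1)] 0) : a = 0 :=
    eq_zero_of_polyOfCoeffs_eq_zero (Ioo_infinite (by norm_num)) <|
      Measure.eqOn_open_of_ae_eq ha isOpen_Ioo (continuous_polyOfCoeffs a).continuousOn
        continuousOn_const
  obtain ⟨C, hC⟩ :=
    exists_enorm_le_mul_eLpNorm (LinearMap.proj 1 ∘ₗ polyOfCoeffs R E) hmem hinj
  refine ⟨C ^ 2, fun a => ?_⟩
  rw [← eLpNorm_two_sq, ENNReal.coe_pow, ← mul_pow]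
  gcongr
  exact hC a

end PolynomialFunctions

section PolynomialForms

variable {n k : ℕ}

lemma polyForms_subset_polySpan (r : ℕ) :
    polyForms n r k ⊆ (polySpan n r (Alt (Pt n) k) : Set (Form n k)) := by
  intro v hv
  let J : Alt (Pt n) k →ₗ[ℝ] (Fin k ↪o Fin n) → ℝ :=
    { toFun := fun α I => α fun a => stdVec (I a)
      map_add' := fun _ _ => rfl
      map_smul' := fun _ _ => rfl }
  have hJ : Function.Injective J := fun α β h =>
    alt_ext_of_orderEmbedding (EuclideanSpace.basisFun (Fin n) ℝ).toBasis fun I => by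
      rw [OrthonormalBasis.coe_toBasis]
      exact congrFun h I
  exact mem_polySpan_of_injective hJ hv

lemma curryLeft_eq_sum_stdVec (α : Alt (Pt n) (k + 1)) (x : Pt n) :
    α.curryLeft x = ∑ i, x i • α.curryLeft (stdVec i) := by
  have hx : ∑ i, x i • stdVec i = x := by
    simpa using (EuclideanSpace.basisFun (Fin n) ℝ).sum_repr x
  conv_lhs => rw [← hx, map_sum]
  exact Finset.sum_congr rfl fun i _ => map_smul _ _ _

lemma koszul_eval_smul (p : MvPolynomial (Fin n) ℝ) (α : Alt (Pt n) (k + 1)) :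
    (koszul fun x : Pt n => MvPolynomial.eval (fun i => x i) p • α) =
      ∑ i : Fin n, fun x : Pt n =>
        MvPolynomial.eval (fun i => x i) (p * MvPolynomial.X i) • α.curryLeft (stdVec i) := by
  ext1 x
  have hkoszul : koszul (fun x : Pt n => MvPolynomial.eval (fun i => x i) p • α) x =
      MvPolynomial.eval (fun i => x i) p • α.curryLeft x := by
    ext m
    simp [koszul]
  rw [hkoszul, curryLeft_eq_sum_stdVec, Finset.smul_sum, Finset.sum_apply]
  exact Finset.sum_congr rfl fun i _ => by rw [smul_smul, map_mul, MvPolynomial.eval_X]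

lemma koszul_mem_polySpan {r : ℕ} {b : Form n (k + 1)}
    (hb : b ∈ polySpan n r (Alt (Pt n) (k + 1))) :
    koszul b ∈ polySpan n (r + 1) (Alt (Pt n) k) := by
  let κ : Form n (k + 1) →ₗ[ℝ] Form n k :=
    { toFun := koszul
      map_add' := fun f g => by ext x m; simp [koszul]
      map_smul' := fun a f => by ext x m; simp [koszul] }
  suffices h : polySpan n r (Alt (Pt n) (k + 1)) ≤ (polySpan n (r + 1) (Alt (Pt n) k)).comap κ from
    h hb
  refine Submodule.span_le.2 ?_
  rintro _ ⟨p, hp, α, rfl⟩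
  change koszul _ ∈ polySpan n (r + 1) (Alt (Pt n) k)
  rw [koszul_eval_smul]
  refine Submodule.sum_mem _ fun i _ => eval_smul_mem_polySpan ?_ _
  exact (MvPolynomial.totalDegree_mul _ _).trans (by simpa using hp)

lemma polyFormsMinus_subset_polySpan (r : ℕ) :
    polyFormsMinus n (r + 1) k ⊆ (polySpan n (r + 1) (Alt (Pt n) k) : Set (Form n k)) := by
  rintro _ ⟨a, ha, b, hb, rfl⟩
  exact Submodule.add_mem _ (polySpan_mono (Nat.le_succ r) (polyForms_subset_polySpan r ha))
    (koszul_mem_polySpan (polyForms_subset_polySpan r hb))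

end PolynomialForms

section SmoothEstimates

variable {V E : Type*} [NormedAddCommGroup V] [NormedSpace ℝ V] [NormedAddCommGroup E]
  [NormedSpace ℝ E] {w : V → E}

lemma continuous_fderiv_comp_line (hw : ContDiff ℝ 1 w) (z d : V) :
    Continuous fun s : ℝ => fderiv ℝ w (z + s • d) := by
  have := hw.continuous_fderiv one_ne_zero
  fun_prop

variable [CompleteSpace E]

lemma enorm_sub_le_lintegral_fderiv (hw : ContDiff ℝ 1 w) (z d : V) {a b : ℝ} (hab : a ≤ b) :
    ‖w (z + b • d) - w (z + a • d)‖ₑ ≤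
      ∫⁻ s in Ioo a b, ‖d‖ₑ * ‖fderiv ℝ w (z + s • d)‖ₑ := by
  have hder (s : ℝ) : HasDerivAt (fun s : ℝ => w (z + s • d)) (fderiv ℝ w (z + s • d) d) s := by
    have hline : HasDerivAt (fun s : ℝ => z + s • d) d s := by
      simpa using ((hasDerivAt_id s).smul_const d).const_add z
    exact (hw.differentiable one_ne_zero _).hasFDerivAt.comp_hasDerivAt s hline
  have hcont : Continuous fun s : ℝ => fderiv ℝ w (z + s • d) d :=
    (continuous_fderiv_comp_line hw z d).clm_apply continuous_const
  rw [← intervalIntegral.integral_eq_sub_of_hasDerivAt (fun s _ => hder s)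
    (hcont.intervalIntegrable _ _), intervalIntegral.integral_of_le hab,
    integral_Ioc_eq_integral_Ioo]
  refine (enorm_integral_le_lintegral_enorm _).trans (lintegral_mono fun s => ?_)
  rw [mul_comm]
  exact ContinuousLinearMap.le_opENorm _ _

lemma enorm_sq_le_lintegral_ray (hw : ContDiff ℝ 1 w) (z d : V) :
    ‖w (z + d)‖ₑ ^ 2 ≤ 2 * ∫⁻ s in Ioo (1 / 2 : ℝ) 1,
      (‖w (z + s • d)‖ₑ + ‖d‖ₑ * ‖fderiv ℝ w (z + s • d)‖ₑ) ^ 2 := by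
  set ν : Measure ℝ := volume.restrict (Ioo (1 / 2 : ℝ) 1)
  have hν : ν univ = 2⁻¹ := by
    simp only [ν, Measure.restrict_apply_univ, Real.volume_Ioo]
    rw [show (1 - 1 / 2 : ℝ) = 2⁻¹ by norm_num, ENNReal.ofReal_inv_of_pos two_pos,
      ENNReal.ofReal_ofNat]
  have hwm : Measurable fun s : ℝ => ‖w (z + s • d)‖ₑ := by
    have := hw.continuous
    exact (by fun_prop : Continuous fun s : ℝ => w (z + s • d)).enorm.measurable
  have hdwm : Measurable fun s : ℝ => ‖d‖ₑ * ‖fderiv ℝ w (z + s • d)‖ₑ :=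
    (continuous_fderiv_comp_line hw z d).enorm.measurable.const_mul _
  have hmean : ‖w (z + d)‖ₑ * 2⁻¹ ≤
      ∫⁻ s, (‖w (z + s • d)‖ₑ + ‖d‖ₑ * ‖fderiv ℝ w (z + s • d)‖ₑ) ∂ν := by
    set G := ∫⁻ s, ‖d‖ₑ * ‖fderiv ℝ w (z + s • d)‖ₑ ∂ν
    have hpt : ∀ t ∈ Ioo (1 / 2 : ℝ) 1, ‖w (z + d)‖ₑ ≤ ‖w (z + t • d)‖ₑ + G := fun t ht =>
      calc ‖w (z + d)‖ₑ
          = ‖w (z + t • d) + (w (z + (1 : ℝ) • d) - w (z + t • d))‖ₑ := by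
            rw [add_sub_cancel, one_smul]
        _ ≤ ‖w (z + t • d)‖ₑ + G := (enorm_add_le _ _).trans <| by
            gcongr
            exact (enorm_sub_le_lintegral_fderiv hw z d ht.2.le).trans
              (lintegral_mono_set (Ioo_subset_Ioo_left ht.1.le))
    calc ‖w (z + d)‖ₑ * 2⁻¹ = ∫⁻ _t, ‖w (z + d)‖ₑ ∂ν := by rw [lintegral_const, hν]
      _ ≤ ∫⁻ t, (‖w (z + t • d)‖ₑ + G) ∂ν := setLIntegral_mono' measurableSet_Ioo hpt
      _ = (∫⁻ t, ‖w (z + t • d)‖ₑ ∂ν) + G * 2⁻¹ := by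
        rw [lintegral_add_left hwm, lintegral_const, hν]
      _ ≤ (∫⁻ t, ‖w (z + t • d)‖ₑ ∂ν) + G := by
        gcongr
        exact mul_le_of_le_one_right zero_le (by simp)
      _ = _ := (lintegral_add_left hwm _).symm
  have hsq := (pow_le_pow_left' hmean 2).trans
    (sq_lintegral_le_measure_univ_mul (hwm.add hdwm).aemeasurable)
  rw [hν, mul_pow, sq 2⁻¹, mul_left_comm] at hsq
  have hcancel := (ENNReal.mul_le_mul_iff_right (by simp) (by simp)).1 hsq
  rwa [mul_comm, ENNReal.inv_mul_le_iff two_ne_zero ENNReal.ofNat_ne_top] at hcancel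

lemma enorm_sub_sq_le_lintegral_segment (hw : ContDiff ℝ 1 w) (x y : V) :
    ‖w x - w y‖ₑ ^ 2 ≤
      ∫⁻ s in Ioo (0 : ℝ) 1, (edist x y * ‖fderiv ℝ w ((1 - s) • x + s • y)‖ₑ) ^ 2 := by
  have hline (s : ℝ) : (1 - s) • x + s • y = x + s • (y - x) := by module
  have hsub := enorm_sub_le_lintegral_fderiv hw x (y - x) zero_le_one
  rw [one_smul, zero_smul, add_zero, add_sub_cancel, ← edist_eq_enorm_sub, ← edist_eq_enorm_sub,
    edist_comm, edist_comm y] at hsub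
  simp only [hline, ← edist_eq_enorm_sub]
  exact (pow_le_pow_left' hsub 2).trans <| sq_lintegral_le (by simp)
    ((continuous_fderiv_comp_line hw x (y - x)).enorm.measurable.const_mul _).aemeasurable

variable [FiniteDimensional ℝ V] [MeasurableSpace V] [BorelSpace V] {μ : Measure V}
  [μ.IsAddHaarMeasure]

lemma lintegral_lintegral_enorm_sub_sq_le {U : Set V} (hU : Convex ℝ U) (hUm : MeasurableSet U)
    (hUb : Bornology.IsBounded U) (hw : ContDiff ℝ 1 w) :
    ∫⁻ x in U, ∫⁻ y in U, ‖w x - w y‖ₑ ^ 2 ∂μ ∂μ ≤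
      2 ^ Module.finrank ℝ V * μ U *
        (Metric.ediam U ^ 2 * ∫⁻ x in U, ‖fderiv ℝ w x‖ₑ ^ 2 ∂μ) := by
  set g : V → ℝ≥0∞ := fun x => Metric.ediam U ^ 2 * ‖fderiv ℝ w x‖ₑ ^ 2 with hg
  have hgm : Measurable g :=
    ((hw.continuous_fderiv one_ne_zero).enorm.measurable.pow_const 2).const_mul _
  have hpt : ∀ x ∈ U, ∀ y ∈ U, ‖w x - w y‖ₑ ^ 2 ≤
      ∫⁻ s in Ioo (0 : ℝ) 1, g ((1 - s) • x + s • y) := fun x hx y hy =>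
    (enorm_sub_sq_le_lintegral_segment hw x y).trans <| lintegral_mono fun s => by
      rw [mul_pow]
      exact mul_le_mul_left (pow_le_pow_left' (Metric.edist_le_ediam_of_mem hx hy) 2) _
  calc ∫⁻ x in U, ∫⁻ y in U, ‖w x - w y‖ₑ ^ 2 ∂μ ∂μ
      ≤ ∫⁻ x in U, ∫⁻ y in U, (∫⁻ s in Ioo (0 : ℝ) 1, g ((1 - s) • x + s • y)) ∂μ ∂μ :=
        setLIntegral_mono' hUm fun x hx => setLIntegral_mono' hUm fun y hy => hpt x hx y hy
    _ = ∫⁻ s in Ioo (0 : ℝ) 1, ∫⁻ x in U, ∫⁻ y in U, g ((1 - s) • x + s • y) ∂μ ∂μ := by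
        have hswap (x : V) : ∫⁻ y in U, (∫⁻ s in Ioo (0 : ℝ) 1, g ((1 - s) • x + s • y)) ∂μ =
            ∫⁻ s in Ioo (0 : ℝ) 1, ∫⁻ y in U, g ((1 - s) • x + s • y) ∂μ :=
          lintegral_lintegral_swap (by fun_prop)
        simp_rw [hswap]
        rw [lintegral_lintegral_swap]
        have : Measurable fun p : (V × ℝ) × V =>
            g ((1 - p.1.2) • p.1.1 + p.1.2 • p.2) := by fun_prop
        exact (this.lintegral_prod_right' (ν := μ.restrict U)).aemeasurable
    _ ≤ ∫⁻ _s in Ioo (0 : ℝ) 1, 2 ^ Module.finrank ℝ V * μ U * ∫⁻ y in U, g y ∂μ :=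
        setLIntegral_mono' measurableSet_Ioo fun s hs =>
          setLIntegral_setLIntegral_convex_comb_le hU hUm hs hgm
    _ = _ := by
        rw [setLIntegral_const, hg,
          lintegral_const_mul' _ _ (ENNReal.pow_ne_top hUb.ediam_ne_top)]
        simp

end SmoothEstimates

section FacetEstimates

variable {n : ℕ} {E : Type*} [NormedAddCommGroup E] [NormedSpace ℝ E]

lemma ofReal_sqrt_mul_le_of_mul_sq_le {h : ℝ} (hh : 0 ≤ h) {c : ℝ≥0} {a b : ℝ≥0∞}
    (hab : ENNReal.ofReal h * a ^ 2 ≤ c * b ^ 2) :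
    ENNReal.ofReal (h ^ (1 / 2 : ℝ)) * a ≤ NNReal.sqrt c * b := by
  rwa [← ENNReal.pow_le_pow_left_iff two_ne_zero, mul_pow, mul_pow,
    ← ENNReal.ofReal_pow (by positivity), ← Real.sqrt_eq_rpow, Real.sq_sqrt hh,
    ← ENNReal.coe_pow, NNReal.sq_sqrt]

lemma IsRegularSimplex.cellDiam_mul_lintegral_facet_le {γ : ℝ} {K : Finset (Pt n)} (hn : 0 < n)
    (hK : IsRegularSimplex γ K) {z : Pt n} (hz : z ∈ K) {f g : Pt n → ℝ≥0∞} (hg : Measurable g)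
    {c : ℝ≥0}
    (hfg : ∀ x ∈ facet K z, f x ≤ c * ∫⁻ s in Ioo (1 / 2 : ℝ) 1, g (z + s • (x - z))) :
    ENNReal.ofReal (cellDiam K) * ∫⁻ x, f x ∂facetMeasure K z ≤
      (c * (γ * 2 ^ (n - 1)).toNNReal : ℝ≥0) * ∫⁻ y in cell K, g y :=
  calc ENNReal.ofReal (cellDiam K) * ∫⁻ x, f x ∂facetMeasure K z
      ≤ ENNReal.ofReal (cellDiam K) *
          ∫⁻ x, c * (∫⁻ s in Ioo (1 / 2 : ℝ) 1, g (z + s • (x - z))) ∂facetMeasure K z := by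
        gcongr ENNReal.ofReal (cellDiam K) * ?_
        exact setLIntegral_mono' (isCompact_facet z).measurableSet hfg
    _ = c * (ENNReal.ofReal (cellDiam K) *
          ∫⁻ x, (∫⁻ s in Ioo (1 / 2 : ℝ) 1, g (z + s • (x - z))) ∂facetMeasure K z) := by
        rw [lintegral_const_mul' _ _ ENNReal.coe_ne_top, mul_left_comm]
    _ ≤ c * (ENNReal.ofReal (γ * 2 ^ (n - 1)) * ∫⁻ y in cell K, g y) := by
        gcongr c * ?_
        exact hK.cellDiam_mul_lintegral_rays_le hn hz hg
    _ = _ := by rw [← mul_assoc, ENNReal.coe_mul]; rfl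

variable (E) in
theorem exists_inverse_facet_estimate [FiniteDimensional ℝ E] (hn : 0 < n) (R : ℕ) (γ : ℝ) :
    ∃ C : ℝ≥0, ∀ K : Finset (Pt n), IsRegularSimplex γ K → ∀ z ∈ K, ∀ q ∈ polySpan n R E,
      ENNReal.ofReal (cellDiam K ^ (1 / 2 : ℝ)) * eLpNorm q 2 (facetMeasure K z) ≤
        C * eLpNorm q 2 (volume.restrict (cell K)) := by
  obtain ⟨C, hC⟩ := exists_enorm_polyOfCoeffs_one_sq_le R E
  refine ⟨NNReal.sqrt (C * (γ * 2 ^ (n - 1)).toNNReal), fun K hK z hz q hq =>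
    ofReal_sqrt_mul_le_of_mul_sq_le (hK.cellDiam_pos hn).le ?_⟩
  rw [eLpNorm_two_sq, eLpNorm_two_sq]
  refine hK.cellDiam_mul_lintegral_facet_le hn hz (g := fun y => ‖q y‖ₑ ^ 2)
    ((contDiff_of_mem_polySpan hq).continuous.enorm.measurable.pow_const 2) fun x _ => ?_
  obtain ⟨a, ha⟩ := exists_polyOfCoeffs_eq_comp_line hq z (x - z)
  have hx : q x = polyOfCoeffs R E a 1 := by
    rw [← ha, one_smul, add_sub_cancel]
  simp only [hx, ha]
  exact hC a

lemma eLpNorm_fderiv_le_sum {w : Pt n → E} (hw : ContDiff ℝ 1 w) (μ : Measure (Pt n)) :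
    eLpNorm (fderiv ℝ w) 2 μ ≤ ∑ j, eLpNorm (fun x => fderiv ℝ w x (stdVec j)) 2 μ := by
  have hpt (x : Pt n) : ‖fderiv ℝ w x‖ ≤ ∑ j, ‖fderiv ℝ w x (stdVec j)‖ := by
    refine ContinuousLinearMap.opNorm_le_bound _ (Finset.sum_nonneg fun _ _ => norm_nonneg _)
      fun d => ?_
    have hd : ∑ i, d i • stdVec i = d := by
      simpa using (EuclideanSpace.basisFun (Fin n) ℝ).sum_repr d
    conv_lhs => rw [← hd]
    rw [map_sum, Finset.sum_mul]
    refine (norm_sum_le _ _).trans (Finset.sum_le_sum fun i _ => ?_)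
    rw [map_smul, norm_smul, mul_comm]
    gcongr
    exact PiLp.norm_apply_le d i
  have := hw.continuous_fderiv one_ne_zero
  calc eLpNorm (fderiv ℝ w) 2 μ
      ≤ eLpNorm (∑ j, fun x => ‖fderiv ℝ w x (stdVec j)‖) 2 μ :=
        eLpNorm_mono_real fun x => (hpt x).trans_eq (by rw [Finset.sum_apply])
    _ ≤ ∑ j, eLpNorm (fun x => ‖fderiv ℝ w x (stdVec j)‖) 2 μ :=
        eLpNorm_sum_le (fun j _ =>
          (by fun_prop : Continuous fun x => ‖fderiv ℝ w x (stdVec j)‖).aestronglyMeasurable)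
          one_le_two
    _ = _ := by simp only [eLpNorm_norm]

/-- The `H¹` norm on the simplex `K`, scaled by powers of `h_K` so that it transforms like an `L²`
norm, of a function `v` with gradient `G`: the quantity `‖v‖_K + h_K ∑ⱼ ‖Gⱼ‖_K`. -/
noncomputable def scaledH1Norm (K : Finset (Pt n)) (v : Pt n → E) (G : Fin n → Pt n → E) :
    ℝ≥0∞ :=
  eLpNorm v 2 (volume.restrict (cell K)) +
    ENNReal.ofReal (cellDiam K) * ∑ j, eLpNorm (G j) 2 (volume.restrict (cell K))

/-- The constant of the scaled trace inequality on a facet of an `n`-simplex of shape regularity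
`γ`. -/
noncomputable def traceConst (n : ℕ) (γ : ℝ) : ℝ≥0 :=
  NNReal.sqrt (2 * (γ * 2 ^ (n - 1)).toNNReal)

theorem IsRegularSimplex.eLpNorm_facetMeasure_le [CompleteSpace E] {γ : ℝ} {K : Finset (Pt n)}
    (hn : 0 < n) (hK : IsRegularSimplex γ K) {z : Pt n} (hz : z ∈ K) {w : Pt n → E}
    (hw : ContDiff ℝ 1 w) :
    ENNReal.ofReal (cellDiam K ^ (1 / 2 : ℝ)) * eLpNorm w 2 (facetMeasure K z) ≤
      traceConst n γ * scaledH1Norm K w fun j x => fderiv ℝ w x (stdVec j) := by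
  have hdiam := (hK.cellDiam_pos hn).le
  have := hw.continuous_fderiv one_ne_zero
  have := hw.continuous
  set G : Pt n → ℝ := (fun x => ‖w x‖) + cellDiam K • fun x => ‖fderiv ℝ w x‖ with hG
  have hG_enorm (x : Pt n) :
      ‖G x‖ₑ = ‖w x‖ₑ + ENNReal.ofReal (cellDiam K) * ‖fderiv ℝ w x‖ₑ := by
    rw [Real.enorm_of_nonneg (by simp only [hG, Pi.add_apply, Pi.smul_apply]; positivity)]
    simp only [hG, Pi.add_apply, Pi.smul_apply, smul_eq_mul]
    rw [ENNReal.ofReal_add (by positivity) (by positivity), ENNReal.ofReal_mul hdiam, ofReal_norm,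
      ofReal_norm]
  have hG_eLpNorm : eLpNorm G 2 (volume.restrict (cell K)) ≤
      scaledH1Norm K w fun j x => fderiv ℝ w x (stdVec j) := by
    refine (eLpNorm_add_le (by fun_prop) (by fun_prop) one_le_two).trans ?_
    rw [eLpNorm_const_smul, eLpNorm_norm, eLpNorm_norm, Real.enorm_of_nonneg hdiam, scaledH1Norm]
    gcongr
    exact eLpNorm_fderiv_le_sum hw _
  refine (ofReal_sqrt_mul_le_of_mul_sq_le hdiam ?_).trans (mul_le_mul_right hG_eLpNorm _)
  rw [eLpNorm_two_sq, eLpNorm_two_sq]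
  refine hK.cellDiam_mul_lintegral_facet_le hn hz (g := fun y => ‖G y‖ₑ ^ 2) (by fun_prop)
    fun x hx => ?_
  have hdist : ‖x - z‖ₑ ≤ ENNReal.ofReal (cellDiam K) := by
    rw [← ofReal_norm, ← dist_eq_norm]
    exact ENNReal.ofReal_le_ofReal
      (dist_le_cellDiam (facet_subset_hull z hx) (subset_convexHull ℝ _ hz))
  have hray := enorm_sq_le_lintegral_ray hw z (x - z)
  rw [add_sub_cancel] at hray
  simp only [hG_enorm, ENNReal.coe_ofNat]
  exact hray.trans (by gcongr)

end FacetEstimates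

section WeakGradients

variable {n : ℕ} {E : Type*} [NormedAddCommGroup E] [NormedSpace ℝ E] {U : Set (Pt n)}

/-- The field `v ∈ L²(U)` has the weak partial derivatives `G j ∈ L²(U)`; the fields are functions
on the whole space, of which only the values on `U` matter. -/
structure HasWeakGrad (U : Set (Pt n)) (v : Pt n → E) (G : Fin n → Pt n → E) : Prop where
  memLp : MemLp v 2 (volume.restrict U)
  memLp_grad : ∀ j, MemLp (G j) 2 (volume.restrict U)
  eq : ∀ j, ∀ φ : Pt n → ℝ, ContDiff ℝ ∞ φ → HasCompactSupport φ → tsupport φ ⊆ U →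
    ∫ x in U, fderiv ℝ φ x (stdVec j) • v x = -∫ x in U, φ x • G j x

lemma integrable_smul_of_memLp {X : Type*} [TopologicalSpace X] [T2Space X] [MeasurableSpace X]
    [OpensMeasurableSpace X] {μ : Measure X} [IsLocallyFiniteMeasure μ] {v : X → E}
    (hv : MemLp v 2 μ) {ψ : X → ℝ} (hψ : Continuous ψ) (hψc : HasCompactSupport ψ) :
    Integrable (fun x => ψ x • v x) μ :=
  (hv.locallyIntegrable one_le_two).integrable_smul_left_of_hasCompactSupport hψ hψc

lemma memLp_of_continuous_of_isBounded {X F : Type*} [PseudoMetricSpace X] [ProperSpace X]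
    [MeasurableSpace X] [OpensMeasurableSpace X] [SecondCountableTopology X]
    [NormedAddCommGroup F] {μ : Measure X} [IsFiniteMeasureOnCompacts μ] {U : Set X}
    (hb : Bornology.IsBounded U) {w : X → F} (hw : Continuous w) (p : ℝ≥0∞) :
    MemLp w p (μ.restrict U) := by
  have hfin : IsFiniteMeasure (μ.restrict (closure U)) :=
    ⟨by simpa using hb.isCompact_closure.measure_lt_top⟩
  obtain ⟨M, hM⟩ := hb.isCompact_closure.exists_bound_of_continuousOn hw.continuousOn
  refine MemLp.mono_measure (Measure.restrict_mono_set μ subset_closure)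
    (MemLp.of_bound hw.aestronglyMeasurable M ?_)
  filter_upwards [ae_restrict_mem isClosed_closure.measurableSet] with x hx using hM x hx

lemma continuous_fderiv_stdVec {w : Pt n → E} (hw : ContDiff ℝ 1 w) (j : Fin n) :
    Continuous fun x => fderiv ℝ w x (stdVec j) :=
  (hw.continuous_fderiv one_ne_zero).clm_apply continuous_const

lemma setIntegral_eq_integral_of_tsupport_subset {f : Pt n → E} (h : tsupport f ⊆ U) :
    ∫ x in U, f x = ∫ x, f x :=
  setIntegral_eq_integral_of_forall_compl_eq_zero fun _ hx =>
    Function.notMem_support.1 fun hfx => hx (h (subset_tsupport _ hfx))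

lemma ae_eq_of_forall_setIntegral_smul_eq [CompleteSpace E] (hU : IsOpen U) {f g : Pt n → E}
    (hf : MemLp f 2 (volume.restrict U)) (hg : MemLp g 2 (volume.restrict U))
    (h : ∀ φ : Pt n → ℝ, ContDiff ℝ ∞ φ → HasCompactSupport φ → tsupport φ ⊆ U →
      ∫ x in U, φ x • f x = ∫ x in U, φ x • g x) : f =ᵐ[volume.restrict U] g := by
  have hint : LocallyIntegrableOn (f - g) U volume :=
    locallyIntegrableOn_of_locallyIntegrable_restrict
      ((hf.sub hg).locallyIntegrable one_le_two)
  have hzero : ∀ᵐ x, x ∈ U → (f - g) x = 0 :=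
    hU.ae_eq_zero_of_integral_contDiff_smul_eq_zero hint fun φ hφ hφc hφU => by
      rw [← setIntegral_eq_integral_of_tsupport_subset
        ((tsupport_smul_subset_left φ (f - g)).trans hφU)]
      simp only [Pi.sub_apply, smul_sub]
      rw [integral_sub (integrable_smul_of_memLp hf hφ.continuous hφc)
        (integrable_smul_of_memLp hg hφ.continuous hφc), h φ hφ hφc hφU, sub_self]
  rw [EventuallyEq, ae_restrict_iff' hU.measurableSet]
  filter_upwards [hzero] with x hx hxU using sub_eq_zero.1 (hx hxU)

namespace HasWeakGrad

variable {v w : Pt n → E} {G H : Fin n → Pt n → E}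

lemma sub (hv : HasWeakGrad U v G) (hw : HasWeakGrad U w H) :
    HasWeakGrad U (v - w) (fun j => G j - H j) where
  memLp := hv.memLp.sub hw.memLp
  memLp_grad j := (hv.memLp_grad j).sub (hw.memLp_grad j)
  eq j φ hφ hφc hφU := by
    have hd := continuous_fderiv_stdVec (hφ.of_le (by simp)) j
    have hdc : HasCompactSupport fun x => fderiv ℝ φ x (stdVec j) := hφc.fderiv_apply ℝ _
    simp only [Pi.sub_apply, smul_sub]
    rw [integral_sub (integrable_smul_of_memLp hv.memLp hd hdc)
      (integrable_smul_of_memLp hw.memLp hd hdc),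
      integral_sub (integrable_smul_of_memLp (hv.memLp_grad j) hφ.continuous hφc)
      (integrable_smul_of_memLp (hw.memLp_grad j) hφ.continuous hφc),
      hv.eq j φ hφ hφc hφU, hw.eq j φ hφ hφc hφU]
    abel

lemma congr (hv : HasWeakGrad U v G) (hvw : v =ᵐ[volume.restrict U] w)
    (hGH : ∀ j, G j =ᵐ[volume.restrict U] H j) : HasWeakGrad U w H where
  memLp := hv.memLp.ae_eq hvw
  memLp_grad j := (hv.memLp_grad j).ae_eq (hGH j)
  eq j φ hφ hφc hφU := by
    rw [← integral_congr_ae (hvw.mono fun x hx => congrArg (fderiv ℝ φ x (stdVec j) • ·) hx),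
      ← integral_congr_ae ((hGH j).mono fun x hx => congrArg (φ x • ·) hx)]
    exact hv.eq j φ hφ hφc hφU

lemma of_contDiff (hb : Bornology.IsBounded U) (hw : ContDiff ℝ 1 w) :
    HasWeakGrad U w fun j x => fderiv ℝ w x (stdVec j) where
  memLp := memLp_of_continuous_of_isBounded hb hw.continuous 2
  memLp_grad j := memLp_of_continuous_of_isBounded hb (continuous_fderiv_stdVec hw j) 2
  eq j φ hφ hφc hφU := by
    have hd := continuous_fderiv_stdVec (hφ.of_le (by simp)) j
    have hdc : HasCompactSupport fun x => fderiv ℝ φ x (stdVec j) := hφc.fderiv_apply ℝ _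
    rw [setIntegral_eq_integral_of_tsupport_subset, setIntegral_eq_integral_of_tsupport_subset,
      integral_smul_fderiv_eq_neg_fderiv_smul_of_integrable, neg_neg]
    · exact (hd.smul hw.continuous).integrable_of_hasCompactSupport hdc.smul_right
    · exact (hφ.continuous.smul (continuous_fderiv_stdVec hw j)).integrable_of_hasCompactSupport
        hφc.smul_right
    · exact (hφ.continuous.smul hw.continuous).integrable_of_hasCompactSupport hφc.smul_right
    · exact fun x _ => hφ.differentiable (by simp) x
    · exact fun x _ => hw.differentiable one_ne_zero x
    · exact (tsupport_smul_subset_left _ _).trans hφU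
    · exact (tsupport_smul_subset_left _ _).trans ((tsupport_fderiv_apply_subset ℝ _).trans hφU)

lemma unique [CompleteSpace E] (hU : IsOpen U) (hG : HasWeakGrad U v G)
    (hH : HasWeakGrad U v H) (j : Fin n) : G j =ᵐ[volume.restrict U] H j :=
  ae_eq_of_forall_setIntegral_smul_eq hU (hG.memLp_grad j) (hH.memLp_grad j) fun φ hφ hφc hφU =>
    neg_inj.1 ((hG.eq j φ hφ hφc hφU).symm.trans (hH.eq j φ hφ hφc hφU))

end HasWeakGrad

end WeakGradients

section ContractedMollification

variable {V E : Type*} [NormedAddCommGroup V] [NormedSpace ℝ V]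
  [NormedAddCommGroup E] [NormedSpace ℝ E]

/-- The mollification of `W` by averaging, with weight `η`, over the points `l x + (1 - l) y`,
which tend to `x` as `l → 1`. If `x` and the support of `η` lie in a convex set, then only the
values of `W` on that set enter, so that no boundary layer has to be removed. -/
noncomputable def contractMollify [MeasurableSpace V] (μ : Measure V) (η : V → ℝ) (l : ℝ)
    (W : V → E) (x : V) : E :=
  ∫ y, η y • W (l • x + (1 - l) • y) ∂μ

/-- The convolution kernel of `contractMollify`: the mollification of `W` is the convolution of
this kernel with `W`, evaluated at `l x`. -/
noncomputable def contractKernel (η : V → ℝ) (l : ℝ) (u : V) : ℝ :=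
  ((1 - l) ^ Module.finrank ℝ V)⁻¹ * η (-((1 - l)⁻¹ • u))

variable {η : V → ℝ} {l : ℝ}

lemma hasCompactSupport_contractKernel (hη : HasCompactSupport η) (hl : l < 1) :
    HasCompactSupport (contractKernel η l) := by
  have hinv : (1 - l)⁻¹ ≠ 0 := inv_ne_zero (sub_pos.2 hl).ne'
  exact (hη.comp_homeomorph ((Homeomorph.smulOfNeZero _ hinv).trans (Homeomorph.neg V))).mul_left

lemma contDiff_contractKernel {m : ℕ∞} (hη : ContDiff ℝ m η) :
    ContDiff ℝ m (contractKernel η l) := by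
  unfold contractKernel
  fun_prop

lemma tsupport_contractKernel_sub_subset {U : Set V} (hU : Convex ℝ U)
    (hηc : HasCompactSupport η)
    (hηU : tsupport η ⊆ U) (hl0 : 0 ≤ l) (hl : l < 1) {x : V} (hx : x ∈ U) :
    tsupport (fun t => contractKernel η l (l • x - t)) ⊆ U := by
  have hpos : 0 < 1 - l := sub_pos.2 hl
  have hsub : tsupport (fun t => contractKernel η l (l • x - t)) ⊆
      (fun y => l • x + (1 - l) • y) '' tsupport η := by
    refine closure_minimal (fun t ht => ⟨(1 - l)⁻¹ • (t - l • x), subset_tsupport _ ?_, ?_⟩)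
      (IsCompact.image hηc (by fun_prop)).isClosed
    · contrapose! ht
      simp only [Function.notMem_support] at ht ⊢
      simp only [contractKernel, ← smul_neg, neg_sub, ht, mul_zero]
    · simp [smul_inv_smul₀ hpos.ne']
  refine hsub.trans ?_
  rintro _ ⟨y, hy, rfl⟩
  exact hU hx (hηU hy) hl0 hpos.le (by ring)

variable [FiniteDimensional ℝ V] [MeasurableSpace V] [BorelSpace V] {μ : Measure V}
  [μ.IsAddHaarMeasure]

lemma contractMollify_eq_integral (hl : l < 1) (W : V → E) (x : V) :
    contractMollify μ η l W x = ∫ t, contractKernel η l (l • x - t) • W t ∂μ := by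
  have hpos : 0 < 1 - l := sub_pos.2 hl
  set k : V → E := fun u => contractKernel η l (-u) • W (l • x + u) with hk
  have htranslate : ∫ u, k u ∂μ = ∫ t, contractKernel η l (l • x - t) • W t ∂μ := by
    rw [← integral_add_left_eq_self (fun t => contractKernel η l (l • x - t) • W t) (l • x)]
    simp [hk]
  have hscale := Measure.integral_comp_smul μ k (1 - l)
  rw [abs_of_pos (by positivity)] at hscale
  rw [← htranslate, ← inv_smul_smul₀
    (show ((1 - l) ^ Module.finrank ℝ V)⁻¹ ≠ 0 by positivity) (∫ u, k u ∂μ), ← hscale, inv_inv,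
    ← integral_smul, contractMollify]
  congr 1 with y
  simp only [hk]
  rw [contractKernel, smul_neg, neg_neg, smul_smul, inv_smul_smul₀ hpos.ne', ← mul_assoc,
    mul_inv_cancel₀ (by positivity), one_mul]

lemma contractMollify_eq_convolution (hl : l < 1) (W : V → E) :
    contractMollify μ η l W =
      (convolution (contractKernel η l) W (ContinuousLinearMap.lsmul ℝ ℝ) μ) ∘ (l • ·) := by
  ext x
  rw [contractMollify_eq_integral hl, Function.comp_apply, convolution_eq_swap]
  rfl

lemma contDiff_contractMollify (hη : ContDiff ℝ ∞ η) (hηc : HasCompactSupport η) (hl : l < 1)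
    {W : V → E} (hW : LocallyIntegrable W μ) : ContDiff ℝ ∞ (contractMollify μ η l W) := by
  rw [contractMollify_eq_convolution hl]
  exact ((hasCompactSupport_contractKernel hηc hl).contDiff_convolution_left
    (ContinuousLinearMap.lsmul ℝ ℝ (E := E)) (contDiff_contractKernel hη) hW).comp
    (contDiff_const_smul l)

lemma fderiv_contractMollify (hη : ContDiff ℝ 1 η) (hηc : HasCompactSupport η) (hl : l < 1)
    {W : V → E} (hW : LocallyIntegrable W μ) (x d : V) :
    fderiv ℝ (contractMollify μ η l W) x d =
      l • ∫ t, fderiv ℝ (contractKernel η l) (l • x - t) d • W t ∂μ := by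
  have hk : ContDiff ℝ 1 (contractKernel η l) := contDiff_contractKernel hη
  have hkc := hasCompactSupport_contractKernel hηc hl
  have hconv := (hkc.hasFDerivAt_convolution_left (ContinuousLinearMap.lsmul ℝ ℝ (E := E)) hk hW
    (l • x)).comp x ((hasFDerivAt_id x).const_smul l)
  have hexists := (hkc.fderiv ℝ).convolutionExists_left
    (ContinuousLinearMap.precompL V (ContinuousLinearMap.lsmul ℝ ℝ (E := E)))
    (hk.continuous_fderiv one_ne_zero) hW (l • x)
  rw [contractMollify_eq_convolution hl]
  erw [hconv.fderiv]
  rw [ContinuousLinearMap.comp_apply, smul_apply, map_smul, ContinuousLinearMap.id_apply,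
    convolution_eq_swap, ContinuousLinearMap.integral_apply hexists.integrable_swap]
  rfl

end ContractedMollification

section MollifiedWeakGradients

variable {n : ℕ} {E : Type*} [NormedAddCommGroup E] [NormedSpace ℝ E] {U : Set (Pt n)}

lemma integral_smul_indicator (hU : MeasurableSet U) (f : Pt n → ℝ) (w : Pt n → E) :
    ∫ t, f t • U.indicator w t = ∫ t in U, f t • w t := by
  rw [← integral_indicator hU]
  simp only [indicator_smul_apply]

lemma fderiv_comp_const_sub (f : Pt n → E) (a t d : Pt n) :
    fderiv ℝ (fun t => f (a - t)) t d = -fderiv ℝ f (a - t) d := by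
  simp_rw [← neg_sub t a, ← neg_sub _ a]
  have hneg : fderiv ℝ (fun s => f (-s)) (t - a) = -fderiv ℝ f (-(t - a)) := by
    change fderiv ℝ (f ∘ ContinuousLinearEquiv.neg ℝ) (t - a) = _
    rw [ContinuousLinearEquiv.comp_right_fderiv]
    ext
    simp
  rw [fderiv_comp_sub (f := fun s => f (-s)) a, hneg, neg_apply]

theorem HasWeakGrad.fderiv_contractMollify (hUo : IsOpen U) (hU : Convex ℝ U) {v : Pt n → E}
    {G : Fin n → Pt n → E} (hv : HasWeakGrad U v G) {η : Pt n → ℝ} (hη : ContDiff ℝ ∞ η)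
    (hηc : HasCompactSupport η) (hηU : tsupport η ⊆ U) {l : ℝ} (hl0 : 0 ≤ l) (hl : l < 1)
    {x : Pt n} (hx : x ∈ U) (j : Fin n) :
    fderiv ℝ (contractMollify volume η l (U.indicator v)) x (stdVec j) =
      l • contractMollify volume η l (U.indicator (G j)) x := by
  have hW : LocallyIntegrable (U.indicator v) volume :=
    ((memLp_indicator_iff_restrict hUo.measurableSet).2 hv.memLp).locallyIntegrable one_le_two
  have hk : ContDiff ℝ ∞ fun t => contractKernel η l (l • x - t) :=
    (contDiff_contractKernel hη).comp (contDiff_const.sub contDiff_id)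
  have hkc : HasCompactSupport fun t => contractKernel η l (l • x - t) :=
    (hasCompactSupport_contractKernel hηc hl).comp_homeomorph (Homeomorph.subLeft (l • x))
  have hparts := hv.eq j _ hk hkc (tsupport_contractKernel_sub_subset hU hηc hηU hl0 hl hx)
  simp only [fderiv_comp_const_sub, neg_smul, integral_neg, neg_inj] at hparts
  rw [TanTrace.fderiv_contractMollify (hη.of_le (by simp)) hηc hl hW,
    contractMollify_eq_integral hl, integral_smul_indicator hUo.measurableSet,
    integral_smul_indicator hUo.measurableSet, hparts]

end MollifiedWeakGradients

section MollificationConvergence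

variable {V E : Type*} [NormedAddCommGroup V] [NormedSpace ℝ V] [NormedAddCommGroup E]

lemma eventually_forall_dist_convex_comb_le {g : V → E} (hg : UniformContinuous g) {U : Set V}
    (hU : Bornology.IsBounded U) {τ : ℝ} (hτ : 0 < τ) :
    ∀ᶠ l : ℝ in 𝓝 1, ∀ x ∈ U, ∀ y ∈ U, dist (g (l • x + (1 - l) • y)) (g x) ≤ τ := by
  obtain ⟨κ, hκ, hgκ⟩ := Metric.uniformContinuous_iff.1 hg τ hτ
  obtain ⟨D, hD⟩ := Metric.isBounded_iff.1 hU
  have hlim : Tendsto (fun l : ℝ => |1 - l| * D) (𝓝 1) (𝓝 0) := by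
    simpa using (by fun_prop : Continuous fun l : ℝ => |1 - l| * D).tendsto 1
  filter_upwards [hlim.eventually (gt_mem_nhds hκ)] with l hl x hx y hy
  refine (hgκ (lt_of_le_of_lt ?_ hl)).le
  rw [dist_eq_norm, show l • x + (1 - l) • y - x = (1 - l) • (y - x) by module, norm_smul,
    Real.norm_eq_abs, ← dist_eq_norm]
  exact mul_le_mul_of_nonneg_left (hD hy hx) (abs_nonneg _)

lemma enorm_integral_smul_sub_sq_le [NormedSpace ℝ E] [CompleteSpace E] {X : Type*}
    [MeasurableSpace X] {μ : Measure X} {η : X → ℝ} (hηm : Measurable η) (hη0 : 0 ≤ η)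
    (hη1 : ∫ y, η y ∂μ = 1) {f : X → E} (hf : StronglyMeasurable f)
    (hηf : Integrable (fun y => η y • f y) μ) (c : E) :
    ‖∫ y, η y • f y ∂μ - c‖ₑ ^ 2 ≤ ∫⁻ y, ENNReal.ofReal (η y) * ‖f y - c‖ₑ ^ 2 ∂μ := by
  have hηi : Integrable η μ := Integrable.of_integral_ne_zero (by simp [hη1])
  have hofm : Measurable fun y => ENNReal.ofReal (η y) := by fun_prop
  have hfm : Measurable fun y => ‖f y - c‖ₑ := (hf.sub stronglyMeasurable_const).enorm
  have hmass : μ.withDensity (fun y => ENNReal.ofReal (η y)) univ ≤ 1 := by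
    rw [withDensity_apply _ MeasurableSet.univ, setLIntegral_univ,
      ← ofReal_integral_eq_lintegral_ofReal hηi (ae_of_all _ hη0), hη1, ENNReal.ofReal_one]
  have hmean : ‖∫ y, η y • f y ∂μ - c‖ₑ ≤
      ∫⁻ y, ‖f y - c‖ₑ ∂μ.withDensity fun y => ENNReal.ofReal (η y) := by
    have hsub : ∫ y, η y • f y ∂μ - c = ∫ y, η y • (f y - c) ∂μ := by
      simp only [smul_sub]
      rw [integral_sub hηf (hηi.smul_const c), integral_smul_const, hη1, one_smul]
    rw [hsub, lintegral_withDensity_eq_lintegral_mul _ hofm hfm]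
    refine (enorm_integral_le_lintegral_enorm _).trans_eq (lintegral_congr fun y => ?_)
    rw [enorm_smul, Real.enorm_of_nonneg (hη0 y), Pi.mul_apply]
  refine ((pow_le_pow_left' hmean 2).trans (sq_lintegral_le hmass hfm.aemeasurable)).trans_eq ?_
  rw [lintegral_withDensity_eq_lintegral_mul _ hofm (hfm.pow_const 2)]
  rfl

variable [FiniteDimensional ℝ V] [MeasurableSpace V] [BorelSpace V] {μ : Measure V}
  [μ.IsAddHaarMeasure]

lemma eLpNorm_comp_convex_comb_le {W : V → E} (hW : StronglyMeasurable W) {l : ℝ}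
    (hl : 1 / 2 ≤ l) (y : V) :
    eLpNorm (fun x => W (l • x + (1 - l) • y)) 2 μ ≤
      2 ^ Module.finrank ℝ V * eLpNorm W 2 μ := by
  have hpos : 0 < l := by linarith
  rw [← ENNReal.pow_le_pow_left_iff two_ne_zero]
  calc eLpNorm (fun x => W (l • x + (1 - l) • y)) 2 μ ^ 2
      = ∫⁻ x, ‖W ((1 - l) • y + l • x)‖ₑ ^ 2 ∂μ := by simp only [eLpNorm_two_sq, add_comm]
    _ = ENNReal.ofReal (l ^ Module.finrank ℝ V)⁻¹ * eLpNorm W 2 μ ^ 2 := by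
        rw [eLpNorm_two_sq, lintegral_comp_add_smul hpos _ (hW.enorm.pow_const 2)]
    _ ≤ 2 ^ Module.finrank ℝ V * eLpNorm W 2 μ ^ 2 := by
        rw [← inv_pow, ENNReal.ofReal_pow (inv_nonneg.2 hpos.le), ← ENNReal.ofReal_ofNat 2]
        gcongr
        rw [inv_le_comm₀ hpos two_pos]
        linarith
    _ ≤ (2 ^ Module.finrank ℝ V * eLpNorm W 2 μ) ^ 2 := by
        rw [mul_pow]
        exact mul_le_mul_left
          (le_self_pow (one_le_pow₀ (by norm_num : (1 : ℝ≥0∞) ≤ 2)) two_ne_zero) _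

lemma eLpNorm_comp_convex_comb_sub_le {W g : V → E}
    (hW : StronglyMeasurable W) (hg : StronglyMeasurable g) {l : ℝ} (hl : 1 / 2 ≤ l) (y : V)
    (U : Set V) :
    eLpNorm (fun x => W (l • x + (1 - l) • y) - W x) 2 (μ.restrict U) ≤
      2 ^ Module.finrank ℝ V * eLpNorm (W - g) 2 μ +
          eLpNorm (fun x => g (l • x + (1 - l) • y) - g x) 2 (μ.restrict U) +
        eLpNorm (W - g) 2 μ := by
  have hcomb : Measurable fun x : V => l • x + (1 - l) • y := by fun_prop
  have hsplit : (fun x => W (l • x + (1 - l) • y) - W x) =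
      ((fun x => (W - g) (l • x + (1 - l) • y)) + fun x => g (l • x + (1 - l) • y) - g x) -
        (W - g) := by
    ext x
    simp only [Pi.add_apply, Pi.sub_apply]
    abel
  have hm₁ := ((hW.sub hg).comp_measurable hcomb).aestronglyMeasurable (μ := μ.restrict U)
  have hm₂ := ((hg.comp_measurable hcomb).sub hg).aestronglyMeasurable (μ := μ.restrict U)
  rw [hsplit]
  refine (eLpNorm_sub_le (hm₁.add hm₂) (hW.sub hg).aestronglyMeasurable one_le_two).trans
    (add_le_add ((eLpNorm_add_le hm₁ hm₂ one_le_two).trans (add_le_add ?_ le_rfl)) ?_)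
  · exact (eLpNorm_mono_measure _ Measure.restrict_le_self).trans
      (eLpNorm_comp_convex_comb_le (hW.sub hg) hl y)
  · exact eLpNorm_mono_measure _ Measure.restrict_le_self

theorem eventually_eLpNorm_convex_comb_sub_le [NormedSpace ℝ E] {W : V → E}
    (hWm : StronglyMeasurable W) (hW : MemLp W 2 μ) {U : Set V} (hUm : MeasurableSet U)
    (hU : Bornology.IsBounded U) {ε : ℝ≥0∞} (hε : 0 < ε) :
    ∀ᶠ l : ℝ in 𝓝 1, ∀ y ∈ U,
      eLpNorm (fun x => W (l • x + (1 - l) • y) - W x) 2 (μ.restrict U) ≤ ε := by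
  have hε3 : ε / 3 ≠ 0 := (ENNReal.div_pos hε.ne' (by simp)).ne'
  set c : ℝ≥0∞ := 2 ^ Module.finrank ℝ V with hc
  have hc0 : c ≠ 0 := by simp [hc]
  have hctop : c ≠ ⊤ := by simp [hc]
  obtain ⟨g, hgc, hWg, hg, -⟩ := hW.exists_hasCompactSupport_eLpNorm_sub_le (by simp)
    (ENNReal.div_pos hε3 hctop).ne'
  obtain ⟨τ, hτ, hτε⟩ := ENNReal.exists_nnreal_pos_mul_lt
    (a := μ U ^ ((2 : ℝ≥0∞).toReal⁻¹)) (by simp [hU.measure_lt_top.ne]) hε3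
  filter_upwards [lt_mem_nhds (by norm_num : (1 / 2 : ℝ) < 1),
    eventually_forall_dist_convex_comb_le (hgc.uniformContinuous_of_continuous hg) hU
      (NNReal.coe_pos.2 hτ)] with l hl hgl y hy
  have hunif : eLpNorm (fun x => g (l • x + (1 - l) • y) - g x) 2 (μ.restrict U) ≤ ε / 3 := by
    refine (eLpNorm_le_of_ae_bound (C := τ) ?_).trans ?_
    · filter_upwards [ae_restrict_mem hUm] with x hx
      exact (dist_eq_norm _ _).symm.trans_le (hgl x hx y hy)
    · rw [Measure.restrict_apply_univ, ENNReal.ofReal_coe_nnreal, mul_comm]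
      exact hτε.le
  have happrox : eLpNorm (W - g) 2 μ ≤ ε / 3 := hWg.trans <|
    ENNReal.div_le_of_le_mul (le_mul_of_one_le_right zero_le (one_le_pow₀ one_le_two))
  calc eLpNorm (fun x => W (l • x + (1 - l) • y) - W x) 2 (μ.restrict U)
      ≤ c * eLpNorm (W - g) 2 μ + eLpNorm (fun x => g (l • x + (1 - l) • y) - g x) 2
          (μ.restrict U) + eLpNorm (W - g) 2 μ :=
        eLpNorm_comp_convex_comb_sub_le hWm hg.stronglyMeasurable hl.le y U
    _ ≤ c * (ε / 3 / c) + ε / 3 + ε / 3 := by gcongr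
    _ = ε := by rw [ENNReal.mul_div_cancel hc0 hctop, ENNReal.add_thirds]

variable [NormedSpace ℝ E] {η : V → ℝ}

lemma integrable_smul_comp_convex_comb (hη : Continuous η) (hηc : HasCompactSupport η)
    {W : V → E} (hW : LocallyIntegrable W μ) {l : ℝ} (hl : l < 1) (x : V) :
    Integrable (fun y => η y • W (l • x + (1 - l) • y)) μ := by
  have hne : 1 - l ≠ 0 := (sub_pos.2 hl).ne'
  have hsupp : HasCompactSupport fun t => η ((1 - l)⁻¹ • (t - l • x)) :=
    hηc.comp_homeomorph
      ((Homeomorph.subRight (l • x)).trans (Homeomorph.smulOfNeZero _ (inv_ne_zero hne)))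
  have hint := ((hW.integrable_smul_left_of_hasCompactSupport (by fun_prop)
    hsupp).comp_add_left (l • x)).comp_smul hne
  simpa [inv_smul_smul₀ hne] using hint

lemma eLpNorm_contractMollify_sub_le [CompleteSpace E] (hη : Continuous η)
    (hηc : HasCompactSupport η) (hη0 : 0 ≤ η) (hη1 : ∫ y, η y ∂μ = 1) {W : V → E}
    (hWm : StronglyMeasurable W) (hW : LocallyIntegrable W μ) {l : ℝ} (hl : l < 1)
    {ν : Measure V} [SFinite ν] {M : ℝ≥0∞}
    (hM : ∀ y ∈ tsupport η, eLpNorm (fun x => W (l • x + (1 - l) • y) - W x) 2 ν ≤ M) :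
    eLpNorm (contractMollify μ η l W - W) 2 ν ≤ M := by
  have hcomb : StronglyMeasurable fun p : V × V => W (l • p.1 + (1 - l) • p.2) :=
    hWm.comp_measurable (by fun_prop)
  have hmeas : Measurable fun p : V × V =>
      ENNReal.ofReal (η p.2) * ‖W (l • p.1 + (1 - l) • p.2) - W p.1‖ₑ ^ 2 :=
    (by fun_prop : Measurable fun p : V × V => ENNReal.ofReal (η p.2)).mul
      ((hcomb.sub (hWm.comp_measurable measurable_fst)).enorm.pow_const 2)
  have hweight (y : V) : ENNReal.ofReal (η y) *
      eLpNorm (fun x => W (l • x + (1 - l) • y) - W x) 2 ν ^ 2 ≤ ENNReal.ofReal (η y) * M ^ 2 := by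
    by_cases hy : y ∈ tsupport η
    · gcongr
      exact hM y hy
    · simp [image_eq_zero_of_notMem_tsupport hy]
  rw [← ENNReal.pow_le_pow_left_iff two_ne_zero, eLpNorm_two_sq]
  calc ∫⁻ x, ‖(contractMollify μ η l W - W) x‖ₑ ^ 2 ∂ν
      ≤ ∫⁻ x, (∫⁻ y, ENNReal.ofReal (η y) * ‖W (l • x + (1 - l) • y) - W x‖ₑ ^ 2 ∂μ) ∂ν :=
        lintegral_mono fun x => enorm_integral_smul_sub_sq_le hη.measurable hη0 hη1
          (hWm.comp_measurable (by fun_prop)) (integrable_smul_comp_convex_comb hη hηc hW hl x) _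
    _ = ∫⁻ y, ENNReal.ofReal (η y) *
          eLpNorm (fun x => W (l • x + (1 - l) • y) - W x) 2 ν ^ 2 ∂μ := by
        rw [lintegral_lintegral_swap hmeas.aemeasurable]
        refine lintegral_congr fun y => ?_
        rw [eLpNorm_two_sq, lintegral_const_mul' _ _ ENNReal.ofReal_ne_top]
    _ ≤ ∫⁻ y, ENNReal.ofReal (η y) * M ^ 2 ∂μ := lintegral_mono hweight
    _ = M ^ 2 := by
        rw [lintegral_mul_const _ (by fun_prop), ← ofReal_integral_eq_lintegral_ofReal
          (Integrable.of_integral_ne_zero (by simp [hη1])) (ae_of_all _ hη0), hη1,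
          ENNReal.ofReal_one, one_mul]

lemma contractMollify_congr_ae {W W' : V → E} (h : W =ᵐ[μ] W') {l : ℝ} (hl : l < 1) :
    contractMollify μ η l W = contractMollify μ η l W' := by
  ext x
  rw [contractMollify_eq_integral hl, contractMollify_eq_integral hl]
  refine integral_congr_ae ?_
  filter_upwards [h] with t ht
  rw [ht]

theorem tendsto_eLpNorm_contractMollify_sub [CompleteSpace E] (hη : Continuous η)
    (hηc : HasCompactSupport η) (hη0 : 0 ≤ η) (hη1 : ∫ y, η y ∂μ = 1) {W : V → E} {U : Set V}
    (hUm : MeasurableSet U) (hU : Bornology.IsBounded U) (hW : MemLp W 2 (μ.restrict U))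
    (hηU : tsupport η ⊆ U) :
    Tendsto (fun l => eLpNorm (contractMollify μ η l (U.indicator W) - W) 2 (μ.restrict U))
      (𝓝[<] 1) (𝓝 0) := by
  have hind : MemLp (U.indicator W) 2 μ := (memLp_indicator_iff_restrict hUm).2 hW
  obtain ⟨W', hWm', hWW'⟩ := hind.1
  have hW' : MemLp W' 2 μ := hind.ae_eq hWW'
  have hres : W =ᵐ[μ.restrict U] W' :=
    (indicator_ae_eq_restrict hUm).symm.trans (ae_restrict_of_ae hWW')
  refine ENNReal.tendsto_nhds_zero.2 fun ε hε => ?_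
  filter_upwards [eventually_nhdsWithin_of_eventually_nhds
    (eventually_eLpNorm_convex_comb_sub_le hWm' hW' hUm hU hε), self_mem_nhdsWithin] with l hl hl1
  rw [contractMollify_congr_ae hWW' hl1, eLpNorm_congr_ae (hres.mono fun x hx => by
    rw [Pi.sub_apply, hx, ← Pi.sub_apply])]
  exact eLpNorm_contractMollify_sub_le hη hηc hη0 hη1 hWm' (hW'.locallyIntegrable one_le_two)
    hl1 fun y hy => hl y (hηU hy)

end MollificationConvergence

section SmoothDensity

lemma exists_bump_tsupport_subset {V : Type*} [NormedAddCommGroup V] [NormedSpace ℝ V]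
    [FiniteDimensional ℝ V] [MeasurableSpace V] [BorelSpace V] (μ : Measure V)
    [μ.IsAddHaarMeasure] {U : Set V} (hU : IsOpen U) (hne : U.Nonempty) :
    ∃ η : V → ℝ, ContDiff ℝ ∞ η ∧ HasCompactSupport η ∧ tsupport η ⊆ U ∧ 0 ≤ η ∧
      ∫ y, η y ∂μ = 1 := by
  obtain ⟨c, hc⟩ := hne
  obtain ⟨ρ, hρ, hball⟩ := Metric.isOpen_iff.1 hU c hc
  let f : ContDiffBump c := ⟨ρ / 4, ρ / 2, by linarith, by linarith⟩
  refine ⟨f.normed μ, f.contDiff_normed, f.hasCompactSupport_normed, ?_, f.nonneg_normed,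
    f.integral_normed⟩
  rw [f.tsupport_normed_eq]
  exact (Metric.closedBall_subset_ball (by change ρ / 2 < ρ; linarith)).trans hball

variable {n : ℕ} {E : Type*} [NormedAddCommGroup E] [NormedSpace ℝ E] [CompleteSpace E]
  {U : Set (Pt n)} {v : Pt n → E} {G : Fin n → Pt n → E} {η : Pt n → ℝ}

theorem HasWeakGrad.tendsto_eLpNorm_fderiv_contractMollify_sub (hUo : IsOpen U)
    (hU : Convex ℝ U) (hb : Bornology.IsBounded U) (hv : HasWeakGrad U v G)
    (hη : ContDiff ℝ ∞ η) (hηc : HasCompactSupport η) (hηU : tsupport η ⊆ U) (hη0 : 0 ≤ η)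
    (hη1 : ∫ y, η y = 1) (j : Fin n) :
    Tendsto (fun l => eLpNorm ((fun x =>
        fderiv ℝ (contractMollify volume η l (U.indicator v)) x (stdVec j)) - G j) 2
      (volume.restrict U)) (𝓝[<] 1) (𝓝 0) := by
  have hG : MemLp (G j) 2 (volume.restrict U) := hv.memLp_grad j
  have hGloc : LocallyIntegrable (U.indicator (G j)) volume :=
    ((memLp_indicator_iff_restrict hUo.measurableSet).2 hG).locallyIntegrable one_le_two
  have hmoll := tendsto_eLpNorm_contractMollify_sub hη.continuous hηc hη0 hη1
    hUo.measurableSet hb hG hηU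
  have hscal : Tendsto (fun l : ℝ => ENNReal.ofReal (1 - l) *
      eLpNorm (G j) 2 (volume.restrict U)) (𝓝[<] 1) (𝓝 0) := by
    have hcont : Tendsto (fun l : ℝ => ENNReal.ofReal (1 - l)) (𝓝 1) (𝓝 0) := by
      simpa [Function.comp_def] using
        (ENNReal.continuous_ofReal.comp (continuous_sub_left (1 : ℝ))).tendsto 1
    simpa using ENNReal.Tendsto.mul_const (hcont.mono_left nhdsWithin_le_nhds)
      (Or.inr hG.eLpNorm_ne_top)
  have hbound : Tendsto (fun l : ℝ => eLpNorm (contractMollify volume η l (U.indicator (G j)) -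
      G j) 2 (volume.restrict U) + ENNReal.ofReal (1 - l) * eLpNorm (G j) 2 (volume.restrict U))
      (𝓝[<] 1) (𝓝 0) := by
    simpa using hmoll.add hscal
  refine tendsto_of_tendsto_of_tendsto_of_le_of_le' tendsto_const_nhds hbound
    (Eventually.of_forall fun _ => zero_le) ?_
  filter_upwards [Ioo_mem_nhdsLT (zero_lt_one : (0 : ℝ) < 1)] with l hl
  have hsplit : (fun x => fderiv ℝ (contractMollify volume η l (U.indicator v)) x (stdVec j)) -
      G j =ᵐ[volume.restrict U]
        l • (contractMollify volume η l (U.indicator (G j)) - G j) - (1 - l) • G j := by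
    filter_upwards [ae_restrict_mem hUo.measurableSet] with x hx
    simp only [Pi.sub_apply, Pi.smul_apply,
      hv.fderiv_contractMollify hUo hU hη hηc hηU hl.1.le hl.2 hx j]
    module
  have hmeas : AEStronglyMeasurable (contractMollify volume η l (U.indicator (G j)) - G j)
      (volume.restrict U) :=
    (contDiff_contractMollify hη hηc hl.2 hGloc).continuous.aestronglyMeasurable.sub hG.1
  rw [eLpNorm_congr_ae hsplit]
  refine (eLpNorm_sub_le (hmeas.const_smul _) (hG.1.const_smul _) one_le_two).trans ?_
  rw [eLpNorm_const_smul, eLpNorm_const_smul, Real.enorm_of_nonneg hl.1.le,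
    Real.enorm_of_nonneg (sub_nonneg.2 hl.2.le)]
  gcongr
  exact mul_le_of_le_one_left zero_le (ENNReal.ofReal_le_one.2 hl.2.le)

theorem HasWeakGrad.exists_smooth_approx (hUo : IsOpen U) (hU : Convex ℝ U)
    (hb : Bornology.IsBounded U) (hne : U.Nonempty) (hv : HasWeakGrad U v G) :
    ∃ φ : ℕ → Pt n → E, (∀ i, ContDiff ℝ ∞ (φ i)) ∧
      Tendsto (fun i => eLpNorm (φ i - v) 2 (volume.restrict U)) atTop (𝓝 0) ∧
      ∀ j, Tendsto (fun i => eLpNorm ((fun x => fderiv ℝ (φ i) x (stdVec j)) - G j) 2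
        (volume.restrict U)) atTop (𝓝 0) := by
  obtain ⟨η, hη, hηc, hηU, hη0, hη1⟩ := exists_bump_tsupport_subset volume hUo hne
  obtain ⟨l, -, hl, hlim⟩ := exists_seq_strictMono_tendsto (1 : ℝ)
  have hlim' : Tendsto l atTop (𝓝[<] 1) :=
    tendsto_nhdsWithin_iff.2 ⟨hlim, Eventually.of_forall hl⟩
  have hloc : LocallyIntegrable (U.indicator v) volume :=
    ((memLp_indicator_iff_restrict hUo.measurableSet).2 hv.memLp).locallyIntegrable one_le_two
  exact ⟨fun i => contractMollify volume η (l i) (U.indicator v),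
    fun i => contDiff_contractMollify hη hηc (hl i) hloc,
    (tendsto_eLpNorm_contractMollify_sub hη.continuous hηc hη0 hη1 hUo.measurableSet hb hv.memLp
      hηU).comp hlim',
    fun j => (hv.tendsto_eLpNorm_fderiv_contractMollify_sub hUo hU hb hη hηc hηU hη0 hη1 j).comp
      hlim'⟩

end SmoothDensity

section DirectionalDerivatives

variable {V F : Type*} [NormedAddCommGroup V] [NormedSpace ℝ V] [NormedAddCommGroup F]
  [NormedSpace ℝ F] {f : V → F}

/-- The iterated directional derivative along the directions of a list; the derivative along the
head of the list is taken last. -/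
noncomputable def dirDerivs (l : List V) (f : V → F) : V → F :=
  l.foldr (fun d g y => fderiv ℝ g y d) f

lemma contDiff_fderiv_apply (hf : ContDiff ℝ ∞ f) (d : V) :
    ContDiff ℝ ∞ fun y => fderiv ℝ f y d :=
  (hf.fderiv_right (m := ∞) (by simp)).clm_apply contDiff_const

lemma contDiff_dirDerivs (hf : ContDiff ℝ ∞ f) (l : List V) : ContDiff ℝ ∞ (dirDerivs l f) := by
  induction l with
  | nil => exact hf
  | cons d l ih => exact contDiff_fderiv_apply ih d

lemma fderiv_fderiv_apply_comm (hf : ContDiff ℝ ∞ f) (a b : V) :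
    (fun y => fderiv ℝ (fun y => fderiv ℝ f y b) y a) =
      fun y => fderiv ℝ (fun y => fderiv ℝ f y a) y b := by
  ext y
  have hdiff : DifferentiableAt ℝ (fderiv ℝ f) y :=
    (hf.fderiv_right (m := ∞) (by simp)).differentiable (by simp) y
  have hsnd (c d : V) :
      fderiv ℝ (fun y => fderiv ℝ f y c) y d = fderiv ℝ (fderiv ℝ f) y d c := by
    simp [fderiv_clm_apply hdiff (differentiableAt_const c)]
  have hsymm : IsSymmSndFDerivAt ℝ f y := hf.contDiffAt.isSymmSndFDerivAt <| by
    rw [minSmoothness_of_isRCLikeNormedField]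
    exact WithTop.coe_le_coe.2 (le_top : (2 : ℕ∞) ≤ ⊤)
  rw [hsnd, hsnd]
  exact hsymm a b

lemma dirDerivs_perm (hf : ContDiff ℝ ∞ f) {l l' : List V} (h : l.Perm l') :
    dirDerivs l f = dirDerivs l' f := by
  induction h with
  | nil => rfl
  | cons d _ ih => exact congrArg (fun g y => fderiv ℝ g y d) ih
  | swap a b l => exact fderiv_fderiv_apply_comm (contDiff_dirDerivs hf l) b a
  | trans _ _ ih₁ ih₂ => exact ih₁.trans ih₂

lemma iteratedFDeriv_eq_dirDerivs (hf : ContDiff ℝ ∞ f) {i : ℕ} (v : Fin i → V) :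
    (fun x => iteratedFDeriv ℝ i f x v) = dirDerivs (List.ofFn v) f := by
  induction i with
  | zero =>
    ext x
    simp [dirDerivs]
  | succ i ih =>
    rw [List.ofFn_succ]
    change _ = fun y => fderiv ℝ (dirDerivs (List.ofFn fun j => v j.succ) f) y (v 0)
    rw [← ih fun j => v j.succ]
    ext x
    have hdiff : DifferentiableAt ℝ (iteratedFDeriv ℝ i f) x :=
      (hf.iteratedFDeriv_right (m := ∞) (i := i) (by
        rw [← WithTop.coe_natCast, ← WithTop.coe_add]; simp)).differentiable (by simp) x
    rw [iteratedFDeriv_succ_apply_left, fderiv_continuousMultilinear_apply_const_apply hdiff]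
    rfl

end DirectionalDerivatives

section PartialDerivatives

variable {n : ℕ} {F : Type*} [NormedAddCommGroup F] [NormedSpace ℝ F] {f : Pt n → F} {i : ℕ}

/-- The partial derivative `∂_{α₁} ⋯ ∂_{αᵢ} f`. -/
noncomputable def partialDeriv (α : Fin i → Fin n) (f : Pt n → F) (x : Pt n) : F :=
  iteratedFDeriv ℝ i f x fun a => stdVec (α a)

lemma partialDeriv_eq_dirDerivs (hf : ContDiff ℝ ∞ f) (α : Fin i → Fin n) :
    partialDeriv α f = dirDerivs (List.ofFn fun a => stdVec (α a)) f :=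
  iteratedFDeriv_eq_dirDerivs hf _

lemma contDiff_partialDeriv (hf : ContDiff ℝ ∞ f) (α : Fin i → Fin n) :
    ContDiff ℝ ∞ (partialDeriv α f) := by
  rw [partialDeriv_eq_dirDerivs hf]
  exact contDiff_dirDerivs hf _

lemma partialDeriv_comp_perm (hf : ContDiff ℝ ∞ f) (α : Fin i → Fin n)
    (σ : Equiv.Perm (Fin i)) : partialDeriv (α ∘ σ) f = partialDeriv α f := by
  rw [partialDeriv_eq_dirDerivs hf, partialDeriv_eq_dirDerivs hf]
  exact dirDerivs_perm hf (Equiv.Perm.ofFn_comp_perm σ fun a => stdVec (α a))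

lemma partialDeriv_cons (hf : ContDiff ℝ ∞ f) (j : Fin n) (α : Fin i → Fin n) :
    partialDeriv (Fin.cons j α : Fin (i + 1) → Fin n) f =
      fun x => fderiv ℝ (partialDeriv α f) x (stdVec j) := by
  rw [partialDeriv_eq_dirDerivs hf, partialDeriv_eq_dirDerivs hf, List.ofFn_succ]
  rfl

lemma partialDeriv_cons_eq_partialDeriv_fderiv (hf : ContDiff ℝ ∞ f) (j : Fin n)
    (α : Fin i → Fin n) :
    partialDeriv (Fin.cons j α : Fin (i + 1) → Fin n) f =
      partialDeriv α fun x => fderiv ℝ f x (stdVec j) := by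
  have happend : dirDerivs (List.ofFn fun a => stdVec (α a)) (fun x => fderiv ℝ f x (stdVec j)) =
      dirDerivs ((List.ofFn fun a => stdVec (α a)) ++ [stdVec j]) f := by
    simp [dirDerivs, List.foldr_append]
  rw [partialDeriv_eq_dirDerivs hf, partialDeriv_eq_dirDerivs (contDiff_fderiv_apply hf _),
    List.ofFn_succ, happend]
  exact dirDerivs_perm hf (List.perm_append_singleton _ _).symm

lemma partialDeriv_of_isEmpty (α : Fin 0 → Fin n) (f : Pt n → F) : partialDeriv α f = f := by
  ext x
  simp [partialDeriv]

lemma partialDeriv_add {g : Pt n → F} (hf : ContDiff ℝ ∞ f) (hg : ContDiff ℝ ∞ g)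
    (α : Fin i → Fin n) : partialDeriv α (f + g) = partialDeriv α f + partialDeriv α g := by
  ext x
  rw [partialDeriv, iteratedFDeriv_add_apply (contDiff_infty.1 hf i).contDiffAt
    (contDiff_infty.1 hg i).contDiffAt]
  rfl

lemma partialDeriv_zero (α : Fin i → Fin n) : partialDeriv α (0 : Pt n → F) = 0 := by
  ext x
  simp [partialDeriv]

end PartialDerivatives

section PolynomialsWithPrescribedMeans

lemma integrableOn_of_continuous_of_isBounded {n : ℕ} {F : Type*} [NormedAddCommGroup F]
    {U : Set (Pt n)} (hb : Bornology.IsBounded U) {f : Pt n → F} (hf : Continuous f) :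
    IntegrableOn f U :=
  memLp_one_iff_integrable.1 (memLp_of_continuous_of_isBounded hb hf 1)

variable {n : ℕ} {E : Type*} [NormedAddCommGroup E] [NormedSpace ℝ E]

/-- The continuous multilinear map `(v₁, …, vᵢ) ↦ (1/i!) ∑_α (v₁)_{α₁} ⋯ (vᵢ)_{αᵢ} c_α`. On the
diagonal it is the homogeneous polynomial of degree `i` with the symmetric coefficients `c`,
normalized so that its derivatives of order `i` are the `c_α`. -/
noncomputable def taylorForm {i : ℕ} (c : (Fin i → Fin n) → E) :
    ContinuousMultilinearMap ℝ (fun _ : Fin i => Pt n) E :=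
  (i.factorial : ℝ)⁻¹ • ∑ α : Fin i → Fin n,
    ((ContinuousMultilinearMap.mkPiAlgebra ℝ (Fin i) ℝ).compContinuousLinearMap
      fun a => EuclideanSpace.proj (𝕜 := ℝ) (α a)).smulRight (c α)

variable {i : ℕ} {c : (Fin i → Fin n) → E}

lemma taylorForm_apply (c : (Fin i → Fin n) → E) (v : Fin i → Pt n) :
    taylorForm c v = (i.factorial : ℝ)⁻¹ • ∑ α : Fin i → Fin n, (∏ a, v a (α a)) • c α := by
  simp [taylorForm]

lemma taylorForm_stdVec (c : (Fin i → Fin n) → E) (β : Fin i → Fin n) :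
    taylorForm c (fun a => stdVec (β a)) = (i.factorial : ℝ)⁻¹ • c β := by
  rw [taylorForm_apply, Finset.sum_eq_single β]
  · simp
  · intro α _ hα
    obtain ⟨a, ha⟩ := Function.ne_iff.1 hα
    rw [Finset.prod_eq_zero (Finset.mem_univ a) (by simp [ha]), zero_smul]
  · simp

lemma taylorForm_diag_mem_polySpan (c : (Fin i → Fin n) → E) :
    (fun x => taylorForm c fun _ => x) ∈ polySpan n i E := by
  have hsum : (fun x : Pt n => taylorForm c fun _ => x) =
      (i.factorial : ℝ)⁻¹ • ∑ α : Fin i → Fin n, fun x : Pt n =>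
        MvPolynomial.eval (fun b => x b) (∏ a, MvPolynomial.X (α a)) • c α := by
    ext x
    simp [taylorForm_apply]
  rw [hsum]
  refine Submodule.smul_mem _ _ (Submodule.sum_mem _ fun α _ => eval_smul_mem_polySpan ?_ _)
  exact (MvPolynomial.totalDegree_finsetProd _ _).trans (by simp)

lemma partialDeriv_taylorForm_diag (hc : ∀ α (σ : Equiv.Perm (Fin i)), c (α ∘ σ) = c α)
    (α : Fin i → Fin n) : partialDeriv α (fun x => taylorForm c fun _ => x) = fun _ => c α := by
  ext x
  have hperm (σ : Equiv.Perm (Fin i)) :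
      taylorForm c (fun a => stdVec (α (σ a))) = (i.factorial : ℝ)⁻¹ • c α := by
    rw [← hc α σ]
    exact taylorForm_stdVec c (α ∘ σ)
  rw [partialDeriv, ContinuousMultilinearMap.iteratedFDeriv_comp_diagonal,
    Finset.sum_congr rfl fun σ _ => hperm σ, Finset.sum_const, Finset.card_univ,
    Fintype.card_perm, Fintype.card_fin, ← Nat.cast_smul_eq_nsmul ℝ, smul_smul,
    mul_inv_cancel₀ (by exact_mod_cast i.factorial_ne_zero), one_smul]

lemma partialDeriv_eq_zero_of_forall_eq_const {p : Pt n → E} (hp : ContDiff ℝ ∞ p)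
    (hpc : ∀ α : Fin i → Fin n, ∃ b, partialDeriv α p = fun _ => b) {k : ℕ} (hk : i < k)
    (α : Fin k → Fin n) : partialDeriv α p = 0 := by
  induction k, hk using Nat.le_induction with
  | base =>
    obtain ⟨b, hb⟩ := hpc (Fin.tail α)
    rw [← Fin.cons_self_tail α, partialDeriv_cons hp, hb]
    ext x
    simp
  | succ k _ ih =>
    rw [← Fin.cons_self_tail α, partialDeriv_cons hp, ih]
    ext x
    simp

theorem exists_polySpan_setIntegral_partialDeriv_eq [CompleteSpace E] {U : Set (Pt n)}
    (hU : volume U ≠ 0) (hb : Bornology.IsBounded U) (M : ℕ) (c : (i : ℕ) → (Fin i → Fin n) → E)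
    (hc : ∀ i < M, ∀ α (σ : Equiv.Perm (Fin i)), c i (α ∘ σ) = c i α) :
    ∃ q ∈ polySpan n M E, (∀ i < M, ∀ α, ∫ x in U, partialDeriv α q x = c i α) ∧
      ∀ i, M ≤ i → ∀ α : Fin i → Fin n, partialDeriv α q = 0 := by
  induction M generalizing c with
  | zero => exact ⟨0, Submodule.zero_mem _, by simp, fun i _ α => partialDeriv_zero α⟩
  | succ M ih =>
    have hvol : volume.real U ≠ 0 := (ENNReal.toReal_pos hU hb.measure_lt_top.ne).ne'
    set p : Pt n → E := fun x => taylorForm (fun α => (volume.real U)⁻¹ • c M α) fun _ => x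
    have hp : p ∈ polySpan n M E := taylorForm_diag_mem_polySpan _
    have hps : ContDiff ℝ ∞ p := contDiff_of_mem_polySpan hp
    have hptop (α : Fin M → Fin n) : partialDeriv α p = fun _ => (volume.real U)⁻¹ • c M α :=
      partialDeriv_taylorForm_diag (fun α σ => by rw [hc M M.lt_succ_self]) α
    obtain ⟨q, hq, hqint, hqhigh⟩ := ih (fun i α => c i α - ∫ x in U, partialDeriv α p x)
      fun i hi α σ => by rw [hc i (hi.trans M.lt_succ_self), partialDeriv_comp_perm hps]
    have hqs : ContDiff ℝ ∞ q := contDiff_of_mem_polySpan hq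
    refine ⟨p + q, polySpan_mono M.le_succ (Submodule.add_mem _ hp hq), fun i hi α => ?_,
      fun i hi α => ?_⟩
    · rw [partialDeriv_add hps hqs]
      simp only [Pi.add_apply]
      rw [integral_add
        (integrableOn_of_continuous_of_isBounded hb (contDiff_partialDeriv hps α).continuous)
        (integrableOn_of_continuous_of_isBounded hb (contDiff_partialDeriv hqs α).continuous)]
      rcases Nat.lt_succ_iff_lt_or_eq.1 hi with hlt | rfl
      · rw [hqint i hlt, add_sub_cancel]
      · simp [hptop, hqhigh i le_rfl, smul_smul, mul_inv_cancel₀ hvol]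
    · rw [partialDeriv_add hps hqs, hqhigh i (Nat.le_of_succ_le hi),
        partialDeriv_eq_zero_of_forall_eq_const hps (fun α => ⟨_, hptop α⟩) hi, add_zero]

end PolynomialsWithPrescribedMeans

section Averages

variable {X E : Type*} [MeasurableSpace X] [NormedAddCommGroup E] [NormedSpace ℝ E]
  [CompleteSpace E] {μ : Measure X} [IsFiniteMeasure μ] [NeZero μ] {f : X → E}

lemma enorm_sub_average_sq_le (hf : Integrable f μ) (c : E) :
    ‖c - ⨍ y, f y ∂μ‖ₑ ^ 2 ≤ ⨍⁻ y, ‖c - f y‖ₑ ^ 2 ∂μ := by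
  have havg : c - ⨍ y, f y ∂μ = ⨍ y, (c - f y) ∂μ := by
    rw [average_eq, average_eq, integral_sub (integrable_const c) hf, smul_sub, integral_const,
      inv_smul_smul₀ (measureReal_ne_zero_iff (measure_ne_top μ univ) |>.2
        (by simpa using NeZero.ne μ))]
  have hnorm : ‖c - ⨍ y, f y ∂μ‖ₑ ≤ ⨍⁻ y, ‖c - f y‖ₑ ∂μ := by
    rw [havg]
    exact enorm_integral_le_lintegral_enorm _
  have hmeas : AEMeasurable (fun y => ‖c - f y‖ₑ) ((μ univ)⁻¹ • μ) :=
    ((aestronglyMeasurable_const.sub hf.1).enorm).mono_ac Measure.smul_absolutelyContinuous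
  exact (pow_le_pow_left' hnorm 2).trans (sq_lintegral_le measure_univ.le hmeas)

lemma measure_univ_mul_enorm_sub_average_sq_le (hf : Integrable f μ) (c : E) :
    μ univ * ‖c - ⨍ y, f y ∂μ‖ₑ ^ 2 ≤ ∫⁻ y, ‖c - f y‖ₑ ^ 2 ∂μ := by
  refine (mul_le_mul_right (enorm_sub_average_sq_le hf c) _).trans_eq ?_
  rw [laverage_eq, ENNReal.mul_div_cancel (NeZero.ne _) (measure_ne_top μ univ)]

lemma measure_univ_mul_eLpNorm_sub_average_sq_le (hf : Integrable f μ) :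
    μ univ * eLpNorm (fun x => f x - ⨍ y, f y ∂μ) 2 μ ^ 2 ≤
      ∫⁻ x, ∫⁻ y, ‖f x - f y‖ₑ ^ 2 ∂μ ∂μ := by
  rw [eLpNorm_two_sq, ← lintegral_const_mul' _ _ (measure_ne_top μ univ)]
  exact lintegral_mono fun x => measure_univ_mul_enorm_sub_average_sq_le hf (f x)

lemma eLpNorm_average_le (hf : Integrable f μ) :
    eLpNorm (fun _ => ⨍ y, f y ∂μ) 2 μ ≤ eLpNorm f 2 μ := by
  rw [← ENNReal.pow_le_pow_left_iff two_ne_zero, eLpNorm_two_sq, eLpNorm_two_sq, lintegral_const,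
    mul_comm]
  simpa using measure_univ_mul_enorm_sub_average_sq_le hf 0

lemma eLpNorm_sub_average_le_two_mul (hf : Integrable f μ) :
    eLpNorm (fun x => f x - ⨍ y, f y ∂μ) 2 μ ≤ 2 * eLpNorm f 2 μ := by
  rw [two_mul]
  exact (eLpNorm_sub_le hf.1 aestronglyMeasurable_const one_le_two).trans
    (add_le_add_right (eLpNorm_average_le hf) _)

end Averages

section Poincare

lemma eLpNorm_sub_average_le_eLpNorm_fderiv {V E : Type*} [NormedAddCommGroup V]
    [NormedSpace ℝ V] [FiniteDimensional ℝ V] [MeasurableSpace V] [BorelSpace V]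
    {μ : Measure V} [μ.IsAddHaarMeasure] [NormedAddCommGroup E] [NormedSpace ℝ E]
    [CompleteSpace E] {U : Set V} (hUo : IsOpen U) (hU : Convex ℝ U)
    (hb : Bornology.IsBounded U) (hne : U.Nonempty) {w : V → E} (hw : ContDiff ℝ 1 w) :
    eLpNorm (fun x => w x - ⨍ y in U, w y ∂μ) 2 (μ.restrict U) ≤
      2 ^ Module.finrank ℝ V * Metric.ediam U * eLpNorm (fderiv ℝ w) 2 (μ.restrict U) := by
  have hμ0 : μ U ≠ 0 := (hUo.measure_pos μ hne).ne'
  have hμtop : μ U ≠ ⊤ := hb.measure_lt_top.ne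
  have hfin : IsFiniteMeasure (μ.restrict U) := ⟨by simpa using hb.measure_lt_top⟩
  have hzero : NeZero (μ.restrict U) := ⟨by simpa using hμ0⟩
  have hint : Integrable w (μ.restrict U) :=
    memLp_one_iff_integrable.1 (memLp_of_continuous_of_isBounded hb hw.continuous 1)
  have havg := (measure_univ_mul_eLpNorm_sub_average_sq_le hint).trans
    (lintegral_lintegral_enorm_sub_sq_le hU hUo.measurableSet hb hw)
  rw [Measure.restrict_apply_univ, mul_comm (2 ^ _), mul_assoc, ← eLpNorm_two_sq,
    ENNReal.mul_le_mul_iff_right hμ0 hμtop] at havg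
  rw [← ENNReal.pow_le_pow_left_iff two_ne_zero, mul_assoc, mul_pow, mul_pow]
  exact havg.trans
    (mul_le_mul_left (le_self_pow (one_le_pow₀ (by norm_num : (1 : ℝ≥0∞) ≤ 2)) two_ne_zero) _)

variable {n : ℕ} {E : Type*} [NormedAddCommGroup E] [NormedSpace ℝ E] [CompleteSpace E]
  {U : Set (Pt n)} {v w : Pt n → E} {G : Fin n → Pt n → E}

lemma HasWeakGrad.eLpNorm_sub_average_le_of_contDiff (hUo : IsOpen U) (hU : Convex ℝ U)
    (hb : Bornology.IsBounded U) (hne : U.Nonempty) (hv : HasWeakGrad U v G)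
    (hw : ContDiff ℝ 1 w) :
    eLpNorm (fun x => v x - ⨍ y in U, v y) 2 (volume.restrict U) ≤
      2 ^ n * Metric.ediam U * ∑ j, (eLpNorm ((fun x => fderiv ℝ w x (stdVec j)) - G j) 2
        (volume.restrict U) + eLpNorm (G j) 2 (volume.restrict U)) +
      2 * eLpNorm (w - v) 2 (volume.restrict U) := by
  have hμ0 : volume U ≠ 0 := (hUo.measure_pos volume hne).ne'
  have hfin : IsFiniteMeasure (volume.restrict U) := ⟨by simpa using hb.measure_lt_top⟩
  have hzero : NeZero (volume.restrict U) := ⟨by simpa using hμ0⟩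
  have hwi : Integrable w (volume.restrict U) :=
    integrableOn_of_continuous_of_isBounded hb hw.continuous
  have hvi : Integrable v (volume.restrict U) := hv.memLp.integrable one_le_two
  have hsplit : (fun x => v x - ⨍ y in U, v y) = (fun x => w x - ⨍ y in U, w y) -
      fun x => (w - v) x - ⨍ y in U, (w - v) y := by
    have havg : ⨍ y in U, (w - v) y = (⨍ y in U, w y) - ⨍ y in U, v y := by
      simp only [average_eq, Pi.sub_apply, integral_sub hwi hvi, smul_sub]
    ext x
    rw [havg, Pi.sub_apply, Pi.sub_apply]
    abel
  have hgrad (j : Fin n) : eLpNorm (fun x => fderiv ℝ w x (stdVec j)) 2 (volume.restrict U) ≤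
      eLpNorm ((fun x => fderiv ℝ w x (stdVec j)) - G j) 2 (volume.restrict U) +
        eLpNorm (G j) 2 (volume.restrict U) := by
    have hGm := (hv.memLp_grad j).1
    simpa using eLpNorm_add_le
      ((continuous_fderiv_stdVec hw j).aestronglyMeasurable.sub hGm) hGm one_le_two
  have hpoincare := eLpNorm_sub_average_le_eLpNorm_fderiv (μ := volume) hUo hU hb hne hw
  rw [finrank_euclideanSpace_fin] at hpoincare
  rw [hsplit]
  refine (eLpNorm_sub_le (hwi.1.sub aestronglyMeasurable_const)
    ((hwi.sub hvi).1.sub aestronglyMeasurable_const) one_le_two).trans ?_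
  refine add_le_add (hpoincare.trans ?_) (eLpNorm_sub_average_le_two_mul (hwi.sub hvi))
  gcongr
  exact (eLpNorm_fderiv_le_sum hw _).trans (Finset.sum_le_sum fun j _ => hgrad j)

theorem HasWeakGrad.eLpNorm_sub_average_le (hUo : IsOpen U) (hU : Convex ℝ U)
    (hb : Bornology.IsBounded U) (hne : U.Nonempty) (hv : HasWeakGrad U v G) :
    eLpNorm (fun x => v x - ⨍ y in U, v y) 2 (volume.restrict U) ≤
      2 ^ n * Metric.ediam U * ∑ j, eLpNorm (G j) 2 (volume.restrict U) := by
  obtain ⟨φ, hφ, hφv, hφG⟩ := hv.exists_smooth_approx hUo hU hb hne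
  have hsum := tendsto_finsetSum Finset.univ fun j _ =>
    (hφG j).add_const (eLpNorm (G j) 2 (volume.restrict U))
  have hconst : 2 ^ n * Metric.ediam U ≠ ⊤ := ENNReal.mul_ne_top (by simp) hb.ediam_ne_top
  have hlim := (ENNReal.Tendsto.const_mul hsum (Or.inr hconst)).add
    (ENNReal.Tendsto.const_mul (a := 2) hφv (Or.inr (by simp)))
  simp only [zero_add, mul_zero, add_zero] at hlim
  exact ge_of_tendsto' hlim fun i =>
    hv.eLpNorm_sub_average_le_of_contDiff hUo hU hb hne ((hφ i).of_le (by simp))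

end Poincare

section WeakJets

variable {n k m i : ℕ} {U : Set (Pt n)} {v : Form n k} {D : (i : ℕ) → (Fin i → Fin n) → Form n k}

lemma IsWeakJet.ae_eq_of_isEmpty (hU : IsOpen U) (hD : IsWeakJet U m v D) (α : Fin 0 → Fin n) :
    D 0 α =ᵐ[volume.restrict U] v :=
  ae_eq_of_forall_setIntegral_smul_eq hU (hD.memL2_deriv 0 m.zero_le α) hD.memL2
    fun φ hφ hφc hφU => by simpa using (hD.eq 0 m.zero_le α φ hφ hφc hφU).symm

lemma IsWeakJet.hasWeakGrad (hD : IsWeakJet U m v D) (hi : i < m) (α : Fin i → Fin n) :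
    HasWeakGrad U (D i α) fun j => D (i + 1) (Fin.cons j α : Fin (i + 1) → Fin n) where
  memLp := hD.memL2_deriv i hi.le α
  memLp_grad _ := hD.memL2_deriv (i + 1) hi _
  eq j φ hφ hφc hφU := by
    have hdφ := hD.eq i hi.le α _ (contDiff_fderiv_apply hφ (stdVec j)) (hφc.fderiv_apply ℝ _)
      ((tsupport_fderiv_apply_subset ℝ _).trans hφU)
    have hcons := hD.eq (i + 1) hi (Fin.cons j α) φ hφ hφc hφU
    have hderiv (x : Pt n) := congrFun (partialDeriv_cons_eq_partialDeriv_fderiv hφ j α) x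
    simp only [partialDeriv] at hderiv
    simp only [hderiv] at hcons
    rw [hdφ, pow_succ, mul_smul] at hcons
    exact (smul_right_injective _ (pow_ne_zero i (neg_ne_zero.2 (one_ne_zero' ℝ))) hcons).trans
      (neg_one_smul ℝ (∫ x in U, φ x • D (i + 1) (Fin.cons j α) x))

lemma IsWeakJet.ae_eq_comp_perm (hU : IsOpen U) (hD : IsWeakJet U m v D) (hi : i ≤ m)
    (α : Fin i → Fin n) (σ : Equiv.Perm (Fin i)) :
    D i (α ∘ σ) =ᵐ[volume.restrict U] D i α := by
  refine ae_eq_of_forall_setIntegral_smul_eq hU (hD.memL2_deriv i hi _)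
    (hD.memL2_deriv i hi _) fun φ hφ hφc hφU => ?_
  have hperm := hD.eq i hi (α ∘ σ) φ hφ hφc hφU
  have hderiv (x : Pt n) := congrFun (partialDeriv_comp_perm hφ α σ) x
  simp only [partialDeriv] at hderiv
  simp only [hderiv] at hperm
  rw [hD.eq i hi α φ hφ hφc hφU] at hperm
  exact (smul_right_injective _ (pow_ne_zero i (neg_ne_zero.2 (one_ne_zero' ℝ))) hperm).symm

lemma IsWeakJet.hasWeakGrad_sub_partialDeriv (hb : Bornology.IsBounded U)
    (hD : IsWeakJet U m v D) {q : Form n k} (hq : ContDiff ℝ ∞ q) (hi : i < m)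
    (α : Fin i → Fin n) :
    HasWeakGrad U (D i α - partialDeriv α q) fun j =>
      D (i + 1) (Fin.cons j α) - partialDeriv (Fin.cons j α : Fin (i + 1) → Fin n) q := by
  simp only [partialDeriv_cons hq]
  exact (hD.hasWeakGrad hi α).sub
    (HasWeakGrad.of_contDiff hb ((contDiff_partialDeriv hq α).of_le (by simp)))

end WeakJets

section BrambleHilbert

lemma sum_eLpNorm_le_of_hasWeakGrad {n m i : ℕ} {E : Type*} [NormedAddCommGroup E]
    [NormedSpace ℝ E] [CompleteSpace E] {U : Set (Pt n)} (hUo : IsOpen U) (hU : Convex ℝ U)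
    (hb : Bornology.IsBounded U) (hne : U.Nonempty) {R : (i : ℕ) → (Fin i → Fin n) → Pt n → E}
    (hgrad : ∀ i < m, ∀ α : Fin i → Fin n,
      HasWeakGrad U (R i α) fun j => R (i + 1) (Fin.cons j α : Fin (i + 1) → Fin n))
    (hmean : ∀ i < m, ∀ α, ∫ x in U, R i α x = 0) (hi : i ≤ m) :
    ∑ α, eLpNorm (R i α) 2 (volume.restrict U) ≤
      (2 ^ n * Metric.ediam U) ^ (m - i) * ∑ α, eLpNorm (R m α) 2 (volume.restrict U) := by
  induction hi using Nat.decreasingInduction with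
  | self => simp
  | @of_succ i hi ih =>
    have hpoincare (α : Fin i → Fin n) : eLpNorm (R i α) 2 (volume.restrict U) ≤
        2 ^ n * Metric.ediam U * ∑ j, eLpNorm (R (i + 1) (Fin.cons j α : Fin (i + 1) → Fin n)) 2
          (volume.restrict U) := by
      simpa [setAverage_eq, hmean i hi α] using
        (hgrad i hi α).eLpNorm_sub_average_le hUo hU hb hne
    have hreindex : ∑ α : Fin i → Fin n, ∑ j,
        eLpNorm (R (i + 1) (Fin.cons j α : Fin (i + 1) → Fin n)) 2 (volume.restrict U) =
          ∑ α, eLpNorm (R (i + 1) α) 2 (volume.restrict U) := by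
      rw [Finset.sum_comm, ← Fintype.sum_prod_type']
      exact Fintype.sum_equiv (Fin.consEquiv fun _ => Fin n) _ _ fun _ => rfl
    calc ∑ α, eLpNorm (R i α) 2 (volume.restrict U)
        ≤ 2 ^ n * Metric.ediam U * ∑ α, eLpNorm (R (i + 1) α) 2 (volume.restrict U) := by
          rw [← hreindex, Finset.mul_sum]
          exact Finset.sum_le_sum fun α _ => hpoincare α
      _ ≤ 2 ^ n * Metric.ediam U * ((2 ^ n * Metric.ediam U) ^ (m - (i + 1)) *
            ∑ α, eLpNorm (R m α) 2 (volume.restrict U)) := by gcongr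
      _ = _ := by rw [← mul_assoc, ← pow_succ', show m - (i + 1) + 1 = m - i by omega]

variable {n k : ℕ}

lemma exists_cellDiam_pow_le_mul_volume (n : ℕ) (γ : ℝ) :
    ∃ B : ℝ≥0, ∀ K : Finset (Pt n), IsRegularSimplex γ K →
      ENNReal.ofReal (cellDiam K ^ n) ≤ B * volume (cell K) := by
  have hball : volume (Metric.ball (0 : Pt n) 1) ≠ 0 :=
    (Metric.measure_ball_pos volume _ one_pos).ne'
  refine ⟨(ENNReal.ofReal (|γ| ^ n) / volume (Metric.ball (0 : Pt n) 1)).toNNReal,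
    fun K hK => ?_⟩
  obtain ⟨c, ρ, hρ, hsub, hle⟩ := hK.exists_ball_subset_cell
  rw [ENNReal.coe_toNNReal (ENNReal.div_ne_top (by simp) hball)]
  calc ENNReal.ofReal (cellDiam K ^ n)
      ≤ ENNReal.ofReal (|γ| ^ n) * ENNReal.ofReal (ρ ^ n) := by
        rw [← ENNReal.ofReal_mul (by positivity), ← mul_pow]
        have hdiam : 0 ≤ cellDiam K := Metric.diam_nonneg
        gcongr
        exact hle.trans (by gcongr; exact le_abs_self γ)
    _ = ENNReal.ofReal (|γ| ^ n) / volume (Metric.ball (0 : Pt n) 1) *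
          volume (Metric.ball c ρ) := by
        rw [Measure.addHaar_ball_of_pos _ _ hρ, finrank_euclideanSpace_fin, mul_comm (_ / _),
          mul_assoc, ENNReal.mul_div_cancel hball measure_ball_lt_top.ne, mul_comm]
    _ ≤ _ := by gcongr

lemma lintegral_lintegral_enorm_sub_sq_le_slobodeckijSq {c : ℝ≥0}
    (hc : ∀ α : Alt (Pt n) k, ‖α‖₊ ≤ c * ‖altCoeffs (Pt n) k α‖₊) {U : Set (Pt n)}
    (hU : MeasurableSet U) {h θ : ℝ} (hh : 0 ≤ h) (hdist : ∀ x ∈ U, ∀ y ∈ U, dist x y ≤ h)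
    (hθ : 0 < θ) (w : Form n k) :
    ∫⁻ x in U, (∫⁻ y in U, ‖w x - w y‖ₑ ^ 2) ≤
      c ^ 2 * ENNReal.ofReal (h ^ (n + 2 * θ)) * slobodeckijSq U θ w := by
  rw [slobodeckijSq, if_neg hθ.ne',
    ← lintegral_const_mul' _ _ (ENNReal.mul_ne_top (by simp) ENNReal.ofReal_ne_top)]
  refine setLIntegral_mono' hU fun x hx => ?_
  rw [← lintegral_const_mul' _ _ (ENNReal.mul_ne_top (by simp) ENNReal.ofReal_ne_top)]
  refine setLIntegral_mono' hU fun y hy => ?_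
  have hcoeff : ‖w x - w y‖ₑ ^ 2 ≤ c ^ 2 * ENNReal.ofReal (altInner (w x - w y) (w x - w y)) := by
    rw [ofReal_altInner_self, ← mul_pow, enorm_eq_nnnorm, enorm_eq_nnnorm]
    exact pow_le_pow_left' (by exact_mod_cast hc (w x - w y)) 2
  rw [mul_assoc, ← ENNReal.ofReal_mul (by positivity)]
  refine hcoeff.trans ?_
  gcongr
  rcases eq_or_ne x y with rfl | hxy
  · simp [altInner_self]
  · have hd : 0 < ‖x - y‖ := norm_pos_iff.2 (sub_ne_zero.2 hxy)
    have hinner : 0 ≤ altInner (w x - w y) (w x - w y) := by rw [altInner_self]; positivity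
    rw [mul_div_assoc', le_div_iff₀ (by positivity), mul_comm]
    gcongr
    exact (dist_eq_norm x y).symm.trans_le (hdist x hx y hy)

lemma eLpNorm_sub_average_le_slobodeckijSq_of_pos {c B : ℝ≥0}
    (hc : ∀ α : Alt (Pt n) k, ‖α‖₊ ≤ c * ‖altCoeffs (Pt n) k α‖₊) {K : Finset (Pt n)}
    (hB : ENNReal.ofReal (cellDiam K ^ n) ≤ B * volume (cell K)) (hh : 0 < cellDiam K)
    (hne : (cell K).Nonempty) {θ : ℝ} (hθ : 0 < θ) {w : Form n k} (hw : MemL2 (cell K) w) :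
    eLpNorm (fun x => w x - ⨍ y in cell K, w y) 2 (volume.restrict (cell K)) ≤
      c * NNReal.sqrt B * ENNReal.ofReal (cellDiam K ^ θ) *
        slobodeckijSq (cell K) θ w ^ (1 / 2 : ℝ) := by
  have hμ0 : volume (cell K) ≠ 0 := (isOpen_cell.measure_pos volume hne).ne'
  have hμtop : volume (cell K) ≠ ⊤ := isBounded_cell.measure_lt_top.ne
  have hfin : IsFiniteMeasure (volume.restrict (cell K)) :=
    ⟨by simpa using isBounded_cell.measure_lt_top⟩
  have hzero : NeZero (volume.restrict (cell K)) := ⟨by simpa using hμ0⟩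
  have hscale : ENNReal.ofReal (cellDiam K ^ (n + 2 * θ)) =
      ENNReal.ofReal (cellDiam K ^ n) * ENNReal.ofReal (cellDiam K ^ θ) ^ 2 := by
    rw [← ENNReal.ofReal_pow (by positivity), ← ENNReal.ofReal_mul (by positivity),
      Real.rpow_add hh, Real.rpow_natCast, mul_comm 2 θ, Real.rpow_mul hh.le, Real.rpow_ofNat]
  have hB' : (B : ℝ≥0∞) = (NNReal.sqrt B : ℝ≥0∞) ^ 2 := by
    exact_mod_cast (NNReal.sq_sqrt B).symm
  have hdouble := (measure_univ_mul_eLpNorm_sub_average_sq_le (hw.integrable one_le_two)).trans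
    (lintegral_lintegral_enorm_sub_sq_le_slobodeckijSq hc isOpen_cell.measurableSet hh.le
      (fun x hx y hy => dist_le_cellDiam (interior_subset hx) (interior_subset hy)) hθ w)
  rw [Measure.restrict_apply_univ] at hdouble
  rw [← ENNReal.pow_le_pow_left_iff two_ne_zero, ← ENNReal.mul_le_mul_iff_right hμ0 hμtop]
  calc _ ≤ c ^ 2 * ENNReal.ofReal (cellDiam K ^ (n + 2 * θ)) * slobodeckijSq (cell K) θ w :=
        hdouble
    _ ≤ c ^ 2 * (B * volume (cell K) * ENNReal.ofReal (cellDiam K ^ θ) ^ 2) *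
          slobodeckijSq (cell K) θ w := by rw [hscale]; gcongr
    _ = _ := by rw [mul_pow, mul_pow, mul_pow, rpow_half_sq, hB']; ring

variable (n k) in
lemma exists_eLpNorm_sub_average_le_slobodeckijSq (hn : 0 < n) (γ : ℝ) : ∃ C : ℝ≥0,
    ∀ K : Finset (Pt n), IsRegularSimplex γ K → ∀ θ : ℝ, 0 ≤ θ → ∀ w : Form n k,
      MemL2 (cell K) w →
      eLpNorm (fun x => w x - ⨍ y in cell K, w y) 2 (volume.restrict (cell K)) ≤
        C * ENNReal.ofReal (cellDiam K ^ θ) * slobodeckijSq (cell K) θ w ^ (1 / 2 : ℝ) := by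
  obtain ⟨c, hc⟩ := exists_nnnorm_le_mul_nnnorm_altCoeffs (Pt n) k
  obtain ⟨B, hB⟩ := exists_cellDiam_pow_le_mul_volume n γ
  refine ⟨max (2 * c) (c * NNReal.sqrt B), fun K hK θ hθ w hw => ?_⟩
  have hne := hK.nonempty_cell
  rcases hθ.eq_or_lt with rfl | hθ
  · have hfin : IsFiniteMeasure (volume.restrict (cell K)) :=
      ⟨by simpa using isBounded_cell.measure_lt_top⟩
    have hzero : NeZero (volume.restrict (cell K)) :=
      ⟨by simpa using (isOpen_cell.measure_pos volume hne).ne'⟩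
    calc _ ≤ 2 * eLpNorm w 2 (volume.restrict (cell K)) :=
          eLpNorm_sub_average_le_two_mul (hw.integrable one_le_two)
      _ ≤ 2 * (c * l2Norm (volume.restrict (cell K)) w) := by
          gcongr
          exact eLpNorm_le_mul_l2Norm hc w
      _ = (2 * c : ℝ≥0) * l2Norm (volume.restrict (cell K)) w := by push_cast; ring
      _ ≤ _ := by
          rw [slobodeckijSq, if_pos rfl, Real.rpow_zero, ENNReal.ofReal_one, mul_one,
            sq_rpow_half]
          gcongr
          exact le_max_left _ _
  · refine (eLpNorm_sub_average_le_slobodeckijSq_of_pos hc (hB K hK) (hK.cellDiam_pos hn) hne hθ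
      hw).trans ?_
    rw [← ENNReal.coe_mul]
    gcongr
    exact le_max_right _ _

variable {m : ℕ} {U : Set (Pt n)} {v : Form n k} {D : (i : ℕ) → (Fin i → Fin n) → Form n k}

lemma IsWeakJet.exists_polySpan_setIntegral_sub_eq_zero (hUo : IsOpen U)
    (hb : Bornology.IsBounded U) (hne : U.Nonempty) (hD : IsWeakJet U m v D) :
    ∃ q ∈ polySpan n (m + 1) (Alt (Pt n) k),
      (∀ i ≤ m, ∀ α, ∫ x in U, (D i α - partialDeriv α q) x = 0) ∧
      ∀ (α : Fin m → Fin n) (x : Pt n), partialDeriv α q x = ⨍ y in U, D m α y := by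
  have hμ0 : volume U ≠ 0 := (hUo.measure_pos volume hne).ne'
  have hfin : IsFiniteMeasure (volume.restrict U) := ⟨by simpa using hb.measure_lt_top⟩
  obtain ⟨q, hq, hqint, hqhigh⟩ := exists_polySpan_setIntegral_partialDeriv_eq hμ0 hb (m + 1)
    (fun i α => ∫ x in U, D i α x) fun i hi α σ =>
      integral_congr_ae (hD.ae_eq_comp_perm hUo (Nat.le_of_lt_succ hi) α σ)
  have hqs : ContDiff ℝ ∞ q := contDiff_of_mem_polySpan hq
  refine ⟨q, hq, fun i hi α => ?_, fun α x => ?_⟩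
  · simp only [Pi.sub_apply]
    rw [integral_sub ((hD.memL2_deriv i hi α).integrable one_le_two)
      (integrableOn_of_continuous_of_isBounded hb (contDiff_partialDeriv hqs α).continuous),
      hqint i (Nat.lt_succ_of_le hi), sub_self]
  · have hconst (y : Pt n) : partialDeriv α q y = partialDeriv α q x := by
      refine is_const_of_fderiv_eq_zero ((contDiff_partialDeriv hqs α).differentiable (by simp))
        (fun y => ?_) y x
      refine ContinuousLinearMap.coe_injective
        ((EuclideanSpace.basisFun (Fin n) ℝ).toBasis.ext fun j => ?_)
      simpa [partialDeriv_cons hqs] using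
        congrFun (hqhigh (m + 1) le_rfl (Fin.cons j α : Fin (m + 1) → Fin n)) y
    rw [setAverage_eq, ← hqint m m.lt_succ_self α]
    simp only [hconst]
    rw [setIntegral_const, inv_smul_smul₀ (measureReal_ne_zero_iff hb.measure_lt_top.ne |>.2 hμ0)]

lemma IsWeakJet.hasWeakGrad_of_one_le (hUo : IsOpen U) (hD : IsWeakJet U m v D) (hm : 1 ≤ m) :
    HasWeakGrad U v fun j => D 1 fun _ => j := by
  have hgrad := (hD.hasWeakGrad hm Fin.elim0).congr (hD.ae_eq_of_isEmpty hUo _)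
    fun _ => EventuallyEq.rfl
  have hcons (j : Fin n) : (Fin.cons j Fin.elim0 : Fin 1 → Fin n) = fun _ => j :=
    Matrix.cons_fin_one j _
  simpa only [hcons] using hgrad

lemma IsWeakJet.exists_polySpan_eLpNorm_le (hUo : IsOpen U) (hU : Convex ℝ U)
    (hb : Bornology.IsBounded U) (hne : U.Nonempty) (hD : IsWeakJet U m v D) (hm : 1 ≤ m) :
    ∃ q ∈ polySpan n (m + 1) (Alt (Pt n) k), ∃ G, HasWeakGrad U (v - q) G ∧
      eLpNorm (v - q) 2 (volume.restrict U) ≤ (2 ^ n * Metric.ediam U) ^ m *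
        ∑ α, eLpNorm (fun x => D m α x - ⨍ y in U, D m α y) 2 (volume.restrict U) ∧
      ∑ j, eLpNorm (G j) 2 (volume.restrict U) ≤ (2 ^ n * Metric.ediam U) ^ (m - 1) *
        ∑ α, eLpNorm (fun x => D m α x - ⨍ y in U, D m α y) 2 (volume.restrict U) := by
  obtain ⟨q, hq, hmean, htop⟩ := hD.exists_polySpan_setIntegral_sub_eq_zero hUo hb hne
  have hqs : ContDiff ℝ ∞ q := contDiff_of_mem_polySpan hq
  have hremainder (i : ℕ) (hi : i ≤ m) := sum_eLpNorm_le_of_hasWeakGrad hUo hU hb hne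
    (fun i hi => hD.hasWeakGrad_sub_partialDeriv hb hqs hi) (fun i hi => hmean i hi.le) hi
  have htop' (α : Fin m → Fin n) :
      D m α - partialDeriv α q = fun x => D m α x - ⨍ y in U, D m α y :=
    funext fun x => by rw [Pi.sub_apply, htop]
  simp only [htop'] at hremainder
  have hzero (α : Fin 0 → Fin n) : D 0 α - partialDeriv α q =ᵐ[volume.restrict U] v - q := by
    rw [partialDeriv_of_isEmpty]
    exact (hD.ae_eq_of_isEmpty hUo α).sub EventuallyEq.rfl
  refine ⟨q, hq, fun j => D 1 (fun _ => j) - partialDeriv (fun _ : Fin 1 => j) q, ?_, ?_, ?_⟩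
  · have hcons (j : Fin n) : (Fin.cons j Fin.elim0 : Fin 1 → Fin n) = fun _ => j :=
      Matrix.cons_fin_one j _
    simpa only [hcons] using (hD.hasWeakGrad_sub_partialDeriv hb hqs hm Fin.elim0).congr
      (hzero _) fun _ => EventuallyEq.rfl
  · simpa only [Fintype.sum_unique, eLpNorm_congr_ae (hzero _), Nat.sub_zero] using
      hremainder 0 m.zero_le
  · rw [← (Equiv.funUnique (Fin 1) (Fin n)).sum_comp]
    refine le_trans (Finset.sum_le_sum fun α _ => ?_) (hremainder 1 hm)
    have hα : (fun _ => Equiv.funUnique (Fin 1) (Fin n) α) = α :=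
      (Equiv.funUnique (Fin 1) (Fin n)).symm_apply_apply α
    simp only [hα, le_refl]

variable (n k) in
theorem exists_polySpan_approx (hn : 0 < n) (γ : ℝ) (hm : 1 ≤ m) : ∃ C : ℝ≥0,
    ∀ K : Finset (Pt n), IsRegularSimplex γ K → ∀ θ : ℝ, 0 ≤ θ →
      ∀ (v : Form n k) (D : (i : ℕ) → (Fin i → Fin n) → Form n k), IsWeakJet (cell K) m v D →
      ∃ q ∈ polySpan n (m + 1) (Alt (Pt n) k), ∃ G, HasWeakGrad (cell K) (v - q) G ∧
        scaledH1Norm K (v - q) G ≤ C * (ENNReal.ofReal (cellDiam K ^ (m + θ)) *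
          (∑ α, slobodeckijSq (cell K) θ (D m α)) ^ (1 / 2 : ℝ)) := by
  simp only [scaledH1Norm]
  obtain ⟨C, hC⟩ := exists_eLpNorm_sub_average_le_slobodeckijSq n k hn γ
  refine ⟨2 * (2 ^ n) ^ m * (n ^ m * C), fun K hK θ hθ v D hD => ?_⟩
  set H : ℝ≥0∞ := ENNReal.ofReal (cellDiam K)
  set S : ℝ≥0∞ := ∑ α, slobodeckijSq (cell K) θ (D m α)
  have hdiam : Metric.ediam (cell K) ≤ H := Metric.ediam_le_of_forall_dist_le fun x hx y hy =>
    dist_le_cellDiam (interior_subset hx) (interior_subset hy)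
  obtain ⟨q, hq, G, hG, hzeroth, hfirst⟩ := hD.exists_polySpan_eLpNorm_le isOpen_cell convex_cell
    isBounded_cell hK.nonempty_cell hm
  set N : ℝ≥0∞ :=
    ∑ α, eLpNorm (fun x => D m α x - ⨍ y in cell K, D m α y) 2 (volume.restrict (cell K))
  have htop : N ≤ n ^ m * (C * ENNReal.ofReal (cellDiam K ^ θ) * S ^ (1 / 2 : ℝ)) := by
    refine (Finset.sum_le_card_nsmul _ _ (C * ENNReal.ofReal (cellDiam K ^ θ) * S ^ (1 / 2 : ℝ))
      fun α _ => (hC K hK θ hθ _ (hD.memL2_deriv m le_rfl α)).trans ?_).trans_eq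
      (by simp [nsmul_eq_mul])
    gcongr
    exact Finset.single_le_sum (f := fun α => slobodeckijSq (cell K) θ (D m α))
      (fun _ _ => zero_le) (Finset.mem_univ α)
  refine ⟨q, hq, G, hG, ?_⟩
  calc eLpNorm (v - q) 2 (volume.restrict (cell K)) +
        H * ∑ j, eLpNorm (G j) 2 (volume.restrict (cell K))
      ≤ (2 ^ n * H) ^ m * N + 2 ^ n * H * ((2 ^ n * H) ^ (m - 1) * N) := by
        refine add_le_add (hzeroth.trans (by gcongr)) ?_
        refine mul_le_mul' (le_mul_of_one_le_left zero_le (one_le_pow₀ (by norm_num)))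
          (hfirst.trans (by gcongr))
    _ = 2 * ((2 ^ n * H) ^ m * N) := by
        rw [← mul_assoc, ← pow_succ', Nat.sub_add_cancel hm, two_mul]
    _ ≤ 2 * ((2 ^ n * H) ^ m *
          (n ^ m * (C * ENNReal.ofReal (cellDiam K ^ θ) * S ^ (1 / 2 : ℝ)))) := by gcongr
    _ = _ := by
        have hh := hK.cellDiam_pos hn
        rw [Real.rpow_add hh, Real.rpow_natCast, ENNReal.ofReal_mul (by positivity),
          ENNReal.ofReal_pow hh.le]
        push_cast
        ring

end BrambleHilbert

section SumsOfSquares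

variable {ι : Type*}

lemma rpow_half_le_iff {a b : ℝ≥0∞} : a ^ (1 / 2 : ℝ) ≤ b ↔ a ≤ b ^ 2 := by
  rw [one_div, ENNReal.rpow_inv_le_iff two_pos, ENNReal.rpow_ofNat]

lemma rpow_half_sum_sq_le_sum (s : Finset ι) (a : ι → ℝ≥0∞) :
    (∑ i ∈ s, a i ^ 2) ^ (1 / 2 : ℝ) ≤ ∑ i ∈ s, a i := by
  rw [rpow_half_le_iff, sq, Finset.sum_mul]
  refine Finset.sum_le_sum fun i hi => ?_
  rw [sq]
  gcongr
  exact Finset.single_le_sum (fun _ _ => zero_le) hi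

lemma le_rpow_half_sum_sq {s : Finset ι} (a : ι → ℝ≥0∞) {i : ι} (hi : i ∈ s) :
    a i ≤ (∑ i ∈ s, a i ^ 2) ^ (1 / 2 : ℝ) := by
  rw [← ENNReal.pow_le_pow_left_iff two_ne_zero, rpow_half_sq]
  exact Finset.single_le_sum (f := fun i => a i ^ 2) (fun _ _ => zero_le) hi

lemma rpow_half_sum_sq_le_mul_add {s : Finset ι} {a x y : ι → ℝ≥0∞} {b c A S : ℝ≥0∞}
    (ha : ∀ i ∈ s, a i ≤ c * (x i + b * y i)) (hx : ∑ i ∈ s, x i ^ 2 ≤ A ^ 2)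
    (hy : ∑ i ∈ s, y i ^ 2 ≤ S ^ 2) :
    (∑ i ∈ s, a i ^ 2) ^ (1 / 2 : ℝ) ≤ c * (A + b * S) := by
  have hminkowski := ENNReal.Lp_add_le s x (fun i => b * y i) one_le_two
  simp only [ENNReal.rpow_ofNat] at hminkowski
  calc (∑ i ∈ s, a i ^ 2) ^ (1 / 2 : ℝ)
      ≤ (∑ i ∈ s, (c * (x i + b * y i)) ^ 2) ^ (1 / 2 : ℝ) := by
        gcongr with i hi
        exact ha i hi
    _ = c * (∑ i ∈ s, (x i + b * y i) ^ 2) ^ (1 / 2 : ℝ) := by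
        simp only [mul_pow c]
        rw [← Finset.mul_sum, ENNReal.mul_rpow_of_nonneg _ _ (by norm_num), sq_rpow_half]
    _ ≤ c * ((∑ i ∈ s, x i ^ 2) ^ (1 / 2 : ℝ) +
          (∑ i ∈ s, (b * y i) ^ 2) ^ (1 / 2 : ℝ)) := by gcongr
    _ ≤ c * (A + b * S) := by
        gcongr c * (?_ + ?_)
        · exact rpow_half_le_iff.2 hx
        · rw [rpow_half_le_iff]
          simp only [mul_pow]
          rw [← Finset.mul_sum]
          gcongr

lemma tendsto_zero_of_le_mul {f g : ℕ → ℝ≥0∞} {c : ℝ≥0} (hg : Tendsto g atTop (𝓝 0))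
    (hfg : ∀ i, f i ≤ c * g i) : Tendsto f atTop (𝓝 0) :=
  tendsto_of_tendsto_of_tendsto_of_le_of_le tendsto_const_nhds
    (by simpa using ENNReal.Tendsto.const_mul hg (Or.inr ENNReal.coe_ne_top))
    (fun _ => zero_le) hfg

end SumsOfSquares

section FirstOrderSeminorm

variable {n k : ℕ} {U : Set (Pt n)} {v : Form n k} {G : Fin n → Form n k}

/-- The jet of order one that consists of a form and its gradient; the entries of order above one
are irrelevant. -/
noncomputable def gradJet (v : Form n k) (G : Fin n → Form n k) :
    (i : ℕ) → (Fin i → Fin n) → Form n k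
  | 0, _ => v
  | _ + 1, α => G (α 0)

lemma HasWeakGrad.isWeakJet (h : HasWeakGrad U v G) : IsWeakJet U 1 v (gradJet v G) where
  memL2 := h.memLp
  memL2_deriv
    | 0, _, _ => h.memLp
    | _ + 1, _, α => h.memLp_grad (α 0)
  eq i hi α φ hφ hφc hφU := by
    obtain rfl | rfl : i = 0 ∨ i = 1 := by omega
    · simp [gradJet]
    · simp only [iteratedFDeriv_one_apply, pow_one, gradJet, h.eq (α 0) φ hφ hφc hφU]
      exact (neg_one_smul ℝ _).symm

lemma sobolevSeminorm_one : sobolevSeminorm U 1 v =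
    ⨅ (D : (i : ℕ) → (Fin i → Fin n) → Form n k) (_ : IsWeakJet U 1 v D),
      (∑ α : Fin 1 → Fin n, l2Norm (volume.restrict U) (D 1 α) ^ 2) ^ (1 / 2 : ℝ) := by
  rw [sobolevSeminorm, Nat.floor_one]
  simp [slobodeckijSq]

lemma HasWeakGrad.sobolevSeminorm_one_le (h : HasWeakGrad U v G) :
    sobolevSeminorm U 1 v ≤ ∑ j, l2Norm (volume.restrict U) (G j) := by
  rw [sobolevSeminorm_one]
  refine (iInf₂_le _ h.isWeakJet).trans ((rpow_half_sum_sq_le_sum _ _).trans_eq ?_)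
  exact (Equiv.funUnique (Fin 1) (Fin n)).sum_comp fun j => l2Norm (volume.restrict U) (G j)

lemma HasWeakGrad.l2Norm_le_sobolevSeminorm_one (hU : IsOpen U) (h : HasWeakGrad U v G)
    (j : Fin n) : l2Norm (volume.restrict U) (G j) ≤ sobolevSeminorm U 1 v := by
  rw [sobolevSeminorm_one]
  refine le_iInf₂ fun D hD => ?_
  rw [l2Norm_congr_ae (h.unique hU (hD.hasWeakGrad_of_one_le hU le_rfl) j)]
  exact le_rpow_half_sum_sq (fun α => l2Norm (volume.restrict U) (D 1 α)) (Finset.mem_univ _)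

lemma MemSobolev.exists_hasWeakGrad (hU : IsOpen U) (h : MemSobolev U 1 v) :
    ∃ G, HasWeakGrad U v G := by
  rw [MemSobolev, sobolevSeminorm_one] at h
  simp only [iInf_lt_iff] at h
  obtain ⟨D, hD, -⟩ := h
  exact ⟨_, hD.hasWeakGrad_of_one_le hU le_rfl⟩

end FirstOrderSeminorm

section ScaledH1Norm

variable {n : ℕ} {K : Finset (Pt n)} {E : Type*} [NormedAddCommGroup E] {v w : Pt n → E}
  {G H : Fin n → Pt n → E}

lemma scaledH1Norm_congr (hvw : v =ᵐ[volume.restrict (cell K)] w)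
    (hGH : ∀ j, G j =ᵐ[volume.restrict (cell K)] H j) :
    scaledH1Norm K v G = scaledH1Norm K w H := by
  simp only [scaledH1Norm, eLpNorm_congr_ae hvw, eLpNorm_congr_ae (hGH _)]

lemma scaledH1Norm_sub_comm (v w : Pt n → E) (G H : Fin n → Pt n → E) :
    scaledH1Norm K (v - w) (fun j => G j - H j) =
      scaledH1Norm K (w - v) fun j => H j - G j := by
  simp only [scaledH1Norm, eLpNorm_sub_comm v, eLpNorm_sub_comm (G _)]

lemma tendsto_scaledH1Norm {v : ℕ → Pt n → E} {G : ℕ → Fin n → Pt n → E}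
    (hv : Tendsto (fun i => eLpNorm (v i) 2 (volume.restrict (cell K))) atTop (𝓝 0))
    (hG : ∀ j, Tendsto (fun i => eLpNorm (G i j) 2 (volume.restrict (cell K))) atTop (𝓝 0)) :
    Tendsto (fun i => scaledH1Norm K (v i) (G i)) atTop (𝓝 0) := by
  have hsum := tendsto_finsetSum Finset.univ fun j _ => hG j
  simpa [scaledH1Norm] using
    hv.add (ENNReal.Tendsto.const_mul hsum (Or.inr ENNReal.ofReal_ne_top))

variable [NormedSpace ℝ E]

lemma HasWeakGrad.scaledH1Norm_sub_le (hv : HasWeakGrad (cell K) v G)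
    (hw : HasWeakGrad (cell K) w H) :
    scaledH1Norm K (v - w) (fun j => G j - H j) ≤ scaledH1Norm K v G + scaledH1Norm K w H := by
  simp only [scaledH1Norm]
  rw [add_add_add_comm, ← mul_add, ← Finset.sum_add_distrib]
  gcongr with j
  · exact eLpNorm_sub_le hv.memLp.1 hw.memLp.1 one_le_two
  · exact eLpNorm_sub_le (hv.memLp_grad j).1 (hw.memLp_grad j).1 one_le_two

lemma HasWeakGrad.scaledH1Norm_le_mul {k : ℕ} {c : ℝ≥0}
    (hc : ∀ α : Alt (Pt n) k, ‖α‖₊ ≤ c * ‖altCoeffs (Pt n) k α‖₊) {v : Form n k}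
    {G : Fin n → Form n k} (h : HasWeakGrad (cell K) v G) :
    scaledH1Norm K v G ≤ c * (l2Norm (volume.restrict (cell K)) v +
      ENNReal.ofReal (cellDiam K) * (n * sobolevSeminorm (cell K) 1 v)) := by
  have hsum : ∑ j, eLpNorm (G j) 2 (volume.restrict (cell K)) ≤
      n * (c * sobolevSeminorm (cell K) 1 v) := by
    refine (Finset.sum_le_card_nsmul _ _ (c * sobolevSeminorm (cell K) 1 v) fun j _ =>
      (eLpNorm_le_mul_l2Norm hc (G j)).trans ?_).trans_eq (by simp)
    gcongr
    exact h.l2Norm_le_sobolevSeminorm_one isOpen_cell j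
  calc scaledH1Norm K v G
      ≤ c * l2Norm (volume.restrict (cell K)) v +
          ENNReal.ofReal (cellDiam K) * (n * (c * sobolevSeminorm (cell K) 1 v)) := by
        rw [scaledH1Norm]
        gcongr
        exact eLpNorm_le_mul_l2Norm hc v
    _ = _ := by ring

end ScaledH1Norm

section FacetTrace

variable {n : ℕ} {γ : ℝ} {K : Finset (Pt n)} {z : Pt n}
  {E F : Type*} [NormedAddCommGroup E] [NormedSpace ℝ E] [NormedAddCommGroup F] [NormedSpace ℝ F]
  {L : E →L[ℝ] F} {v w : Pt n → E} {G H : Fin n → Pt n → E} {g g' : Pt n → F}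

lemma memLp_facetMeasure {F : Type*} [NormedAddCommGroup F] [IsFiniteMeasure (facetMeasure K z)]
    {f : Pt n → F} (hf : Continuous f) : MemLp f 2 (facetMeasure K z) := by
  obtain ⟨c, hc⟩ := (isCompact_facet z).exists_bound_of_continuousOn hf.continuousOn
  exact .of_bound hf.aestronglyMeasurable c
    (ae_restrict_of_forall_mem (isCompact_facet z).measurableSet hc)

lemma scaledH1Norm_fderiv_sub_le {φ ψ : Pt n → E} (hφ : ContDiff ℝ 1 φ) (hψ : ContDiff ℝ 1 ψ)
    (hv : HasWeakGrad (cell K) v G) (hw : HasWeakGrad (cell K) w H) :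
    scaledH1Norm K (φ - ψ - (v - w))
        (fun j => (fun x => fderiv ℝ (φ - ψ) x (stdVec j)) - (G j - H j)) ≤
      scaledH1Norm K (φ - v) (fun j => (fun x => fderiv ℝ φ x (stdVec j)) - G j) +
        scaledH1Norm K (ψ - w) fun j => (fun x => fderiv ℝ ψ x (stdVec j)) - H j := by
  refine Eq.trans_le ?_ (((HasWeakGrad.of_contDiff isBounded_cell hφ).sub hv).scaledH1Norm_sub_le
    ((HasWeakGrad.of_contDiff isBounded_cell hψ).sub hw))
  rw [sub_sub_sub_comm]
  congr 1
  ext j x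
  simp only [Pi.sub_apply, fderiv_sub (hφ.differentiable one_ne_zero x)
    (hψ.differentiable one_ne_zero x), sub_apply, sub_sub_sub_comm]

/-- `g` is the image under `L` of the trace, on the facet of `K` opposite to `z`, of the function
`v` with weak gradient `G`. -/
structure HasFacetTrace (K : Finset (Pt n)) (z : Pt n) (L : E →L[ℝ] F) (v : Pt n → E)
    (G : Fin n → Pt n → E) (g : Pt n → F) : Prop where
  hasWeakGrad : HasWeakGrad (cell K) v G
  memLp : MemLp g 2 (facetMeasure K z)
  approx : ∃ φ : ℕ → Pt n → E, (∀ i, ContDiff ℝ ∞ (φ i)) ∧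
    Tendsto (fun i => scaledH1Norm K (φ i - v)
      fun j => (fun x => fderiv ℝ (φ i) x (stdVec j)) - G j) atTop (𝓝 0) ∧
    Tendsto (fun i => eLpNorm ((fun x => L (φ i x)) - g) 2 (facetMeasure K z)) atTop (𝓝 0)

namespace HasFacetTrace

lemma of_contDiff [IsFiniteMeasure (facetMeasure K z)] {φ : Pt n → E} (hφ : ContDiff ℝ ∞ φ) :
    HasFacetTrace K z L φ (fun j x => fderiv ℝ φ x (stdVec j)) (fun x => L (φ x)) where
  hasWeakGrad := .of_contDiff isBounded_cell (hφ.of_le (by simp))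
  memLp := memLp_facetMeasure (L.continuous.comp hφ.continuous)
  approx := ⟨fun _ => φ, fun _ => hφ, by simp [scaledH1Norm], by simp⟩

lemma sub (h : HasFacetTrace K z L v G g) (h' : HasFacetTrace K z L w H g') :
    HasFacetTrace K z L (v - w) (fun j => G j - H j) (g - g') := by
  obtain ⟨hv, hg, φ, hφ, hφv, hφg⟩ := h
  obtain ⟨hw, hg', ψ, hψ, hψw, hψg⟩ := h'
  have hL : ∀ {θ : Pt n → E}, ContDiff ℝ ∞ θ →
      AEStronglyMeasurable (fun x => L (θ x)) (facetMeasure K z) := fun hθ =>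
    (L.continuous.comp hθ.continuous).aestronglyMeasurable
  refine ⟨hv.sub hw, hg.sub hg', fun i => φ i - ψ i, fun i => (hφ i).sub (hψ i), ?_, ?_⟩
  · have hsum := hφv.add hψw
    rw [add_zero] at hsum
    refine tendsto_of_tendsto_of_tendsto_of_le_of_le tendsto_const_nhds hsum
      (fun _ => zero_le) fun i => ?_
    exact scaledH1Norm_fderiv_sub_le ((hφ i).of_le (by simp)) ((hψ i).of_le (by simp)) hv hw
  · have hsum := hφg.add hψg
    rw [add_zero] at hsum
    refine tendsto_of_tendsto_of_tendsto_of_le_of_le tendsto_const_nhds hsum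
      (fun _ => zero_le) fun i => ?_
    refine Eq.trans_le ?_ (eLpNorm_sub_le ((hL (hφ i)).sub hg.1) ((hL (hψ i)).sub hg'.1)
      one_le_two)
    congr 1
    ext x
    simp only [Pi.sub_apply, map_sub, sub_sub_sub_comm]

lemma congr (h : HasFacetTrace K z L v G g) (hvw : v =ᵐ[volume.restrict (cell K)] w)
    (hGH : ∀ j, G j =ᵐ[volume.restrict (cell K)] H j) : HasFacetTrace K z L w H g := by
  obtain ⟨φ, hφ, hφv, hφg⟩ := h.approx
  refine ⟨h.hasWeakGrad.congr hvw hGH, h.memLp, φ, hφ, hφv.congr fun i => ?_, hφg⟩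
  exact scaledH1Norm_congr (EventuallyEq.rfl.sub hvw) fun j => EventuallyEq.rfl.sub (hGH j)

lemma eLpNorm_facetMeasure_le [FiniteDimensional ℝ E] (h : HasFacetTrace K z L v G g)
    (hL : ∀ x, ‖L x‖ ≤ ‖x‖) (hn : 0 < n) (hK : IsRegularSimplex γ K) (hz : z ∈ K) :
    ENNReal.ofReal (cellDiam K ^ (1 / 2 : ℝ)) * eLpNorm g 2 (facetMeasure K z) ≤
      traceConst n γ * scaledH1Norm K v G := by
  obtain ⟨hv, hg, φ, hφ, hφv, hφg⟩ := h
  set s := ENNReal.ofReal (cellDiam K ^ (1 / 2 : ℝ))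
  have hsmooth : ∀ i, s * eLpNorm g 2 (facetMeasure K z) ≤
      s * eLpNorm ((fun x => L (φ i x)) - g) 2 (facetMeasure K z) +
        traceConst n γ * (scaledH1Norm K v G + scaledH1Norm K (φ i - v)
          fun j => (fun x => fderiv ℝ (φ i) x (stdVec j)) - G j) := by
    intro i
    have hφ1 : ContDiff ℝ 1 (φ i) := (hφ i).of_le (by simp)
    have hφi : HasWeakGrad (cell K) (φ i) _ := .of_contDiff isBounded_cell hφ1
    have hfacet : eLpNorm g 2 (facetMeasure K z) ≤
        eLpNorm ((fun x => L (φ i x)) - g) 2 (facetMeasure K z) +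
          eLpNorm (φ i) 2 (facetMeasure K z) := by
      have hLφ : AEStronglyMeasurable (fun x => L (φ i x)) (facetMeasure K z) :=
        (L.continuous.comp (hφ i).continuous).aestronglyMeasurable
      have htriangle := eLpNorm_sub_le hLφ (hLφ.sub hg.1) one_le_two
      rw [sub_sub_cancel, add_comm] at htriangle
      exact htriangle.trans (add_le_add le_rfl (eLpNorm_mono fun x => hL _))
    have hcell := hv.scaledH1Norm_sub_le (hv.sub hφi)
    rw [scaledH1Norm_sub_comm v (φ i), sub_sub_cancel] at hcell
    simp only [sub_sub_cancel] at hcell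
    calc s * eLpNorm g 2 (facetMeasure K z)
        ≤ s * eLpNorm ((fun x => L (φ i x)) - g) 2 (facetMeasure K z) +
            s * eLpNorm (φ i) 2 (facetMeasure K z) := by
          rw [← mul_add]
          gcongr
      _ ≤ _ := by
          refine add_le_add le_rfl ((hK.eLpNorm_facetMeasure_le hn hz hφ1).trans ?_)
          gcongr
  refine ge_of_tendsto' (x := atTop) ?_ hsmooth
  simpa using (ENNReal.Tendsto.const_mul hφg (Or.inr ENNReal.ofReal_ne_top)).add
    (ENNReal.Tendsto.const_mul (hφv.const_add (scaledH1Norm K v G)) (Or.inr ENNReal.coe_ne_top))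

end HasFacetTrace

lemma exists_tendsto_eLpNorm_sub {X F : Type*} [MeasurableSpace X] [NormedAddCommGroup F]
    [CompleteSpace F] {μ : Measure X} {f : ℕ → X → F} (hf : ∀ i, MemLp (f i) 2 μ)
    {b : ℕ → ℝ≥0∞} (hb : Tendsto b atTop (𝓝 0))
    (hfb : ∀ i j, eLpNorm (f i - f j) 2 μ ≤ b i + b j) :
    ∃ g, MemLp g 2 μ ∧ Tendsto (fun i => eLpNorm (f i - g) 2 μ) atTop (𝓝 0) := by
  have hcauchy : CauchySeq fun i => (hf i).toLp (f i) := by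
    refine EMetric.cauchySeq_iff.2 fun ε hε => ?_
    obtain ⟨N, hN⟩ := eventually_atTop.1 (hb.eventually_lt_const (ENNReal.half_pos hε.ne'))
    refine ⟨N, fun i hi j hj => ?_⟩
    rw [Lp.edist_toLp_toLp, ← ENNReal.add_halves ε]
    exact (hfb i j).trans_lt (ENNReal.add_lt_add (hN i hi) (hN j hj))
  obtain ⟨g, hg⟩ := cauchySeq_tendsto_of_complete hcauchy
  rw [tendsto_iff_edist_tendsto_0] at hg
  refine ⟨g, Lp.memLp g, hg.congr fun i => ?_⟩
  rw [Lp.edist_def]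
  exact eLpNorm_congr_ae ((hf i).coeFn_toLp.sub EventuallyEq.rfl)

lemma HasWeakGrad.exists_tendsto_facet [FiniteDimensional ℝ E] [CompleteSpace F]
    (hv : HasWeakGrad (cell K) v G) (hn : 0 < n) (hK : IsRegularSimplex γ K) (hz : z ∈ K)
    (hL : ∀ x, ‖L x‖ ≤ ‖x‖) {φ : ℕ → Pt n → E} (hφ : ∀ i, ContDiff ℝ 1 (φ i))
    (hφv : Tendsto (fun i => scaledH1Norm K (φ i - v)
      fun j => (fun x => fderiv ℝ (φ i) x (stdVec j)) - G j) atTop (𝓝 0)) :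
    ∃ g, MemLp g 2 (facetMeasure K z) ∧
      Tendsto (fun i => eLpNorm ((fun x => L (φ i x)) - g) 2 (facetMeasure K z)) atTop (𝓝 0) := by
  have := hK.isFiniteMeasure_facetMeasure hn hz
  have hs : ENNReal.ofReal (cellDiam K ^ (1 / 2 : ℝ)) ≠ 0 := by
    simpa using Real.rpow_pos_of_pos (hK.cellDiam_pos hn) _
  set s := ENNReal.ofReal (cellDiam K ^ (1 / 2 : ℝ))
  set e : ℕ → ℝ≥0∞ := fun i => scaledH1Norm K (φ i - v)
    fun j => (fun x => fderiv ℝ (φ i) x (stdVec j)) - G j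
  refine exists_tendsto_eLpNorm_sub (b := fun i => s⁻¹ * (traceConst n γ * e i))
    (fun i => memLp_facetMeasure (L.continuous.comp (hφ i).continuous)) ?_ fun i i' => ?_
  · simpa using ENNReal.Tendsto.const_mul (ENNReal.Tendsto.const_mul hφv
      (Or.inr ENNReal.coe_ne_top)) (Or.inr (ENNReal.inv_ne_top.2 hs))
  · have hcell := scaledH1Norm_fderiv_sub_le (hφ i) (hφ i') hv hv
    simp only [sub_self, sub_zero] at hcell
    rw [← mul_add, ← mul_add, ← ENNReal.mul_le_iff_le_inv hs ENNReal.ofReal_ne_top]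
    calc s * eLpNorm (L ∘ φ i - L ∘ φ i') 2 (facetMeasure K z)
        ≤ s * eLpNorm (φ i - φ i') 2 (facetMeasure K z) := by
          gcongr
          exact eLpNorm_mono fun x => by simpa using hL (φ i x - φ i' x)
      _ ≤ _ := hK.eLpNorm_facetMeasure_le hn hz ((hφ i).sub (hφ i'))
      _ ≤ traceConst n γ * (e i + e i') := by gcongr

end FacetTrace

section TangentialTrace

variable {n k : ℕ} {γ : ℝ} {K : Finset (Pt n)} {z : Pt n} {v : Form n k} {G : Fin n → Form n k}

/-- Restriction of alternating forms to the vectors tangent to the facet of `K` opposite to `z`. -/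
noncomputable def restrictFacet (K : Finset (Pt n)) (z : Pt n) (k : ℕ) :
    Alt (Pt n) k →L[ℝ] Alt (facetDir K z) k :=
  ContinuousAlternatingMap.compContinuousLinearMapCLM (facetDir K z).subtypeL

lemma pullbackBdry_eq_restrictFacet (v : Form n k) :
    pullbackBdry K v z = fun x => restrictFacet K z k (v x) :=
  rfl

lemma norm_restrictFacet_le (α : Alt (Pt n) k) : ‖restrictFacet K z k α‖ ≤ ‖α‖ := by
  refine (α.norm_compContinuousLinearMap_le _).trans ?_
  exact mul_le_of_le_one_right (norm_nonneg α)
    (pow_le_one₀ (ContinuousLinearMap.opNorm_nonneg _) (facetDir K z).norm_subtypeL_le)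

lemma IsTanTrace.hasFacetTrace {g : BdryForm K k} (h : IsTanTrace K v g)
    (hG : HasWeakGrad (cell K) v G) (hz : z ∈ K) :
    HasFacetTrace K z (restrictFacet K z k) v G (g z) := by
  obtain ⟨hg, φ, hφ, hφv, hφv1, hφg⟩ := h
  obtain ⟨c, hc⟩ := exists_nnnorm_le_mul_nnnorm_altCoeffs (Pt n) k
  obtain ⟨c', hc'⟩ := exists_nnnorm_le_mul_nnnorm_altCoeffs (facetDir K z) k
  refine ⟨hG, hg z hz, φ, hφ, ?_, ?_⟩
  · have hlim := hφv.add (ENNReal.Tendsto.const_mul (a := ENNReal.ofReal (cellDiam K))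
      (ENNReal.Tendsto.const_mul (a := n) hφv1 (Or.inr (ENNReal.natCast_ne_top n)))
      (Or.inr ENNReal.ofReal_ne_top))
    refine tendsto_zero_of_le_mul (c := c) (by simpa using hlim) fun i => ?_
    exact ((HasWeakGrad.of_contDiff isBounded_cell
      ((hφ i).of_le (by simp))).sub hG).scaledH1Norm_le_mul hc
  · refine tendsto_zero_of_le_mul (c := c') hφg fun i => (eLpNorm_le_mul_l2Norm hc' _).trans ?_
    gcongr
    exact le_rpow_half_sum_sq
      (fun z => l2Norm (facetMeasure K z) ((pullbackBdry K (φ i) - g) z)) hz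

lemma tendsto_bdryNorm_zero {g : ℕ → BdryForm K k}
    (h : ∀ z ∈ K, Tendsto (fun i => eLpNorm (g i z) 2 (facetMeasure K z)) atTop (𝓝 0)) :
    Tendsto (fun i => bdryNorm K (g i)) atTop (𝓝 0) := by
  have hsum := tendsto_finsetSum K h
  rw [Finset.sum_const_zero] at hsum
  refine tendsto_zero_of_le_mul (c := NNReal.sqrt (n ^ k)) hsum fun i =>
    (rpow_half_sum_sq_le_sum _ _).trans ?_
  rw [Finset.mul_sum]
  refine Finset.sum_le_sum fun z _ => l2Norm_le_mul_eLpNorm _ ?_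
  simpa using (facetDir K z).finrank_le

lemma HasWeakGrad.tendsto_sobolevSeminorm_one {φ : ℕ → Form n k} (hφ : ∀ i, ContDiff ℝ 1 (φ i))
    (hv : HasWeakGrad (cell K) v G)
    (hφG : ∀ j, Tendsto (fun i => eLpNorm ((fun x => fderiv ℝ (φ i) x (stdVec j)) - G j) 2
      (volume.restrict (cell K))) atTop (𝓝 0)) :
    Tendsto (fun i => sobolevSeminorm (cell K) 1 (φ i - v)) atTop (𝓝 0) := by
  have hsum := tendsto_finsetSum Finset.univ fun j _ => hφG j
  rw [Finset.sum_const_zero] at hsum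
  refine tendsto_zero_of_le_mul (c := NNReal.sqrt (n ^ k)) hsum fun i =>
    ((HasWeakGrad.of_contDiff isBounded_cell (hφ i)).sub hv).sobolevSeminorm_one_le.trans ?_
  rw [Finset.mul_sum]
  exact Finset.sum_le_sum fun j _ => l2Norm_le_mul_eLpNorm _ (by simp)

lemma HasWeakGrad.exists_isTanTrace (hv : HasWeakGrad (cell K) v G) (hn : 0 < n)
    (hK : IsRegularSimplex γ K) : ∃ g : BdryForm K k, IsTanTrace K v g := by
  obtain ⟨φ, hφ, hφv, hφG⟩ := hv.exists_smooth_approx isOpen_cell convex_cell isBounded_cell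
    hK.nonempty_cell
  have hφ1 : ∀ i, ContDiff ℝ 1 (φ i) := fun i => (hφ i).of_le (by simp)
  have hfacet : ∀ z ∈ K, ∃ g : Pt n → Alt (facetDir K z) k, MemLp g 2 (facetMeasure K z) ∧
      Tendsto (fun i => eLpNorm (pullbackBdry K (φ i) z - g) 2 (facetMeasure K z))
        atTop (𝓝 0) := by
    intro z hz
    have hL : ∀ α, ‖restrictFacet K z k α‖ ≤ ‖α‖ := norm_restrictFacet_le
    simp only [pullbackBdry_eq_restrictFacet]
    exact hv.exists_tendsto_facet (F := Alt (facetDir K z) k) hn hK hz hL hφ1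
      (tendsto_scaledH1Norm hφv hφG)
  choose! g hg using hfacet
  refine ⟨g, fun z hz => (hg z hz).1, φ, hφ, ?_, hv.tendsto_sobolevSeminorm_one hφ1 hφG,
    tendsto_bdryNorm_zero fun z hz => (hg z hz).2⟩
  exact tendsto_zero_of_le_mul (c := NNReal.sqrt (n ^ k)) hφv fun i =>
    l2Norm_le_mul_eLpNorm _ (by simp)

end TangentialTrace

section LocalEstimate

variable {n k : ℕ} {γ : ℝ} {K : Finset (Pt n)} {z : Pt n}

lemma HasFacetTrace.eLpNorm_facetMeasure_le_of_smooth {E F : Type*} [NormedAddCommGroup E]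
    [NormedSpace ℝ E] [FiniteDimensional ℝ E] [NormedAddCommGroup F] [NormedSpace ℝ F]
    {L : E →L[ℝ] F} {e p : Pt n → E} {G H : Fin n → Pt n → E} {g : Pt n → F} {C : ℝ≥0}
    (he : HasFacetTrace K z L e G g) (hL : ∀ x, ‖L x‖ ≤ ‖x‖) (hn : 0 < n)
    (hK : IsRegularSimplex γ K) (hz : z ∈ K) (hp : ContDiff ℝ ∞ p)
    (hpC : ENNReal.ofReal (cellDiam K ^ (1 / 2 : ℝ)) * eLpNorm p 2 (facetMeasure K z) ≤
      C * eLpNorm p 2 (volume.restrict (cell K)))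
    (hH : HasWeakGrad (cell K) (e - p) H) :
    ENNReal.ofReal (cellDiam K ^ (1 / 2 : ℝ)) * eLpNorm g 2 (facetMeasure K z) ≤
      (traceConst n γ + C : ℝ≥0) *
        (eLpNorm e 2 (volume.restrict (cell K)) + scaledH1Norm K (e - p) H) := by
  have := hK.isFiniteMeasure_facetMeasure hn hz
  set s := ENNReal.ofReal (cellDiam K ^ (1 / 2 : ℝ))
  have hrest := he.sub (.of_contDiff (L := L) hp)
  have htrace := (hrest.congr .rfl fun j =>
    hrest.hasWeakGrad.unique isOpen_cell hH j).eLpNorm_facetMeasure_le hL hn hK hz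
  have hfacet : eLpNorm g 2 (facetMeasure K z) ≤
      eLpNorm (g - fun x => L (p x)) 2 (facetMeasure K z) + eLpNorm p 2 (facetMeasure K z) := by
    have hLp : AEStronglyMeasurable (fun x => L (p x)) (facetMeasure K z) :=
      (L.continuous.comp hp.continuous).aestronglyMeasurable
    have htriangle := eLpNorm_add_le hrest.memLp.1 hLp one_le_two
    rw [sub_add_cancel] at htriangle
    exact htriangle.trans (add_le_add le_rfl (eLpNorm_mono fun x => hL (p x)))
  have hcell : eLpNorm p 2 (volume.restrict (cell K)) ≤
      eLpNorm e 2 (volume.restrict (cell K)) + scaledH1Norm K (e - p) H := by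
    have htriangle := eLpNorm_sub_le he.hasWeakGrad.memLp.1 hH.memLp.1 one_le_two
    rw [sub_sub_cancel] at htriangle
    exact htriangle.trans (add_le_add le_rfl le_self_add)
  calc s * eLpNorm g 2 (facetMeasure K z)
      ≤ s * eLpNorm (g - fun x => L (p x)) 2 (facetMeasure K z) +
          s * eLpNorm p 2 (facetMeasure K z) := by
        rw [← mul_add]
        gcongr
    _ ≤ traceConst n γ * (eLpNorm e 2 (volume.restrict (cell K)) + scaledH1Norm K (e - p) H) +
          C * (eLpNorm e 2 (volume.restrict (cell K)) + scaledH1Norm K (e - p) H) :=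
        add_le_add (htrace.trans (mul_le_mul_right le_add_self _))
          (hpC.trans (mul_le_mul_right hcell _))
    _ = _ := by rw [← add_mul, ENNReal.coe_add]

lemma IsRegularSimplex.scaledBdryNorm_le (hK : IsRegularSimplex γ K) {g : BdryForm K k}
    {a : ℝ≥0∞} (h : ∀ z ∈ K, ENNReal.ofReal (cellDiam K ^ (1 / 2 : ℝ)) *
      eLpNorm (g z) 2 (facetMeasure K z) ≤ a) :
    scaledBdryNorm K g ≤ ((n + 1) * NNReal.sqrt (n ^ k) : ℝ≥0) * a := by
  calc scaledBdryNorm K g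
      ≤ ∑ z ∈ K, ENNReal.ofReal (cellDiam K ^ (1 / 2 : ℝ)) *
          l2Norm (facetMeasure K z) (g z) := by
        rw [← Finset.mul_sum]
        exact mul_le_mul_right (rpow_half_sum_sq_le_sum _ _) _
    _ ≤ ∑ _z ∈ K, (NNReal.sqrt (n ^ k) : ℝ≥0∞) * a := by
        refine Finset.sum_le_sum fun z hz => ?_
        refine (mul_le_mul_right (l2Norm_le_mul_eLpNorm _
          (by simpa using (facetDir K z).finrank_le)) _).trans ?_
        rw [mul_left_comm]
        exact mul_le_mul_right (h z hz) _
    _ = _ := by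
        rw [Finset.sum_const, hK.card, nsmul_eq_mul, ← mul_assoc]
        push_cast
        rfl

lemma exists_scaledBdryNorm_le_of_isWeakJet (k R : ℕ) (hn : 0 < n) (γ : ℝ) {m : ℕ} (hm : 1 ≤ m) :
    ∃ C : ℝ≥0, ∀ K : Finset (Pt n), IsRegularSimplex γ K → ∀ θ : ℝ, 0 ≤ θ →
      ∀ v D, IsWeakJet (cell K) m v D →
      ∀ vh qh, qh ∈ polySpan n R (Alt (Pt n) k) → vh =ᵐ[volume.restrict (cell K)] qh →
      ∀ g gh : BdryForm K k, IsTanTrace K v g → IsTanTrace K vh gh →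
      scaledBdryNorm K (g - gh) ≤ C * (l2Norm (volume.restrict (cell K)) (v - vh) +
        ENNReal.ofReal (cellDiam K ^ (m + θ)) *
          (∑ α : Fin m → Fin n, slobodeckijSq (cell K) θ (D m α)) ^ (1 / 2 : ℝ)) := by
  obtain ⟨c, hc⟩ := exists_nnnorm_le_mul_nnnorm_altCoeffs (Pt n) k
  obtain ⟨Capprox, happrox⟩ := exists_polySpan_approx n k hn γ hm
  obtain ⟨Cinv, hinv⟩ := exists_inverse_facet_estimate (Alt (Pt n) k) hn (max R (m + 1)) γ
  refine ⟨(n + 1) * NNReal.sqrt (n ^ k) * ((traceConst n γ + Cinv) * (c + Capprox)),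
    fun K hK θ hθ v D hD vh qh hqh hvh g gh hg hgh => ?_⟩
  obtain ⟨q, hq, G, hG, hGle⟩ := happrox K hK θ hθ v D hD
  have hqqh := (polySpan n _ (Alt (Pt n) k)).sub_mem (polySpan_mono (le_max_right R (m + 1)) hq)
    (polySpan_mono (le_max_left R (m + 1)) hqh)
  have hgradh : HasWeakGrad (cell K) vh _ := (HasWeakGrad.of_contDiff isBounded_cell
    ((contDiff_of_mem_polySpan hqh).of_le (by simp))).congr hvh.symm fun _ => .rfl
  have hsplit : v - q =ᵐ[volume.restrict (cell K)] v - vh - (q - qh) := by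
    filter_upwards [hvh] with x hx
    simp only [Pi.sub_apply, hx]
    abel
  rw [scaledH1Norm_congr hsplit fun _ => .rfl] at hGle
  set Q := (∑ α : Fin m → Fin n, slobodeckijSq (cell K) θ (D m α)) ^ (1 / 2 : ℝ)
  refine (hK.scaledBdryNorm_le (a := (traceConst n γ + Cinv : ℝ≥0) *
    ((c + Capprox : ℝ≥0) * (l2Norm (volume.restrict (cell K)) (v - vh) +
      ENNReal.ofReal (cellDiam K ^ (m + θ)) * Q))) fun z hz => ?_).trans_eq ?_
  · have hL : ∀ α, ‖restrictFacet K z k α‖ ≤ ‖α‖ := norm_restrictFacet_le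
    have htrace := ((hg.hasFacetTrace (hD.hasWeakGrad_of_one_le isOpen_cell hm) hz).sub
      (hgh.hasFacetTrace hgradh hz)).eLpNorm_facetMeasure_le_of_smooth hL hn hK hz
      (contDiff_of_mem_polySpan hqqh) (hinv K hK z hz _ hqqh) (hG.congr hsplit fun _ => .rfl)
    refine htrace.trans (mul_le_mul_right ?_ _)
    rw [mul_add]
    refine add_le_add ((eLpNorm_le_mul_l2Norm hc _).trans ?_) (hGle.trans ?_)
    · gcongr
      exact le_self_add
    · gcongr
      exact le_add_self
  · push_cast
    ring

lemma exists_scaledBdryNorm_le (k R : ℕ) (hn : 0 < n) (γ M : ℝ) :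
    ∃ C : ℝ≥0, 0 < C ∧ ∀ K : Finset (Pt n), IsRegularSimplex γ K → ∀ t ∈ Icc 1 M,
      ∀ v vh qh, qh ∈ polySpan n R (Alt (Pt n) k) → vh =ᵐ[volume.restrict (cell K)] qh →
      ∀ g gh : BdryForm K k, IsTanTrace K v g → IsTanTrace K vh gh →
      scaledBdryNorm K (g - gh) ≤ C * (l2Norm (volume.restrict (cell K)) (v - vh) +
        ENNReal.ofReal (cellDiam K ^ t) * sobolevSeminorm (cell K) t v) := by
  choose! C hC using fun m (hm : 1 ≤ m) =>
    exists_scaledBdryNorm_le_of_isWeakJet k R hn γ hm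
  set S := 1 + ∑ m ∈ Finset.Icc 1 ⌊M⌋₊, C m
  have hS : 0 < S := by positivity
  refine ⟨S, hS, fun K hK t ht v vh qh hqh hvh g gh hg hgh => ?_⟩
  have hfloor : 1 ≤ ⌊t⌋₊ := Nat.one_le_floor_iff t |>.2 ht.1
  have hle : C ⌊t⌋₊ ≤ S := by
    refine le_trans ?_ le_add_self
    exact Finset.single_le_sum (f := C) (fun _ _ => zero_le)
      (Finset.mem_Icc.2 ⟨hfloor, Nat.floor_mono ht.2⟩)
  have hh : ENNReal.ofReal (cellDiam K ^ t) ≠ 0 := by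
    simpa using Real.rpow_pos_of_pos (hK.cellDiam_pos hn) t
  simp only [sobolevSeminorm, ENNReal.mul_iInf_of_ne (ENNReal.coe_ne_zero.2 hS.ne')
    ENNReal.coe_ne_top, ENNReal.mul_iInf_of_ne hh ENNReal.ofReal_ne_top, ENNReal.add_iInf]
  refine le_iInf₂ fun D hD => ?_
  have hjet := hC ⌊t⌋₊ hfloor K hK (t - ⌊t⌋₊)
    (sub_nonneg.2 (Nat.floor_le (zero_le_one.trans ht.1))) v D hD vh qh hqh hvh g gh hg hgh
  rw [add_sub_cancel] at hjet
  exact hjet.trans (mul_le_mul_left (ENNReal.coe_le_coe.2 hle) _)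

end LocalEstimate

section GlobalEstimate

variable {n k : ℕ} {Ω U : Set (Pt n)} {T : Finset (Finset (Pt n))}

lemma IsWeakJet.mono {m : ℕ} {v : Form n k} {D : (i : ℕ) → (Fin i → Fin n) → Form n k}
    (h : IsWeakJet Ω m v D) (hΩ : MeasurableSet Ω) (hU : U ⊆ Ω) : IsWeakJet U m v D := by
  have hμ : (volume : Measure (Pt n)).restrict U ≤ volume.restrict Ω :=
    Measure.restrict_mono_set _ hU
  refine ⟨h.memL2.mono_measure hμ, fun i hi α => (h.memL2_deriv i hi α).mono_measure hμ,
    fun i hi α φ hφ hφc hφU => ?_⟩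
  have hφ0 : ∀ x ∉ U, φ x = 0 := fun x hx =>
    image_eq_zero_of_notMem_tsupport fun hx' => hx (hφU hx')
  have hDφ0 : ∀ x ∉ U, iteratedFDeriv ℝ i φ x = 0 := fun x hx =>
    image_eq_zero_of_notMem_tsupport fun hx' => hx (hφU (tsupport_iteratedFDeriv_subset i hx'))
  rw [← setIntegral_eq_of_subset_of_forall_sdiff_eq_zero hΩ hU,
    ← setIntegral_eq_of_subset_of_forall_sdiff_eq_zero hΩ hU]
  · exact h.eq i hi α φ hφ hφc (hφU.trans hU)
  · intro x hx
    rw [hφ0 x hx.2, zero_smul]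
  · intro x hx
    rw [hDφ0 x hx.2, zero_apply, zero_smul]

section Superadditivity

variable (hTΩ : ∀ K ∈ T, cell K ⊆ Ω) (hT : (T : Set (Finset (Pt n))).PairwiseDisjoint cell)

include hTΩ hT

lemma sum_setLIntegral_cell_le (f : Pt n → ℝ≥0∞) :
    ∑ K ∈ T, ∫⁻ x in cell K, f x ≤ ∫⁻ x in Ω, f x := by
  rw [← lintegral_biUnion_finset hT fun K _ => isOpen_cell.measurableSet]
  exact lintegral_mono_set (iUnion₂_subset hTΩ)

lemma sum_l2Norm_sq_le (v : Form n k) :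
    ∑ K ∈ T, l2Norm (volume.restrict (cell K)) v ^ 2 ≤ l2Norm (volume.restrict Ω) v ^ 2 := by
  simp only [l2Norm, rpow_half_sq]
  exact sum_setLIntegral_cell_le hTΩ hT _

lemma sum_slobodeckijSq_le (θ : ℝ) (v : Form n k) :
    ∑ K ∈ T, slobodeckijSq (cell K) θ v ≤ slobodeckijSq Ω θ v := by
  unfold slobodeckijSq
  split_ifs
  · exact sum_l2Norm_sq_le hTΩ hT v
  · refine (Finset.sum_le_sum fun K hK => ?_).trans (sum_setLIntegral_cell_le hTΩ hT _)
    exact lintegral_mono fun x => lintegral_mono_set (hTΩ K hK)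

lemma sum_sobolevSeminorm_sq_le (hΩ : MeasurableSet Ω) (t : ℝ) (v : Form n k) :
    ∑ K ∈ T, sobolevSeminorm (cell K) t v ^ 2 ≤ sobolevSeminorm Ω t v ^ 2 := by
  refine rpow_half_le_iff.1 (le_iInf₂ fun D hD => ENNReal.rpow_le_rpow ?_ (by norm_num))
  calc ∑ K ∈ T, sobolevSeminorm (cell K) t v ^ 2
      ≤ ∑ K ∈ T, ∑ α : Fin ⌊t⌋₊ → Fin n, slobodeckijSq (cell K) (t - ⌊t⌋₊) (D ⌊t⌋₊ α) := by
        refine Finset.sum_le_sum fun K hK => ?_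
        rw [← rpow_half_sq (∑ α : Fin ⌊t⌋₊ → Fin n, _)]
        exact pow_le_pow_left' (iInf₂_le D (hD.mono hΩ (hTΩ K hK))) 2
    _ ≤ ∑ α : Fin ⌊t⌋₊ → Fin n, slobodeckijSq Ω (t - ⌊t⌋₊) (D ⌊t⌋₊ α) := by
        rw [Finset.sum_comm]
        exact Finset.sum_le_sum fun α _ => sum_slobodeckijSq_le hTΩ hT _ _

end Superadditivity

lemma cellDiam_le_meshSize {K : Finset (Pt n)} (hK : K ∈ T) : cellDiam K ≤ meshSize T :=
  le_csSup (T.finite_toSet.image _).bddAbove (mem_image_of_mem _ hK)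

lemma TraceEstimate.mono {C C' t : ℝ} {v vh : Form n k} (h : TraceEstimate Ω T C t v vh)
    (hC : C ≤ C') : TraceEstimate Ω T C' t v vh where
  exists_trace := h.exists_trace
  exists_trace_discrete := h.exists_trace_discrete
  local_estimate K hK g gh hg hgh := (h.local_estimate K hK g gh hg hgh).trans
    (mul_le_mul_left (ENNReal.ofReal_le_ofReal hC) _)
  global_estimate g gh hg hgh := (h.global_estimate g gh hg hgh).trans
    (mul_le_mul_left (ENNReal.ofReal_le_ofReal hC) _)

lemma TraceEstimate.of_local (hn : 0 < n) (hΩ : MeasurableSet Ω) (hT : IsMesh Ω T) {C t : ℝ}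
    (ht : 0 ≤ t) {v vh : Form n k} (hv : ∀ K ∈ T, ∃ g, IsTanTrace K v g)
    (hvh : ∀ K ∈ T, ∃ gh, IsTanTrace K vh gh)
    (hle : ∀ K ∈ T, ∀ g gh : BdryForm K k, IsTanTrace K v g → IsTanTrace K vh gh →
      scaledBdryNorm K (g - gh) ≤ ENNReal.ofReal C *
        (l2Norm (volume.restrict (cell K)) (v - vh) +
          ENNReal.ofReal (cellDiam K ^ t) * sobolevSeminorm (cell K) t v)) :
    TraceEstimate Ω T C t v vh where
  exists_trace := hv
  exists_trace_discrete := hvh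
  local_estimate := hle
  global_estimate g gh hg hgh := by
    have hdisj := hT.pairwise_disjoint_cell hn
    refine rpow_half_sum_sq_le_mul_add (fun K hK => ?_) (sum_l2Norm_sq_le hT.cell_subset hdisj _)
      (sum_sobolevSeminorm_sq_le hT.cell_subset hdisj hΩ t v)
    refine (hle K hK _ _ (hg K hK) (hgh K hK)).trans ?_
    gcongr
    · exact Metric.diam_nonneg
    · exact cellDiam_le_meshSize hK

lemma subset_polySpan_of_eq_polyForms_or_eq_polyFormsMinus {r : ℕ} {W : Set (Form n k)}
    (hW : (∃ s ≤ r + 1, W = polyForms n s k) ∨ W = polyFormsMinus n (r + 1) k) :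
    W ⊆ polySpan n (r + 1) (Alt (Pt n) k) := by
  rcases hW with ⟨s, hs, rfl⟩ | rfl
  · exact (polyForms_subset_polySpan s).trans (polySpan_mono hs)
  · exact polyFormsMinus_subset_polySpan r

end GlobalEstimate

end TanTrace

open TanTrace in
theorem mainTheorem6_general (n k R : ℕ) (hn : 0 < n) (γ M : ℝ) :
    ∃ C : ℝ, 0 < C ∧ ∀ (Ω : Set (Pt n)) (T : Finset (Finset (Pt n))),
      MeasurableSet Ω → IsMesh Ω T → IsShapeRegular γ T →
      ∀ v vh : Form n k, (∀ K ∈ T, MemSobolev (cell K) 1 v) →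
        (∀ K ∈ T, ∃ q ∈ polySpan n R (Alt (Pt n) k),
          vh =ᵐ[volume.restrict (cell K)] q) →
      ∀ t ∈ Icc 1 M, TraceEstimate Ω T C t v vh := by
  obtain ⟨C, hC, hlocal⟩ := exists_scaledBdryNorm_le k R hn γ M
  refine ⟨C, hC, fun Ω T hΩ hT hγ v vh hv hvh t ht => ?_⟩
  have hK : ∀ K ∈ T, IsRegularSimplex γ K := fun K => hT.isRegularSimplex hγ
  refine .of_local hn hΩ hT (zero_le_one.trans ht.1) (fun K hKT => ?_) (fun K hKT => ?_)
    fun K hKT g gh hg hgh => ?_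
  · obtain ⟨G, hG⟩ := (hv K hKT).exists_hasWeakGrad isOpen_cell
    exact hG.exists_isTanTrace hn (hK K hKT)
  · obtain ⟨q, hq, hvhq⟩ := hvh K hKT
    have hgrad := HasWeakGrad.of_contDiff (U := cell K)
      isBounded_cell ((contDiff_of_mem_polySpan hq).of_le (by simp))
    exact (hgrad.congr hvhq.symm fun _ => .rfl).exists_isTanTrace hn (hK K hKT)
  · obtain ⟨q, hq, hvhq⟩ := hvh K hKT
    rw [ENNReal.ofReal_coe_nnreal]
    exact hlocal K (hK K hKT) t ht v vh q hq hvhq g gh hg hgh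

theorem mainTheorem6 (n r : ℕ) (hn : 0 < n) (γ s : ℝ) (hs : 0 ≤ s) :
    -- forms of degree `k = j + 1`
    (∀ j : ℕ, ∃ C : ℝ, 0 < C ∧
      ∀ (Ω : Set (TanTrace.Pt n)) (T : Finset (Finset (TanTrace.Pt n))),
        IsOpen Ω → TanTrace.IsMesh Ω T → TanTrace.IsShapeRegular γ T →
      ∀ (W' : Set (TanTrace.Form n j)) (W : Set (TanTrace.Form n (j + 1))),
        (W' = TanTrace.polyForms n (r + 1) j ∨ W' = TanTrace.polyFormsMinus n (r + 1) j) →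
        ((1 ≤ r ∧ W = TanTrace.polyForms n r (j + 1)) ∨
          W = TanTrace.polyFormsMinus n (r + 1) (j + 1)) →
      ∀ (f : TanTrace.Form n (j + 1))
        (σ : TanTrace.Form n j) (u p : TanTrace.Form n (j + 1))
        (σh : TanTrace.Form n j) (uh ph : TanTrace.Form n (j + 1)),
        TanTrace.MemL2 Ω f →
        TanTrace.IsMixedSolution Ω (TanTrace.HLambda Ω j) (TanTrace.HLambda Ω (j + 1)) f σ u p →
        TanTrace.IsMixedSolution Ω (TanTrace.feSpace Ω T W') (TanTrace.feSpace Ω T W)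
          f σh uh ph →
        (∀ K ∈ T, TanTrace.MemSobolev (TanTrace.cell K) 1 σ) →
        (∀ K ∈ T, TanTrace.MemSobolev (TanTrace.cell K) 1 u) →
        (W' = TanTrace.polyForms n (r + 1) j → s ≤ (r : ℝ) + 1 →
          TanTrace.TraceEstimate Ω T C (s + 1) σ σh) ∧
        (W' = TanTrace.polyFormsMinus n (r + 1) j → s ≤ (r : ℝ) →
          TanTrace.TraceEstimate Ω T C (s + 1) σ σh) ∧
        (W = TanTrace.polyFormsMinus n 1 (j + 1) →
          TanTrace.TraceEstimate Ω T C 1 u uh) ∧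
        (s ≤ (r : ℝ) - 1 →
          TanTrace.TraceEstimate Ω T C (s + 2) u uh)) ∧
    -- forms of degree `k = 0`
    (∃ C : ℝ, 0 < C ∧
      ∀ (Ω : Set (TanTrace.Pt n)) (T : Finset (Finset (TanTrace.Pt n))),
        IsOpen Ω → TanTrace.IsMesh Ω T → TanTrace.IsShapeRegular γ T →
      ∀ (W : Set (TanTrace.Form n 0)),
        ((1 ≤ r ∧ W = TanTrace.polyForms n r 0) ∨ W = TanTrace.polyFormsMinus n (r + 1) 0) →
      ∀ (f u p uh ph : TanTrace.Form n 0),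
        TanTrace.MemL2 Ω f →
        TanTrace.IsMixedSolutionZero Ω (TanTrace.HLambda Ω 0) f u p →
        TanTrace.IsMixedSolutionZero Ω (TanTrace.feSpace Ω T W) f uh ph →
        (∀ K ∈ T, TanTrace.MemSobolev (TanTrace.cell K) 1 u) →
        (W = TanTrace.polyFormsMinus n 1 0 →
          TanTrace.TraceEstimate Ω T C 1 u uh) ∧
        (s ≤ (r : ℝ) - 1 →
          TanTrace.TraceEstimate Ω T C (s + 2) u uh)) := by
  have hs1 : s + 1 ∈ Icc 1 (s + 2) := ⟨by linarith, by linarith⟩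
  have hs2 : s + 2 ∈ Icc 1 (s + 2) := ⟨by linarith, le_rfl⟩
  have h1 : 1 ∈ Icc 1 (s + 2) := ⟨le_rfl, by linarith⟩
  refine ⟨fun j => ?_, ?_⟩
  · obtain ⟨C', hC', hest'⟩ := mainTheorem6_general n j (r + 1) hn γ (s + 2)
    obtain ⟨C, -, hest⟩ := mainTheorem6_general n (j + 1) (r + 1) hn γ (s + 2)
    refine ⟨max C' C, lt_max_of_lt_left hC', fun Ω T hΩ hT hγ W' W hW' hW f σ u p σh uh ph _ _ hh
      hσ hu => ?_⟩
    have hW'r := TanTrace.subset_polySpan_of_eq_polyForms_or_eq_polyFormsMinus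
      (hW'.imp_left fun h => ⟨r + 1, le_rfl, h⟩)
    have hWr := TanTrace.subset_polySpan_of_eq_polyForms_or_eq_polyFormsMinus
      (hW.imp_left fun h => ⟨r, r.le_succ, h.2⟩)
    have hσest := fun t ht => (hest' Ω T hΩ.measurableSet hT hγ σ σh hσ (fun K hK =>
      (hh.sigma_mem.2 K hK).imp fun _ => .imp_left (@hW'r _)) t ht).mono (le_max_left C' C)
    have huest := fun t ht => (hest Ω T hΩ.measurableSet hT hγ u uh hu (fun K hK =>
      (hh.u_mem.2 K hK).imp fun _ => .imp_left (@hWr _)) t ht).mono (le_max_right C' C)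
    exact ⟨fun _ _ => hσest _ hs1, fun _ _ => hσest _ hs1, fun _ => huest _ h1,
      fun _ => huest _ hs2⟩
  · obtain ⟨C, hC, hest⟩ := mainTheorem6_general n 0 (r + 1) hn γ (s + 2)
    refine ⟨C, hC, fun Ω T hΩ hT hγ W hW f u p uh ph _ _ hh hu => ?_⟩
    have hWr := TanTrace.subset_polySpan_of_eq_polyForms_or_eq_polyFormsMinus
      (hW.imp_left fun h => ⟨r, r.le_succ, h.2⟩)
    have huest := hest Ω T hΩ.measurableSet hT hγ u uh hu fun K hK =>
      (hh.u_mem.2 K hK).imp fun _ => .imp_left (@hWr _)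
    exact ⟨fun _ => huest _ h1, fun _ => huest _ hs2⟩
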